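/- Let $n\ge 0$, let $0<a_1<\dots<a_k<n$ be integers, and put $a_{k+1}=n$. Let $S_n(a)$ be the set of permutations $w\in S_n$ whose descent positions $\{i : w(i)>w(i+1)\}$ all lie in $\{a_1,\dots,a_k\}$. Let $\ell(w)$ be the number of inversions of $w$, let $t_{bc}$ be the transposition of $b$ and $c$, and $s_i=t_{i,i+1}$. Let $\mathfrak S_w\in\mathbb Z[x_1,\dots,x_n]$ be the Schubert polynomial: $\mathfrak S_{w_0}=x_1^{n-1}x_2^{n-2}\cdots x_{n-1}$ for the longest permutation $w_0$, and $\mathfrak S_w=\partial_i\mathfrak S_{ws_i}$ if $\ell(ws_i)=\ell(w)+1$, where $\partial_i P=(P-s_iP)/(x_i-x_{i+1})$. Write $e^m_j=e_j(x_1,\dots,x_m)$ for the elementary symmetric polynomials. For $1\le r\le m\le n-1$ and $\alpha=s_rs_{r+1}\cdots s_m$, of length $\ell=m-r+1$, write $u\xrightarrow{\alpha}v$ if there are integers $b_1,\dots,b_\ell$ and $c_1,\dots,c_\ell$ in $\{1,\dots,n\}$, with the $b_i$ distinct and $b_i\le m<c_i$, such that $v=u\,t_{b_1c_1}\cdots t_{b_\ell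 c_\ell}$ and $\ell(u\,t_{b_1c_1}\cdots t_{b_ic_i})=\ell(u)+i$ for $1\le i\le \ell$. Let $w\in S_n(a)$. If $w\ne 1$, then there is a largest $p\le k$ with $w(a_p+1)\ne a_p+1$. Set $u(i)=w(i)$ if $i\le a_p$ and $w(i)<w(a_p+1)$; $u(i)=w(i)-1$ if $i\le a_p$ and $w(i)>w(a_p+1)$; and $u(i)=w(i+1)-1$ if $i>a_p$ (where $w(n+1)=n+1$). Let $\alpha=s_{w(a_p+1)}\cdots s_{a_p-1}s_{a_p}$. Then: 1. For $w\neq1$: $w(a_p+1)<a_p+1$, the map $u$ is a permutation in $S_n(a)$, $u\xrightarrow{\alpha}w$, every $v$ with $u\xrightarrow{\alpha}v$ is in $S_n(a)$, and $$\mathfrak S_w=\mathfrak S_u\cdot e^{a_p}_{a_p+1-w(a_p+1)}-\sum_{u\xrightarrow{\alpha}v\ne w}\mathfrak S_v .\qquad(*)$$ 2. The recursive procedure which expands $\mathfrak S_w$ by applying $(*)$ to $w$, and then to $u$ and to all the permutations $v$ on the right hand side, and so on, stopping at $\mathfrak S_1=1$, terminates: there is no infinite chain of recursive calls starting at $w$,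 and the procedure returns exactly one result, a formal integral polynomial in symbols for the $e^{a_p}_j$ ($1\le p\le k$, $j\geq 1$). 3. The result is an integral linear combination, formally in these symbols (with $e_0=1$), and hence as an identity of polynomials $$\mathfrak S_w=\sum c_{i_{a_1},\dots,i_{n-1}}\,e^{(a)}_{i_{a_1},\dots,i_{n-1}},\qquad c_{i_{a_1},\dots,i_{n-1}}\in\mathbb Z,$$ of the products $e^{(a)}_{i_{a_1},\dots,i_{n-1}}=\prod_{p=1}^k\prod_{r=a_p}^{a_{p+1}-1}e_{i_r}(x_1,\dots,x_{a_p})$, over finitely many sequences of integers with $0\le i_r\le a_p$ whenever $a_p\le r<a_{p+1}$. -/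

import Mathlib

open MvPolynomial Finset

/-! Indexing: `Fin n` is `0, …, n-1`, so the position (or value) written `i` in `1, …, n` is the
element of `Fin n` with value `i - 1`, and the variable `x_i` is `X ⟨i - 1, _⟩`. -/

namespace Schub

/-- The length of a permutation: its number of inversions. -/
def len {n : ℕ} (w : Equiv.Perm (Fin n)) : ℕ :=
  #{ij : Fin n × Fin n | ij.1 < ij.2 ∧ w ij.2 < w ij.1}

/-- The simple transposition exchanging the adjacent (zero-based) positions `i` and `i + 1`. -/
def simpleSwap {n : ℕ} (i : ℕ) (hi : i + 1 < n) : Equiv.Perm (Fin n) :=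
  Equiv.swap ⟨i, Nat.lt_of_succ_lt hi⟩ ⟨i + 1, hi⟩

theorem len_le {n : ℕ} (w : Equiv.Perm (Fin n)) : len w ≤ n * n := by
  refine (Finset.card_le_univ _).trans ?_
  simp

theorem sub_dvd_sub_swap {n : ℕ} (i j : Fin n) (P : MvPolynomial (Fin n) ℤ) :
    (X i - X j : MvPolynomial (Fin n) ℤ) ∣ P - rename (Equiv.swap i j) P := by
  induction P using MvPolynomial.induction_on with
  | C c => simp
  | add P Q hP hQ =>
    have h := dvd_add hP hQ
    rw [map_add]
    convert h using 1
    ring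
  | mul_X P l hP =>
    have hl : (X i - X j : MvPolynomial (Fin n) ℤ) ∣ X l - X (Equiv.swap i j l) := by
      rcases eq_or_ne l i with rfl | h1
      · simp
      rcases eq_or_ne l j with rfl | h2
      · rw [Equiv.swap_apply_right]
        exact dvd_sub_comm.mp dvd_rfl
      · rw [Equiv.swap_apply_of_ne_of_ne h1 h2, sub_self]
        exact dvd_zero _
    have h := dvd_add (hP.mul_right (X l))
      (hl.mul_left (rename (Equiv.swap i j) P))
    rw [map_mul, rename_X]
    convert h using 1
    ring

/-- The divided difference: the polynomial `Q` with
`P = P(x_i ↔ x_j) + (x_i - x_j) * Q`. -/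
noncomputable def dividedDiff {n : ℕ} (i j : Fin n) (P : MvPolynomial (Fin n) ℤ) :
    MvPolynomial (Fin n) ℤ :=
  (sub_dvd_sub_swap i j P).choose

theorem dividedDiff_spec {n : ℕ} (i j : Fin n) (P : MvPolynomial (Fin n) ℤ) :
    P - rename (Equiv.swap i j) P = (X i - X j) * dividedDiff i j P :=
  (sub_dvd_sub_swap i j P).choose_spec

/-- The Schubert polynomial. If some simple transposition `s` has `ℓ(w s) = ℓ(w) + 1`, take the
first one and apply its divided difference to the polynomial of `w s`; there is no such `s` exactly
when `w` is the longest permutation, whose polynomial is `x_1^(n-1) x_2^(n-2) ⋯ x_(n-1)`. -/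
noncomputable def schubert {n : ℕ} (w : Equiv.Perm (Fin n)) : MvPolynomial (Fin n) ℤ :=
  open Classical in
  if h : ∃ i : ℕ, ∃ hi : i + 1 < n, len (w * simpleSwap i hi) = len w + 1 then
    dividedDiff ⟨Nat.find h, Nat.lt_of_succ_lt (Nat.find_spec h).1⟩
      ⟨Nat.find h + 1, (Nat.find_spec h).1⟩
      (schubert (w * simpleSwap (Nat.find h) (Nat.find_spec h).1))
  else ∏ i : Fin n, X i ^ (n - 1 - (i : ℕ))
termination_by n * n - len w
decreasing_by
  have h1 := (Nat.find_spec h).2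
  have h2 := len_le (w * simpleSwap (Nat.find h) (Nat.find_spec h).1)
  omega

/-- `e_j(x_1, …, x_m)` as a polynomial in `x_1, …, x_n`, for `m < n`. -/
noncomputable def elemSym {n : ℕ} (m : Fin n) (j : ℕ) : MvPolynomial (Fin n) ℤ :=
  rename (Fin.castLE m.isLt.le) (esymm (Fin (m : ℕ)) ℤ j)

/-- The relation `u →^α v` for the cyclic permutation `α = s_r s_(r+1) ⋯ s_m` (with `1 ≤ r ≤ m`),
of length `m + 1 - r`; the list `L` holds the pairs `(b_1, c_1), …, (b_ℓ, c_ℓ)`. -/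
def PieriArrow {n : ℕ} (r m : ℕ) (u v : Equiv.Perm (Fin n)) : Prop :=
  ∃ L : List (Fin n × Fin n),
    L.length = m + 1 - r ∧
    (∀ t ∈ L, (t.1 : ℕ) < m ∧ m ≤ (t.2 : ℕ)) ∧
    v = u * (L.map fun t => Equiv.swap t.1 t.2).prod ∧
    (∀ i, 1 ≤ i → i ≤ L.length →
      len (u * ((L.take i).map fun t => Equiv.swap t.1 t.2).prod) = len u + i) ∧
    (L.map Prod.fst).Nodup

/-! Below, `a : Fin k → Fin n` is the sequence `a_1 < ⋯ < a_k`. Note that the element `a p` of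
`Fin n`, used as a position, is the position written `a_p + 1` in one-based indexing. -/

/-- `S_n(a)`: all descent positions lie in `{a_1, …, a_k}`. -/
def IsIn {n k : ℕ} (a : Fin k → Fin n) (w : Equiv.Perm (Fin n)) : Prop :=
  ∀ (i : ℕ) (hi : i + 1 < n),
    w ⟨i + 1, hi⟩ < w ⟨i, Nat.lt_of_succ_lt hi⟩ → ∃ p, (a p : ℕ) = i + 1

/-- `p` is maximal with `w(a_p + 1) ≠ a_p + 1` (one-based). -/
def IsPivot {n k : ℕ} (a : Fin k → Fin n) (w : Equiv.Perm (Fin n)) (p : Fin k) : Prop :=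
  w (a p) ≠ a p ∧ ∀ q, p < q → w (a q) = a q

/-- `u` is given by `u(i) = w(i)` if `i ≤ a_p` and `w(i) < w(a_p + 1)`, by `u(i) = w(i) - 1` if
`i ≤ a_p` and `w(i) > w(a_p + 1)`, and by `u(i) = w(i + 1) - 1` if `i > a_p` (one-based, where
`w(n + 1) = n + 1`). -/
def IsReduction {n k : ℕ} (a : Fin k → Fin n) (w : Equiv.Perm (Fin n)) (p : Fin k)
    (u : Equiv.Perm (Fin n)) : Prop :=
  (∀ i, i < a p → w i < w (a p) → u i = w i) ∧
  (∀ i, i < a p → w (a p) < w i → (u i : ℕ) = (w i : ℕ) - 1) ∧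
  (∀ (i : ℕ) (hi : i + 1 < n), (a p : ℕ) ≤ i →
    (u ⟨i, Nat.lt_of_succ_lt hi⟩ : ℕ) = (w ⟨i + 1, hi⟩ : ℕ) - 1) ∧
  (∀ i : Fin n, (i : ℕ) + 1 = n → u i = i)

/-- `u →^α v` with `α = s_{w(a_p + 1)} ⋯ s_{a_p}` (one-based). -/
def StepArrow {n k : ℕ} (a : Fin k → Fin n) (w : Equiv.Perm (Fin n)) (p : Fin k)
    (u v : Equiv.Perm (Fin n)) : Prop :=
  PieriArrow ((w (a p) : ℕ) + 1) (a p) u v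

/-- The permutations `v ≠ w` with `u →^α v`, over which the recursive identity subtracts. -/
noncomputable def others {n k : ℕ} (a : Fin k → Fin n) (w : Equiv.Perm (Fin n)) (p : Fin k)
    (u : Equiv.Perm (Fin n)) : Finset (Equiv.Perm (Fin n)) :=
  open Classical in {v | StepArrow a w p u v ∧ v ≠ w}

/-- The index `a_p + 1 - w(a_p + 1)` of the elementary symmetric polynomial used at `w`. -/
def stepDegree {n k : ℕ} (a : Fin k → Fin n) (w : Equiv.Perm (Fin n)) (p : Fin k) : ℕ :=
  (a p : ℕ) - (w (a p) : ℕ)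

/-- `Calls a v w`: the recursive identity at `w` has `v` on its right hand side. -/
def Calls {n k : ℕ} (a : Fin k → Fin n) (v w : Equiv.Perm (Fin n)) : Prop :=
  ∃ (p : Fin k) (u : Equiv.Perm (Fin n)), IsPivot a w p ∧ IsReduction a w p u ∧
    (v = u ∨ v ∈ others a w p u)

/-- Formal symbol for `e_j(x_1, …, x_{a_p})`, with the convention `e_0 = 1`. -/
noncomputable def eSymbol {k : ℕ} (p : Fin k) (j : ℕ) : MvPolynomial (Fin k × ℕ) ℤ :=
  if j = 0 then 1 else X (p, j)

/-- `Expands a w F`: the recursion, started at `w`, stops and returns the formal expression `F`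
in the symbols `e_j(x_1, …, x_{a_p})`. It returns `1` at the identity; elsewhere it first expands
all the permutations on the right hand side of the recursive identity. -/
inductive Expands {n k : ℕ} (a : Fin k → Fin n) :
    Equiv.Perm (Fin n) → MvPolynomial (Fin k × ℕ) ℤ → Prop
  | one : Expands a 1 1
  | step (w : Equiv.Perm (Fin n)) (p : Fin k) (u : Equiv.Perm (Fin n))
      (F : MvPolynomial (Fin k × ℕ) ℤ)
      (G : Equiv.Perm (Fin n) → MvPolynomial (Fin k × ℕ) ℤ)
      (hp : IsPivot a w p) (hu : IsReduction a w p u) (hF : Expands a u F)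
      (hG : ∀ v, v ∈ others a w p u → Expands a v (G v)) :
      Expands a w (F * eSymbol p (stepDegree a w p) - ∑ v ∈ others a w p u, G v)

/-- `a_{p+1}`, with `a_{k+1} = n`. -/
def next {n k : ℕ} (a : Fin k → Fin n) (p : Fin k) : ℕ :=
  if h : (p : ℕ) + 1 < k then (a ⟨p + 1, h⟩ : ℕ) else n

/-- The indices `r` with `a_p ≤ r < a_{p+1}`. -/
def block {n k : ℕ} (a : Fin k → Fin n) (p : Fin k) : Finset (Fin n) :=
  {r | a p ≤ r ∧ (r : ℕ) < next a p}

/-- Sequences `(i_{a_1}, …, i_{n-1})` with `0 ≤ i_r ≤ a_p` for `a_p ≤ r < a_{p+1}`; the unused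
entries `i_r` with `r < a_1` are set to `0`. -/
def Admissible {n k : ℕ} (a : Fin k → Fin n) (i : Fin n → ℕ) : Prop :=
  (∀ p, ∀ r ∈ block a p, i r ≤ (a p : ℕ)) ∧ (∀ r, (∀ p, r < a p) → i r = 0)

/-- `e^{(a)}_{i_{a_1}, …, i_{n-1}}`. -/
noncomputable def eProd {n k : ℕ} (a : Fin k → Fin n) (i : Fin n → ℕ) :
    MvPolynomial (Fin n) ℤ :=
  ∏ p, ∏ r ∈ block a p, elemSym (a p) (i r)

/-- The same product as a formal expression. -/
noncomputable def eProdSymbol {n k : ℕ} (a : Fin k → Fin n) (i : Fin n → ℕ) :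
    MvPolynomial (Fin k × ℕ) ℤ :=
  ∏ p, ∏ r ∈ block a p, eSymbol p (i r)

end Schub

/-!
Why the statement holds. Schubert polynomials are studied through the linear functionals `phi w`,
the constant coefficient of the divided difference `∂_w`. They do not depend on the reduced word
(`confluence`) and are dual to the Schubert polynomials (`phi_schubert`).

Multiplication by a variable is transposed by the Leibniz rule into the dual of Monk's rule
(`phi_X_mul`): `phi w (x_m f)` is a signed sum of `phi (w t) f` over the transpositions `t` at `m`
that lower the length by one. All the permutations involved lie in the same finite symmetric group,
so that no infinite one is needed. From this the dual of Pieri's rule (`phi_elemFirst_mul`)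
follows: `phi w (e_j(x_1, …, x_m) f)` is the sum of `phi u f` over the starting points `u` of the
saturated chains of `j` transpositions `(b, c)`, with `b ≤ m < c` and distinct `b`, that end at `w`.
At a descent of `w` other than `m`, both sides are conjugated by the simple transposition
(`up_conj_iff`); if there is none before `m`, the recursion for `e_j` in the number of variables
is matched with one for chains (`Up.of_succ`, `Up.succ_of_swap`, `up_swap_unique`), which has no
cancellations, as all the signs in the dual of Monk's rule are positive.

The functionals determine every polynomial whose exponents lie below the staircase
`(n - 1, n - 2, …, 0)` (`BelowStaircase.eq_zero`). If `u` fixes the last position, then the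
exponents of `schubert u` lie below `(n - 2, n - 3, …, 0, 0)`, so those of the product with
`e_j(x_1, …, x_m)`, `m < n`, lie below the staircase, and Pieri's rule itself follows inside `S_n`
(`schubert_mul_elemSym`). The recursive identity is this rule for the reduction `u` of `w`, with the
term of `w` singled out: `IsRed.exists_chain` gives the chain from `u` to `w`.

For termination, `u` is shorter than `w`, while the other `v` have the length of `w`. For these
the pivot stays the same, and the value at the pivot drops, or stays and the sum of the values on
the left of it grows (`callMeasure_lt`). The result has the required form because one step of the
recursion lowers by one the number of positions that may be moved when it passes to `u`, which frees
one index in the block of the pivot for the new factor (`Expands.mem_span`).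
-/

namespace Schub

/-! ### Inversions -/

theorem simpleSwap_lt_iff {n : ℕ} {i : ℕ} (hi : i + 1 < n) {x y : Fin n}
    (h : y ≠ simpleSwap i hi x) :
    simpleSwap i hi x < simpleSwap i hi y ↔ x < y := by
  obtain ⟨x, hx⟩ := x
  obtain ⟨y, hy⟩ := y
  simp only [simpleSwap, Equiv.swap_apply_def, Fin.mk.injEq, ne_eq] at *
  split_ifs at * <;> simp only [Fin.lt_def, Fin.mk.injEq] at * <;> omega

theorem simpleSwap_mul_self {n : ℕ} {i : ℕ} (hi : i + 1 < n) :
    simpleSwap i hi * simpleSwap i hi = 1 := Equiv.swap_mul_self _ _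

theorem mul_simpleSwap_cancel {n : ℕ} {i : ℕ} (hi : i + 1 < n) (w : Equiv.Perm (Fin n)) :
    w * simpleSwap i hi * simpleSwap i hi = w := by
  rw [mul_assoc, simpleSwap_mul_self, mul_one]

theorem simpleSwap_left {n : ℕ} {i : ℕ} (hi : i + 1 < n) :
    simpleSwap i hi ⟨i, Nat.lt_of_succ_lt hi⟩ = ⟨i + 1, hi⟩ := Equiv.swap_apply_left _ _

theorem simpleSwap_right {n : ℕ} {i : ℕ} (hi : i + 1 < n) :
    simpleSwap i hi ⟨i + 1, hi⟩ = ⟨i, Nat.lt_of_succ_lt hi⟩ := Equiv.swap_apply_right _ _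

theorem simpleSwap_of_ne {n : ℕ} {i : ℕ} (hi : i + 1 < n) {x : Fin n} (h1 : (x : ℕ) ≠ i)
    (h2 : (x : ℕ) ≠ i + 1) : simpleSwap i hi x = x :=
  Equiv.swap_apply_of_ne_of_ne (fun h => h1 (congrArg Fin.val h)) (fun h => h2 (congrArg Fin.val h))

/-- `w` has an ascent at the (zero-based) position `i`. -/
def Asc {n : ℕ} (w : Equiv.Perm (Fin n)) (i : ℕ) (hi : i + 1 < n) : Prop :=
  w ⟨i, Nat.lt_of_succ_lt hi⟩ < w ⟨i + 1, hi⟩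

theorem not_asc {n : ℕ} {w : Equiv.Perm (Fin n)} {i : ℕ} {hi : i + 1 < n} :
    ¬ Asc w i hi ↔ w ⟨i + 1, hi⟩ < w ⟨i, Nat.lt_of_succ_lt hi⟩ := by
  unfold Asc
  rw [not_lt, le_iff_lt_or_eq, or_iff_left]
  intro h
  have := w.injective h
  simp at this

theorem asc_mul_simpleSwap {n : ℕ} {w : Equiv.Perm (Fin n)} {i : ℕ} {hi : i + 1 < n} :
    Asc (w * simpleSwap i hi) i hi ↔ ¬ Asc w i hi := by
  rw [not_asc]
  simp only [Asc, Equiv.Perm.mul_apply, simpleSwap_left, simpleSwap_right]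

theorem len_mul_simpleSwap {n : ℕ} {w : Equiv.Perm (Fin n)} {i : ℕ} {hi : i + 1 < n}
    (h : Asc w i hi) : len (w * simpleSwap i hi) = len w + 1 := by
  set s := simpleSwap i hi with hs
  have hss : ∀ x, s (s x) = x := fun x => by
    rw [← Equiv.Perm.mul_apply, simpleSwap_mul_self]; rfl
  have key : ({ij : Fin n × Fin n | ij.1 < ij.2 ∧ (w * s) ij.2 < (w * s) ij.1} : Finset _) =
      insert (⟨i, Nat.lt_of_succ_lt hi⟩, ⟨i + 1, hi⟩)
        (({ij : Fin n × Fin n | ij.1 < ij.2 ∧ w ij.2 < w ij.1} : Finset _).map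
          (Equiv.prodCongr s s).toEmbedding) := by
    ext ⟨x, y⟩
    rw [mem_filter_univ, mem_insert, mem_map_equiv, mem_filter_univ]
    simp only [Equiv.Perm.mul_apply,
      Equiv.prodCongr_symm, Equiv.prodCongr_apply, Prod.map_apply, Prod.mk.injEq]
    have hsymm : s.symm = s := Equiv.symm_swap _ _
    rw [hsymm]
    by_cases hxy : y = s x
    · subst hxy
      rw [hss]
      by_cases hx1 : (x : ℕ) = i
      · obtain rfl : x = ⟨i, Nat.lt_of_succ_lt hi⟩ := Fin.ext hx1
        rw [simpleSwap_left]
        exact ⟨fun _ => Or.inl ⟨rfl, rfl⟩, fun _ => ⟨Nat.lt_succ_self i, h⟩⟩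
      by_cases hx2 : (x : ℕ) = i + 1
      · obtain rfl : x = ⟨i + 1, hi⟩ := Fin.ext hx2
        rw [simpleSwap_right]
        refine ⟨fun h' => absurd h'.1 (not_lt_of_gt (Nat.lt_succ_self i)), ?_⟩
        rintro (⟨h', -⟩ | ⟨-, h'⟩)
        · simp at h'
        · exact absurd h' (not_lt_of_gt h)
      · rw [simpleSwap_of_ne hi hx1 hx2]
        refine ⟨fun h' => absurd h'.1 (lt_irrefl _), ?_⟩
        rintro (⟨h', -⟩ | ⟨h', -⟩)
        · exact absurd (congrArg Fin.val h') hx1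
        · exact absurd h' (lt_irrefl _)
    · rw [simpleSwap_lt_iff hi hxy]
      refine ⟨Or.inr, ?_⟩
      rintro (⟨rfl, rfl⟩ | h')
      · exact absurd (simpleSwap_left hi).symm hxy
      · exact h'
  unfold len
  rw [key, card_insert_of_notMem, card_map]
  rw [mem_map_equiv, mem_filter_univ]
  simp only [not_and, Equiv.prodCongr_symm, Equiv.prodCongr_apply, Prod.map_apply]
  have hsymm : s.symm = s := Equiv.symm_swap _ _
  rw [hsymm, simpleSwap_left, simpleSwap_right]
  intro h'
  simp [Fin.lt_def] at h'

theorem len_mul_simpleSwap_of_not_asc {n : ℕ} {w : Equiv.Perm (Fin n)} {i : ℕ} {hi : i + 1 < n}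
    (h : ¬ Asc w i hi) : len (w * simpleSwap i hi) + 1 = len w := by
  rw [← len_mul_simpleSwap (asc_mul_simpleSwap.mpr h), mul_simpleSwap_cancel]

theorem asc_iff_len {n : ℕ} {w : Equiv.Perm (Fin n)} {i : ℕ} {hi : i + 1 < n} :
    len (w * simpleSwap i hi) = len w + 1 ↔ Asc w i hi := by
  refine ⟨fun h => ?_, len_mul_simpleSwap⟩
  by_contra h'
  have := len_mul_simpleSwap_of_not_asc h'
  omega

/-- The length after exchanging two values in increasing position: besides the new inversion,
every entry lying between them in position and in value contributes two inversions. -/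
theorem len_mul_swap {n : ℕ} (d : ℕ) : ∀ (u : Equiv.Perm (Fin n)) (b c : Fin n),
    (c : ℕ) = b + d → u b < u c →
    len (u * Equiv.swap b c) =
      len u + 1 + 2 * #{x : Fin n | b < x ∧ x < c ∧ u b < u x ∧ u x < u c} := by
  -- moving the left position one step to the right conjugates by a simple transposition
  induction d with
  | zero =>
    intro u b c hd h
    obtain rfl : c = b := Fin.ext hd
    exact absurd h (lt_irrefl _)
  | succ d ih =>
    intro u b c hd h
    rcases Nat.eq_zero_or_pos d with rfl | hd0
    · have hb : (b : ℕ) + 1 < n := by have := c.isLt; omega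
      have hc : c = ⟨b + 1, hb⟩ := Fin.ext hd
      subst hc
      have := len_mul_simpleSwap (w := u) (hi := hb) h
      rw [show Equiv.swap b ⟨b + 1, hb⟩ = simpleSwap b hb from rfl, this]
      rw [Finset.card_eq_zero.mpr]
      rw [Finset.filter_eq_empty_iff]
      rintro x - ⟨h1, h2, -⟩
      simp only [Fin.lt_def] at h1 h2
      omega
    · have hb : (b : ℕ) + 1 < n := by have := c.isLt; omega
      set b' : Fin n := ⟨b + 1, hb⟩ with hb'
      set s := simpleSwap (b : ℕ) hb with hs
      have hbc : b ≠ c := fun e => by rw [e] at h; exact lt_irrefl _ h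
      have hb'c : b' ≠ c := fun e => by have := congrArg Fin.val e; simp [hb'] at this; omega
      have hbb' : b ≠ b' := fun e => by have := congrArg Fin.val e; simp [hb'] at this
      have hsc : s c = c := Equiv.swap_apply_of_ne_of_ne hbc.symm hb'c.symm
      have hsb : s b = b' := simpleSwap_left hb
      have hsb' : s b' = b := simpleSwap_right hb
      have hconj : Equiv.swap b c = s * Equiv.swap b' c * s := by
        have := Equiv.swap_apply_apply s b' c
        rw [hsb', hsc] at this
        rw [this, show s⁻¹ = s from Equiv.swap_inv _ _]
      have ih' := ih (u * s) b' c (by simp [hb']; omega)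
        (by simpa [hsc, hsb'] using h)
      have hcard : #{x : Fin n | b < x ∧ x < c ∧ u b < u x ∧ u x < u c} =
          (if u b < u b' ∧ u b' < u c then 1 else 0) +
          #{x : Fin n | b' < x ∧ x < c ∧ (u * s) b' < (u * s) x ∧ (u * s) x < (u * s) c} := by
        rw [← Finset.card_filter_add_card_filter_not (p := fun x => x = b')]
        congr 1
        · rw [Finset.filter_filter]
          split_ifs with h0
          · rw [Finset.card_eq_one]
            refine ⟨b', ?_⟩
            ext x
            simp only [mem_filter, mem_univ, true_and, mem_singleton]
            refine ⟨fun hx => hx.2, ?_⟩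
            rintro rfl
            refine ⟨⟨?_, ?_, h0⟩, rfl⟩ <;> simp [Fin.lt_def, hb']
            omega
          · rw [Finset.card_eq_zero, Finset.filter_eq_empty_iff]
            rintro x - ⟨hx, rfl⟩
            exact h0 hx.2.2
        · rw [Finset.filter_filter]
          congr 1
          ext x
          simp only [mem_filter, mem_univ, true_and, Equiv.Perm.mul_apply, hsc, hsb']
          constructor
          · rintro ⟨⟨h1, h2, h3⟩, h4⟩
            have hx : s x = x := by
              refine simpleSwap_of_ne hb (by simp only [Fin.lt_def] at h1; omega) ?_
              intro e; exact h4 (Fin.ext e)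
            rw [hx]
            refine ⟨?_, h2, h3⟩
            simp only [Fin.lt_def, hb', Fin.ext_iff] at h1 h4 ⊢
            omega
          · rintro ⟨h1, h2, h3⟩
            simp only [Fin.lt_def, hb'] at h1
            have hx : s x = x := simpleSwap_of_ne hb (by omega) (by omega)
            rw [hx] at h3
            refine ⟨⟨?_, h2, h3⟩, ?_⟩
            · simp only [Fin.lt_def]; omega
            · simp only [Fin.ext_iff, hb']; omega
      rw [hcard, hconj, ← mul_assoc, ← mul_assoc]
      have hne1 : u b ≠ u b' := fun e => hbb' (u.injective e)
      have hne2 : u b' ≠ u c := fun e => hb'c (u.injective e)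
      have a1 : Asc u b hb ↔ u b < u b' := Iff.rfl
      have a2 : Asc (u * s * Equiv.swap b' c) b hb ↔ u b' < u c := by
        change (u * s * Equiv.swap b' c) b < (u * s * Equiv.swap b' c) b' ↔ _
        simp [Equiv.swap_apply_of_ne_of_ne hbb' hbc, hsb, hsc]
      have e1 : len (u * s) + (if u b < u b' then 0 else 1) =
          len u + (if u b < u b' then 1 else 0) := by
        split_ifs with h0
        · exact len_mul_simpleSwap (a1.mpr h0)
        · exact len_mul_simpleSwap_of_not_asc (mt a1.mp h0)
      have e2 : len (u * s * Equiv.swap b' c * s) + (if u b' < u c then 0 else 1) =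
          len (u * s * Equiv.swap b' c) + (if u b' < u c then 1 else 0) := by
        split_ifs with h0
        · exact len_mul_simpleSwap (a2.mpr h0)
        · exact len_mul_simpleSwap_of_not_asc (mt a2.mp h0)
      by_cases h1 : u b < u b' <;> by_cases h2 : u b' < u c <;>
        simp only [h1, h2, if_true, if_false, and_self, and_true, and_false] at e1 e2 ⊢
      · omega
      · omega
      · omega
      · exfalso
        have h3 := lt_of_le_of_ne (not_lt.mp h1) hne1.symm
        have h4 := lt_of_le_of_ne (not_lt.mp h2) hne2.symm
        exact lt_asymm h (h4.trans h3)

theorem len_lt_len_mul_swap {n : ℕ} {u : Equiv.Perm (Fin n)} {b c : Fin n} (hbc : b < c)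
    (h : u b < u c) : len u < len (u * Equiv.swap b c) := by
  rw [len_mul_swap (c - b) u b c (by simp only [Fin.lt_def] at hbc; omega) h]
  omega

theorem len_mul_swap_lt {n : ℕ} {u : Equiv.Perm (Fin n)} {b c : Fin n} (hbc : b < c)
    (h : u c < u b) : len (u * Equiv.swap b c) < len u := by
  have := len_lt_len_mul_swap (u := u * Equiv.swap b c) hbc (by simpa using h)
  rwa [mul_assoc, Equiv.swap_mul_self, mul_one] at this

theorem len_one {n : ℕ} : len (1 : Equiv.Perm (Fin n)) = 0 := by
  rw [len, Finset.card_eq_zero, Finset.filter_eq_empty_iff]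
  rintro x - ⟨h1, h2⟩
  exact lt_asymm h1 h2

theorem apply_eq_of_le {n : ℕ} {w : Equiv.Perm (Fin n)} {M : ℕ}
    (h : ∀ x : Fin n, M ≤ (x : ℕ) → x ≤ w x) (x : Fin n) (hx : M ≤ (x : ℕ)) : w x = x := by
  induction x using WellFoundedGT.induction with
  | ind x ih =>
    by_contra hne
    have h1 := lt_of_le_of_ne (h x hx) (Ne.symm hne)
    have h2 := ih (w x) h1 (hx.trans (by simp only [Fin.lt_def] at h1; omega))
    exact hne (w.injective h2)

theorem lt_of_asc {n : ℕ} {w : Equiv.Perm (Fin n)} {lo up : ℕ}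
    (h : ∀ i hi, lo ≤ i → i + 1 ≤ up → Asc w i hi) {x y : Fin n} (hx : lo ≤ (x : ℕ)) (hxy : x < y)
    (hy : (y : ℕ) ≤ up) : w x < w y := by
  obtain ⟨d, hd⟩ := Nat.exists_eq_add_of_lt hxy
  induction d generalizing y with
  | zero =>
    have hi : (x : ℕ) + 1 < n := by have := y.isLt; omega
    obtain rfl : y = ⟨x + 1, hi⟩ := Fin.ext hd
    exact h x hi hx hy
  | succ d ih =>
    have hi : (x + d + 1 : ℕ) + 1 < n := by have := y.isLt; omega
    obtain rfl : y = ⟨x + d + 1 + 1, hi⟩ := Fin.ext hd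
    refine (ih (y := ⟨x + d + 1, Nat.lt_of_succ_lt hi⟩) ?_ ?_ rfl).trans
      (h (x + d + 1) hi (by omega) hy)
    · simp only [Fin.lt_def]; omega
    · simp only at hy ⊢; omega

theorem eq_one_of_asc {n : ℕ} {w : Equiv.Perm (Fin n)} (h : ∀ i hi, Asc w i hi) : w = 1 := by
  have hm : StrictMono w := by
    cases n with
    | zero => exact fun x => x.elim0
    | succ n => exact Fin.strictMono_iff_lt_succ.mpr fun i => h i (by omega)
  ext x
  rw [apply_eq_of_le (M := 0) (fun x _ => hm.id_le x) x (Nat.zero_le _)]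
  rfl

/-! ### Divided differences -/

theorem X_sub_X_ne_zero {n : ℕ} {i j : Fin n} (h : i ≠ j) :
    (X i - X j : MvPolynomial (Fin n) ℤ) ≠ 0 :=
  sub_ne_zero.mpr fun e => h (X_injective e)

theorem dividedDiff_eq {n : ℕ} {i j : Fin n} (h : i ≠ j) {P Q : MvPolynomial (Fin n) ℤ}
    (hQ : P - rename (Equiv.swap i j) P = (X i - X j) * Q) : dividedDiff i j P = Q :=
  mul_left_cancel₀ (X_sub_X_ne_zero h) ((dividedDiff_spec i j P).symm.trans hQ)

theorem dividedDiff_add {n : ℕ} {i j : Fin n} (h : i ≠ j) (P Q : MvPolynomial (Fin n) ℤ) :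
    dividedDiff i j (P + Q) = dividedDiff i j P + dividedDiff i j Q := by
  refine dividedDiff_eq h ?_
  rw [map_add, mul_add, ← dividedDiff_spec, ← dividedDiff_spec]
  ring

theorem dividedDiff_smul {n : ℕ} {i j : Fin n} (h : i ≠ j) (z : ℤ) (P : MvPolynomial (Fin n) ℤ) :
    dividedDiff i j (z • P) = z • dividedDiff i j P := by
  refine dividedDiff_eq h ?_
  rw [map_smul, mul_smul_comm, ← dividedDiff_spec, smul_sub]

theorem dividedDiff_mul {n : ℕ} {i j : Fin n} (h : i ≠ j) (P Q : MvPolynomial (Fin n) ℤ) :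
    dividedDiff i j (P * Q) =
      dividedDiff i j P * Q + rename (Equiv.swap i j) P * dividedDiff i j Q := by
  refine dividedDiff_eq h ?_
  rw [map_mul]
  linear_combination Q * dividedDiff_spec i j P +
    rename (Equiv.swap i j) P * dividedDiff_spec i j Q

theorem dividedDiff_eq_zero {n : ℕ} {i j : Fin n} (h : i ≠ j) {P : MvPolynomial (Fin n) ℤ}
    (hP : rename (Equiv.swap i j) P = P) : dividedDiff i j P = 0 :=
  dividedDiff_eq h (by rw [hP]; ring)

theorem dividedDiff_mul_of_symm {n : ℕ} {i j : Fin n} (h : i ≠ j) {P : MvPolynomial (Fin n) ℤ}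
    (hP : rename (Equiv.swap i j) P = P) (Q : MvPolynomial (Fin n) ℤ) :
    dividedDiff i j (P * Q) = P * dividedDiff i j Q := by
  rw [dividedDiff_mul h, dividedDiff_eq_zero h hP, hP, zero_mul, zero_add]

theorem rename_swap_swap {n : ℕ} (i j : Fin n) (P : MvPolynomial (Fin n) ℤ) :
    rename (Equiv.swap i j) (rename (Equiv.swap i j) P) = P := by
  rw [rename_rename]
  convert rename_id_apply P
  ext x
  simp

theorem rename_dividedDiff {n : ℕ} {i j : Fin n} (h : i ≠ j) (P : MvPolynomial (Fin n) ℤ) :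
    rename (Equiv.swap i j) (dividedDiff i j P) = dividedDiff i j P := by
  have h1 := congrArg (rename (Equiv.swap i j)) (dividedDiff_spec i j P)
  rw [map_sub, rename_swap_swap, map_mul, map_sub, rename_X, rename_X, Equiv.swap_apply_left,
    Equiv.swap_apply_right] at h1
  refine mul_left_cancel₀ (X_sub_X_ne_zero h) ?_
  linear_combination h1 + dividedDiff_spec i j P

theorem dividedDiff_dividedDiff {n : ℕ} {i j : Fin n} (h : i ≠ j) (P : MvPolynomial (Fin n) ℤ) :
    dividedDiff i j (dividedDiff i j P) = 0 :=
  dividedDiff_eq_zero h (rename_dividedDiff h P)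

theorem dividedDiff_comm {n : ℕ} {i j k l : Fin n} (hij : i ≠ j) (hkl : k ≠ l) (hik : i ≠ k)
    (hil : i ≠ l) (hjk : j ≠ k) (hjl : j ≠ l) (P : MvPolynomial (Fin n) ℤ) :
    dividedDiff i j (dividedDiff k l P) = dividedDiff k l (dividedDiff i j P) := by
  have e1 : rename (Equiv.swap i j) (rename (Equiv.swap k l) P) =
      rename (Equiv.swap k l) (rename (Equiv.swap i j) P) := by
    have hd : Equiv.swap i j * Equiv.swap k l = Equiv.swap k l * Equiv.swap i j :=
      (Equiv.Perm.disjoint_swap_swap (by simp [*])).commute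
    rw [rename_rename, rename_rename, ← Equiv.Perm.coe_mul, ← Equiv.Perm.coe_mul, hd]
  have h1 := congrArg (rename (Equiv.swap i j)) (dividedDiff_spec k l P)
  have h2 := congrArg (rename (Equiv.swap k l)) (dividedDiff_spec i j P)
  rw [map_sub, map_mul, map_sub, rename_X, rename_X, Equiv.swap_apply_of_ne_of_ne hik.symm hjk.symm,
    Equiv.swap_apply_of_ne_of_ne hil.symm hjl.symm, e1] at h1
  rw [map_sub, map_mul, map_sub, rename_X, rename_X, Equiv.swap_apply_of_ne_of_ne hik hil,
    Equiv.swap_apply_of_ne_of_ne hjk hjl] at h2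
  refine mul_left_cancel₀ (mul_ne_zero (X_sub_X_ne_zero hij) (X_sub_X_ne_zero hkl)) ?_
  linear_combination -(X k - X l) * dividedDiff_spec i j (dividedDiff k l P) +
    (X i - X j) * dividedDiff_spec k l (dividedDiff i j P)
    + h1 - h2 - dividedDiff_spec k l P + dividedDiff_spec i j P

/-- The alternating sum over the symmetric group of `i, j, k` that computes the triple divided
difference. -/
theorem dividedDiff_triple {n : ℕ} {i j k : Fin n} (hij : i ≠ j) (hjk : j ≠ k) (hik : i ≠ k)
    (P : MvPolynomial (Fin n) ℤ) :
    (X i - X j) * (X j - X k) * (X i - X k) *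
      dividedDiff i j (dividedDiff j k (dividedDiff i j P)) =
      P - rename (Equiv.swap i j) P - rename (Equiv.swap j k) P
        + rename (Equiv.swap j k) (rename (Equiv.swap i j) P)
        + rename (Equiv.swap i j) (rename (Equiv.swap j k) P)
        - rename (Equiv.swap i k) P := by
  set A := dividedDiff i j P with hA
  set B := dividedDiff j k A with hB
  have hAs : rename (Equiv.swap i j) A = A := rename_dividedDiff hij P
  have h0 := dividedDiff_spec i j P
  have h1 := dividedDiff_spec j k A
  have h2 := dividedDiff_spec i j B
  have h3 := congrArg (rename (Equiv.swap i j)) h1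
  have h4 := congrArg (rename (Equiv.swap j k)) h0
  have h5 := congrArg (rename (Equiv.swap i j)) h4
  have e : rename (Equiv.swap i j) (rename (Equiv.swap j k) (rename (Equiv.swap i j) P)) =
      rename (Equiv.swap i k) P := by
    rw [rename_rename, rename_rename, ← Equiv.Perm.coe_mul, ← Equiv.Perm.coe_mul]
    have := Equiv.swap_apply_apply (Equiv.swap i j) j k
    rw [Equiv.swap_apply_right, Equiv.swap_apply_of_ne_of_ne hik.symm hjk.symm,
      Equiv.swap_inv] at this
    rw [this, mul_assoc]
  simp only [map_sub, map_mul, rename_X, Equiv.swap_apply_left, Equiv.swap_apply_right,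
    Equiv.swap_apply_of_ne_of_ne hij hik, Equiv.swap_apply_of_ne_of_ne hik.symm hjk.symm, hAs,
    ← hA, ← hB, e] at h0 h1 h2 h3 h4 h5
  linear_combination -(X j - X k) * (X i - X k) * h2 - (X i - X k) * h1 + (X j - X k) * h3
    - h0 + h4 - h5

theorem dividedDiff_braid {n : ℕ} {i j k : Fin n} (hij : i ≠ j) (hjk : j ≠ k) (hik : i ≠ k)
    (P : MvPolynomial (Fin n) ℤ) :
    dividedDiff i j (dividedDiff j k (dividedDiff i j P)) =
      dividedDiff j k (dividedDiff i j (dividedDiff j k P)) := by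
  have h1 := dividedDiff_triple hij hjk hik P
  -- exchanging `i` and `k` changes the sign of all three factors and of all three operators
  have h2 := dividedDiff_triple hjk.symm hij.symm hik.symm P
  have hc : ∀ (x y : Fin n) (Q : MvPolynomial (Fin n) ℤ),
      dividedDiff x y Q = - dividedDiff y x Q ∨ x = y := by
    intro x y Q
    by_cases hxy : x = y
    · exact Or.inr hxy
    left
    refine dividedDiff_eq hxy ?_
    rw [Equiv.swap_comm]
    linear_combination dividedDiff_spec y x Q
  have hneg : ∀ {x y : Fin n} (_ : x ≠ y) (Q : MvPolynomial (Fin n) ℤ),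
      dividedDiff x y (-Q) = - dividedDiff x y Q := by
    intro x y hxy Q
    have := dividedDiff_smul hxy (-1) Q
    simpa using this
  rw [(hc k j _).resolve_right hjk.symm, (hc j i _).resolve_right hij.symm,
    (hc k j P).resolve_right hjk.symm, hneg hij, neg_neg,
    Equiv.swap_comm k j, Equiv.swap_comm j i, Equiv.swap_comm k i] at h2
  refine mul_left_cancel₀ (mul_ne_zero (mul_ne_zero (X_sub_X_ne_zero hij) (X_sub_X_ne_zero hjk))
    (X_sub_X_ne_zero hik)) ?_
  linear_combination h1 - h2

/-- The divided difference at the adjacent positions `i` and `i + 1`. -/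
noncomputable def ddiff {n : ℕ} (i : ℕ) (hi : i + 1 < n) :
    MvPolynomial (Fin n) ℤ →ₗ[ℤ] MvPolynomial (Fin n) ℤ where
  toFun := dividedDiff ⟨i, Nat.lt_of_succ_lt hi⟩ ⟨i + 1, hi⟩
  map_add' := dividedDiff_add (by simp)
  map_smul' := dividedDiff_smul (by simp)

theorem ddiff_spec {n : ℕ} {i : ℕ} (hi : i + 1 < n) (P : MvPolynomial (Fin n) ℤ) :
    P - rename (simpleSwap i hi) P =
      (X ⟨i, Nat.lt_of_succ_lt hi⟩ - X ⟨i + 1, hi⟩) * ddiff i hi P :=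
  dividedDiff_spec _ _ P

theorem ddiff_eq {n : ℕ} {i : ℕ} (hi : i + 1 < n) {P Q : MvPolynomial (Fin n) ℤ}
    (h : P - rename (simpleSwap i hi) P = (X ⟨i, Nat.lt_of_succ_lt hi⟩ - X ⟨i + 1, hi⟩) * Q) :
    ddiff i hi P = Q :=
  dividedDiff_eq (by simp) h

theorem ddiff_mul {n : ℕ} {i : ℕ} (hi : i + 1 < n) (P Q : MvPolynomial (Fin n) ℤ) :
    ddiff i hi (P * Q) = ddiff i hi P * Q + rename (simpleSwap i hi) P * ddiff i hi Q :=
  dividedDiff_mul (by simp) P Q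

theorem ddiff_mul_of_symm {n : ℕ} {i : ℕ} (hi : i + 1 < n) {P : MvPolynomial (Fin n) ℤ}
    (hP : rename (simpleSwap i hi) P = P) (Q : MvPolynomial (Fin n) ℤ) :
    ddiff i hi (P * Q) = P * ddiff i hi Q :=
  dividedDiff_mul_of_symm (by simp) hP Q

theorem ddiff_ddiff {n : ℕ} {i : ℕ} (hi : i + 1 < n) (P : MvPolynomial (Fin n) ℤ) :
    ddiff i hi (ddiff i hi P) = 0 :=
  dividedDiff_dividedDiff (by simp) P

theorem ddiff_comm {n : ℕ} {i j : ℕ} (hi : i + 1 < n) (hj : j + 1 < n) (hij : i + 1 < j)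
    (P : MvPolynomial (Fin n) ℤ) :
    ddiff i hi (ddiff j hj P) = ddiff j hj (ddiff i hi P) := by
  refine dividedDiff_comm ?_ ?_ ?_ ?_ ?_ ?_ P <;> simp <;> omega

theorem ddiff_braid {n : ℕ} {i : ℕ} (hi : i + 1 < n) (hi' : i + 1 + 1 < n)
    (P : MvPolynomial (Fin n) ℤ) :
    ddiff i hi (ddiff (i + 1) hi' (ddiff i hi P)) =
      ddiff (i + 1) hi' (ddiff i hi (ddiff (i + 1) hi' P)) := by
  refine dividedDiff_braid ?_ ?_ ?_ P <;> simp
  omega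

/-! ### Independence of the chosen reduced word -/

theorem simpleSwap_comm {n : ℕ} {i j : ℕ} (hi : i + 1 < n) (hj : j + 1 < n) (hij : i + 1 < j) :
    simpleSwap i hi * simpleSwap j hj = simpleSwap j hj * simpleSwap i hi := by
  refine (Equiv.Perm.disjoint_swap_swap ?_).commute
  simp
  omega

theorem simpleSwap_braid {n : ℕ} {i : ℕ} (hi : i + 1 < n) (hi' : i + 1 + 1 < n) :
    simpleSwap i hi * simpleSwap (i + 1) hi' * simpleSwap i hi =
      simpleSwap (i + 1) hi' * simpleSwap i hi * simpleSwap (i + 1) hi' := by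
  have h1 := Equiv.swap_apply_apply (simpleSwap i hi) ⟨i + 1, hi⟩ ⟨i + 1 + 1, hi'⟩
  have h2 := Equiv.swap_apply_apply (simpleSwap (i + 1) hi') ⟨i, Nat.lt_of_succ_lt hi⟩ ⟨i + 1, hi⟩
  have e : simpleSwap (i + 1) hi' ⟨i + 1, hi⟩ = ⟨i + 1 + 1, hi'⟩ := simpleSwap_left hi'
  rw [simpleSwap_right, simpleSwap_of_ne hi (by simp; omega) (by simp)] at h1
  rw [e, simpleSwap_of_ne hi' (by simp) (by simp; omega)] at h2
  exact h1.symm.trans h2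

/-- If operators `d i` satisfy the commutation and braid relations, and `g w = d i (g (w s_i))`
for one position `i` at which `w` is ordered by `r`, then this holds for every such position.
It is applied with `r` being `<` (ascents) and `>` (descents). -/
theorem confluence {n : ℕ} {M : Type*} (r : Fin n → Fin n → Prop) [IsStrictTotalOrder (Fin n) r]
    (μ : Equiv.Perm (Fin n) → ℕ) (d : ∀ i, i + 1 < n → M → M)
    (hμ : ∀ w i hi, r (w ⟨i, Nat.lt_of_succ_lt hi⟩) (w ⟨i + 1, hi⟩) →
      μ (w * simpleSwap i hi) < μ w)
    (hcomm : ∀ i j hi hj x, i + 1 < j → d i hi (d j hj x) = d j hj (d i hi x))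
    (hbraid : ∀ i hi hi' x, d i hi (d (i + 1) hi' (d i hi x)) =
      d (i + 1) hi' (d i hi (d (i + 1) hi' x)))
    (g : Equiv.Perm (Fin n) → M)
    (hg : ∀ w, (∃ i, ∃ hi : i + 1 < n, r (w ⟨i, Nat.lt_of_succ_lt hi⟩) (w ⟨i + 1, hi⟩)) →
      ∃ i, ∃ hi : i + 1 < n, r (w ⟨i, Nat.lt_of_succ_lt hi⟩) (w ⟨i + 1, hi⟩) ∧
        g w = d i hi (g (w * simpleSwap i hi)))
    (w : Equiv.Perm (Fin n)) (i : ℕ) (hi : i + 1 < n)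
    (h : r (w ⟨i, Nat.lt_of_succ_lt hi⟩) (w ⟨i + 1, hi⟩)) :
    g w = d i hi (g (w * simpleSwap i hi)) := by
  induction hN : μ w using Nat.strong_induction_on generalizing w i hi with
  | _ N ih =>
    -- two positions give the same value
    have aux : ∀ i j hi hj, i < j → r (w ⟨i, Nat.lt_of_succ_lt hi⟩) (w ⟨i + 1, hi⟩) →
        r (w ⟨j, Nat.lt_of_succ_lt hj⟩) (w ⟨j + 1, hj⟩) →
        d i hi (g (w * simpleSwap i hi)) = d j hj (g (w * simpleSwap j hj)) := by
      intro i j hi hj hij hri hrj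
      have m1 := hμ w i hi hri
      have m2 := hμ w j hj hrj
      rcases Nat.lt_or_ge (i + 1) j with h1 | h1
      · have a1 : simpleSwap i hi ⟨j, Nat.lt_of_succ_lt hj⟩ = ⟨j, Nat.lt_of_succ_lt hj⟩ :=
          simpleSwap_of_ne hi (by simp; omega) (by simp; omega)
        have a2 : simpleSwap i hi ⟨j + 1, hj⟩ = ⟨j + 1, hj⟩ :=
          simpleSwap_of_ne hi (by simp; omega) (by simp; omega)
        have a3 : simpleSwap j hj ⟨i, Nat.lt_of_succ_lt hi⟩ = ⟨i, Nat.lt_of_succ_lt hi⟩ :=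
          simpleSwap_of_ne hj (by simp; omega) (by simp; omega)
        have a4 : simpleSwap j hj ⟨i + 1, hi⟩ = ⟨i + 1, hi⟩ :=
          simpleSwap_of_ne hj (by simp; omega) (by simp; omega)
        rw [ih _ (hN ▸ m1) (w * simpleSwap i hi) j hj
            (by simpa only [Equiv.Perm.mul_apply, a1, a2] using hrj) rfl,
          ih _ (hN ▸ m2) (w * simpleSwap j hj) i hi
            (by simpa only [Equiv.Perm.mul_apply, a3, a4] using hri) rfl,
          hcomm i j hi hj _ h1, mul_assoc, mul_assoc, simpleSwap_comm hi hj h1]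
      · obtain rfl : j = i + 1 := by omega
        set s := simpleSwap i hi with hs
        set t := simpleSwap (i + 1) hj with ht
        have s0 : s ⟨i, Nat.lt_of_succ_lt hi⟩ = ⟨i + 1, hi⟩ := simpleSwap_left hi
        have s1 : s ⟨i + 1, hi⟩ = ⟨i, Nat.lt_of_succ_lt hi⟩ := simpleSwap_right hi
        have s2 : s ⟨i + 1 + 1, hj⟩ = ⟨i + 1 + 1, hj⟩ :=
          simpleSwap_of_ne hi (by simp; omega) (by simp)
        have t0 : t ⟨i, Nat.lt_of_succ_lt hi⟩ = ⟨i, Nat.lt_of_succ_lt hi⟩ :=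
          simpleSwap_of_ne hj (by simp) (by simp; omega)
        have t1 : t ⟨i + 1, hi⟩ = ⟨i + 1 + 1, hj⟩ := simpleSwap_left hj
        have t2 : t ⟨i + 1 + 1, hj⟩ = ⟨i + 1, hi⟩ := simpleSwap_right hj
        have hr2 := trans_of r hri hrj
        have b1 : r ((w * s) ⟨i + 1, hi⟩) ((w * s) ⟨i + 1 + 1, hj⟩) := by
          simpa only [Equiv.Perm.mul_apply, s1, s2] using hr2
        have b2 : r ((w * s * t) ⟨i, Nat.lt_of_succ_lt hi⟩) ((w * s * t) ⟨i + 1, hi⟩) := by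
          simpa only [Equiv.Perm.mul_apply, s0, s2, t0, t1] using hrj
        have b3 : r ((w * t) ⟨i, Nat.lt_of_succ_lt hi⟩) ((w * t) ⟨i + 1, hi⟩) := by
          simpa only [Equiv.Perm.mul_apply, t0, t1] using hr2
        have b4 : r ((w * t * s) ⟨i + 1, hi⟩) ((w * t * s) ⟨i + 1 + 1, hj⟩) := by
          simpa only [Equiv.Perm.mul_apply, t0, t2, s1, s2] using hri
        have m3 := hμ (w * s) (i + 1) hj b1
        have m4 := hμ (w * t) i hi b3
        rw [ih _ (hN ▸ m1) (w * s) (i + 1) hj b1 rfl,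
          ih _ (hN ▸ m3.trans m1) (w * s * t) i hi b2 rfl,
          ih _ (hN ▸ m2) (w * t) i hi b3 rfl,
          ih _ (hN ▸ m4.trans m2) (w * t * s) (i + 1) hj b4 rfl, hbraid, ← hs, ← ht,
          mul_assoc (w * s), mul_assoc w, ← mul_assoc s, hs, ht, simpleSwap_braid hi hj]
        simp only [mul_assoc]
    obtain ⟨j, hj, hrj, hgj⟩ := hg w ⟨i, hi, h⟩
    rw [hgj]
    rcases lt_trichotomy i j with hij | rfl | hij
    · exact (aux i j hi hj hij h hrj).symm
    · rfl
    · exact aux j i hj hi hij hrj h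

theorem schubert_eq_ddiff {n : ℕ} {w : Equiv.Perm (Fin n)} {i : ℕ} {hi : i + 1 < n}
    (h : Asc w i hi) : schubert w = ddiff i hi (schubert (w * simpleSwap i hi)) := by
  refine confluence (· < ·) (fun w => n * n - len w) (fun i hi => ddiff i hi) ?_ ?_ ?_ schubert ?_
    w i hi h
  · intro w i hi h
    have h1 := len_mul_simpleSwap (w := w) (hi := hi) h
    have h2 := len_le (w * simpleSwap i hi)
    omega
  · intro i j hi hj x hij
    exact ddiff_comm hi hj hij x
  · intro i hi hi' x
    exact ddiff_braid hi hi' x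
  · rintro w ⟨i, hi, h⟩
    have hex : ∃ i : ℕ, ∃ hi : i + 1 < n, len (w * simpleSwap i hi) = len w + 1 :=
      ⟨i, hi, len_mul_simpleSwap h⟩
    classical
    refine ⟨Nat.find hex, (Nat.find_spec hex).1, asc_iff_len.mp (Nat.find_spec hex).2, ?_⟩
    rw [schubert, dif_pos hex]
    rfl

theorem schubert_of_forall_not_asc {n : ℕ} {w : Equiv.Perm (Fin n)} (h : ∀ i hi, ¬ Asc w i hi) :
    schubert w = ∏ i : Fin n, X i ^ (n - 1 - (i : ℕ)) := by
  rw [schubert, dif_neg]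
  rintro ⟨i, hi, h'⟩
  exact h i hi (asc_iff_len.mp h')

theorem ddiff_schubert {n : ℕ} (w : Equiv.Perm (Fin n)) (i : ℕ) (hi : i + 1 < n)
    [Decidable (Asc w i hi)] :
    ddiff i hi (schubert w) = if Asc w i hi then 0 else schubert (w * simpleSwap i hi) := by
  split_ifs with h
  · rw [schubert_eq_ddiff h, ddiff_ddiff]
  · rw [schubert_eq_ddiff (asc_mul_simpleSwap.mpr h), mul_simpleSwap_cancel]

/-- The linear functional sending `f` to the constant coefficient of `∂_w f`, computed along the
reduced word obtained by removing the first descent again and again. -/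
noncomputable def phi {n : ℕ} (w : Equiv.Perm (Fin n)) : MvPolynomial (Fin n) ℤ →ₗ[ℤ] ℤ :=
  open Classical in
  if h : ∃ i : ℕ, ∃ hi : i + 1 < n, ¬ Asc w i hi then
    (phi (w * simpleSwap (Nat.find h) (Nat.find_spec h).1)).comp
      (ddiff (Nat.find h) (Nat.find_spec h).1)
  else lcoeff ℤ 0
termination_by len w
decreasing_by
  classical
  have := len_mul_simpleSwap_of_not_asc (Nat.find_spec h).2
  omega

theorem phi_one {n : ℕ} (f : MvPolynomial (Fin n) ℤ) :
    phi (1 : Equiv.Perm (Fin n)) f = constantCoeff f := by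
  rw [phi, dif_neg]
  · rfl
  · rintro ⟨i, hi, h⟩
    exact h (Nat.lt_succ_self i)

theorem phi_of_not_asc {n : ℕ} {w : Equiv.Perm (Fin n)} {i : ℕ} {hi : i + 1 < n}
    (h : ¬ Asc w i hi) (f : MvPolynomial (Fin n) ℤ) :
    phi w f = phi (w * simpleSwap i hi) (ddiff i hi f) := by
  have := confluence (· > ·) len
    (fun i hi (φ : MvPolynomial (Fin n) ℤ →ₗ[ℤ] ℤ) => φ.comp (ddiff i hi)) ?_ ?_ ?_ phi ?_
    w i hi (not_asc.mp h)
  · rw [this]; rfl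
  · intro w i hi h
    have h1 := len_mul_simpleSwap_of_not_asc (w := w) (hi := hi) (not_asc.mpr h)
    omega
  · intro i j hi hj φ hij
    refine LinearMap.ext fun f => ?_
    exact congrArg φ (ddiff_comm hi hj hij f).symm
  · intro i hi hi' φ
    refine LinearMap.ext fun f => ?_
    exact congrArg φ (ddiff_braid hi hi' f)
  · rintro w ⟨i, hi, h⟩
    have hex : ∃ i : ℕ, ∃ hi : i + 1 < n, ¬ Asc w i hi := ⟨i, hi, not_asc.mpr h⟩
    classical
    refine ⟨Nat.find hex, (Nat.find_spec hex).1, not_asc.mp (Nat.find_spec hex).2, ?_⟩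
    conv_lhs => rw [phi, dif_pos hex]

theorem phi_ddiff {n : ℕ} (w : Equiv.Perm (Fin n)) (i : ℕ) (hi : i + 1 < n)
    [Decidable (Asc w i hi)] (f : MvPolynomial (Fin n) ℤ) :
    phi w (ddiff i hi f) = if Asc w i hi then phi (w * simpleSwap i hi) f else 0 := by
  split_ifs with h
  · have h' : ¬ Asc (w * simpleSwap i hi) i hi := fun h' => asc_mul_simpleSwap.mp h' h
    rw [phi_of_not_asc h', mul_simpleSwap_cancel]
  · rw [phi_of_not_asc h, ddiff_ddiff, map_zero]

/-! ### The dual of Monk's rule -/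

theorem len_mul_swap_lt_iff {n : ℕ} {w : Equiv.Perm (Fin n)} {x y : Fin n} (h : x ≠ y) :
    len (w * Equiv.swap x y) < len w ↔ (x < y ↔ w y < w x) := by
  have hw : w x ≠ w y := fun e => h (w.injective e)
  rcases lt_or_gt_of_ne h with h1 | h1 <;> rcases lt_or_gt_of_ne hw with h2 | h2
  · simpa [h1, h2.not_gt] using (len_lt_len_mul_swap h1 h2).le
  · simpa [h1, h2] using len_mul_swap_lt h1 h2
  · rw [Equiv.swap_comm]
    simpa [h1.not_gt, h2.not_gt] using len_mul_swap_lt h1 h2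
  · rw [Equiv.swap_comm]
    simpa [h1.not_gt, h2] using (len_lt_len_mul_swap h1 h2).le

/-- The sign with which exchanging the positions `m` and `x` enters the expansion of `x_m`. -/
def monkSign {n : ℕ} (m x : Fin n) : ℤ := if m < x then 1 else if x < m then -1 else 0

theorem ddiff_X {n : ℕ} (i : ℕ) (hi : i + 1 < n) (m : Fin n) :
    ddiff i hi (X m) = C (monkSign m (simpleSwap i hi m)) := by
  refine ddiff_eq hi ?_
  rw [rename_X]
  by_cases h1 : (m : ℕ) = i
  · obtain rfl : m = ⟨i, Nat.lt_of_succ_lt hi⟩ := Fin.ext h1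
    rw [simpleSwap_left]
    simp [monkSign, Fin.lt_def]
  by_cases h2 : (m : ℕ) = i + 1
  · obtain rfl : m = ⟨i + 1, hi⟩ := Fin.ext h2
    rw [simpleSwap_right]
    simp [monkSign, Fin.lt_def]
  · rw [simpleSwap_of_ne hi h1 h2]
    simp [monkSign]

theorem mul_swap_simpleSwap {n : ℕ} {i : ℕ} (hi : i + 1 < n) (w : Equiv.Perm (Fin n))
    (x y : Fin n) :
    w * simpleSwap i hi * Equiv.swap (simpleSwap i hi x) (simpleSwap i hi y) =
      w * Equiv.swap x y * simpleSwap i hi := by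
  rw [Equiv.swap_apply_apply, show (simpleSwap i hi)⁻¹ = simpleSwap i hi from Equiv.swap_inv _ _,
    ← mul_assoc, ← mul_assoc, mul_simpleSwap_cancel]

/-- The dual of Monk's rule: multiplication by a variable, seen through the functionals `phi`. No
terms outside `S_n` occur here, in contrast to Monk's rule for products of Schubert polynomials. -/
theorem phi_X_mul {n : ℕ} (w : Equiv.Perm (Fin n)) (m : Fin n) (f : MvPolynomial (Fin n) ℤ) :
    phi w (X m * f) = ∑ x, if len (w * Equiv.swap m x) + 1 = len w then
      monkSign m x * phi (w * Equiv.swap m x) f else 0 := by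
  classical
  induction hN : len w using Nat.strong_induction_on generalizing w m f with
  | _ N ih =>
    subst hN
    by_cases hw : ∃ i, ∃ hi : i + 1 < n, ¬ Asc w i hi
    swap
    · push Not at hw
      obtain rfl := eq_one_of_asc hw
      simp [phi_one, len_one]
    obtain ⟨i, hi, hd⟩ := hw
    set s := simpleSwap i hi with hs
    have hlen : len (w * s) + 1 = len w := len_mul_simpleSwap_of_not_asc hd
    have hss : ∀ x, s (s x) = x := fun x => by
      rw [← Equiv.Perm.mul_apply, simpleSwap_mul_self]; rfl
    -- the Leibniz rule: the first term is the summand `x = s m`, the second is the rule for `w s`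
    rw [phi_of_not_asc hd, ddiff_mul, map_add, rename_X, ddiff_X, ← smul_eq_C_mul, map_smul,
      ih (len (w * s)) (by omega) (w * s) _ _ rfl, ← Equiv.sum_comp s]
    rw [show monkSign m (s m) • phi (w * s) f =
      ∑ x, if x = s m then monkSign m x * phi (w * s) f else 0 by simp]
    rw [← Finset.sum_add_distrib]
    refine Finset.sum_congr rfl fun x _ => ?_
    rw [mul_swap_simpleSwap, ← hs]
    by_cases hx : x = s m
    · subst hx
      rw [if_pos rfl]
      by_cases hm : s m = m
      · rw [hm, Equiv.swap_self]
        simp [monkSign, hm]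
      · have hsw : Equiv.swap m (s m) = s := by
          by_cases h1 : (m : ℕ) = i
          · obtain rfl : m = ⟨i, Nat.lt_of_succ_lt hi⟩ := Fin.ext h1
            rw [simpleSwap_left]; rfl
          by_cases h2 : (m : ℕ) = i + 1
          · obtain rfl : m = ⟨i + 1, hi⟩ := Fin.ext h2
            rw [simpleSwap_right, Equiv.swap_comm]; rfl
          · exact absurd (simpleSwap_of_ne hi h1 h2) hm
        rw [hsw, if_pos hlen, mul_simpleSwap_cancel, if_neg (by omega), add_zero]
    · rw [if_neg hx, zero_add]
      have hx' : m ≠ s x := fun e => hx (by rw [e, hss])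
      have hsign : monkSign (s m) (s x) = monkSign m x := by
        rw [monkSign, monkSign]
        simp only [hs, simpleSwap_lt_iff hi hx, simpleSwap_lt_iff hi hx']
      rw [phi_ddiff, hsign, mul_simpleSwap_cancel]
      by_cases hmx : m = x
      · subst hmx
        simp [monkSign]
      have key : (len (w * Equiv.swap m x * s) + 1 = len (w * s) ∧
          Asc (w * Equiv.swap m x * s) i hi) ↔ len (w * Equiv.swap m x) + 1 = len w := by
        constructor
        · rintro ⟨h1, h2⟩
          have := len_mul_simpleSwap h2
          rw [mul_simpleSwap_cancel] at this
          omega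
        · intro h1
          -- conjugation by `s` does not affect whether the exchange lowers the length
          have h2 : len (w * s * Equiv.swap (s m) (s x)) < len (w * s) := by
            rw [len_mul_swap_lt_iff (fun e => hmx (s.injective e)), Equiv.Perm.mul_apply,
              Equiv.Perm.mul_apply, hss, hss, hs, simpleSwap_lt_iff hi hx,
              ← len_mul_swap_lt_iff hmx]
            omega
          rw [mul_swap_simpleSwap, ← hs] at h2
          have h3 : ¬ Asc (w * Equiv.swap m x) i hi := by
            intro h3
            have := len_mul_simpleSwap h3
            rw [← hs] at this
            omega
          have := len_mul_simpleSwap_of_not_asc h3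
          rw [← hs] at this
          exact ⟨by omega, asc_mul_simpleSwap.mpr h3⟩
      rw [← if_congr key rfl rfl, ite_and]
      simp only [mul_ite, mul_zero]

/-! ### Increasing chains of transpositions -/

/-- The product of the transpositions given by a list of pairs. -/
def swapProd {n : ℕ} (L : List (Fin n × Fin n)) : Equiv.Perm (Fin n) :=
  (L.map fun t => Equiv.swap t.1 t.2).prod

/-- Each transposition of the list, applied in turn on the right of `u`, moves the larger of the
two values to the first component of its pair. -/
def Inc {n : ℕ} (u : Equiv.Perm (Fin n)) : List (Fin n × Fin n) → Prop
  | [] => True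
  | t :: L => u t.1 < u t.2 ∧ Inc (u * Equiv.swap t.1 t.2) L

/-- `L` lists pairs `(b, c)` with distinct `b < m ≤ c`, and is increasing from `u`. No condition on
the growth of the length is imposed. -/
structure IsChain {n : ℕ} (m : ℕ) (u : Equiv.Perm (Fin n)) (L : List (Fin n × Fin n)) : Prop where
  inc : Inc u L
  pos : ∀ t ∈ L, (t.1 : ℕ) < m ∧ m ≤ (t.2 : ℕ)
  nodup : (L.map Prod.fst).Nodup

/-- `v` is the end of a chain of `j` transpositions from `u` along which the length grows by `j`. -/
def Up {n : ℕ} (m j : ℕ) (u v : Equiv.Perm (Fin n)) : Prop :=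
  (∃ L, L.length = j ∧ IsChain m u L ∧ v = u * swapProd L) ∧ len v = len u + j

section
variable {n : ℕ} {m : ℕ} {u : Equiv.Perm (Fin n)}

@[simp] theorem swapProd_nil : swapProd ([] : List (Fin n × Fin n)) = 1 := rfl

@[simp] theorem swapProd_cons (t : Fin n × Fin n) (L : List (Fin n × Fin n)) :
    swapProd (t :: L) = Equiv.swap t.1 t.2 * swapProd L := by simp [swapProd]

theorem swapProd_append (L L' : List (Fin n × Fin n)) :
    swapProd (L ++ L') = swapProd L * swapProd L' := by simp [swapProd]

theorem swapProd_map (τ : Equiv.Perm (Fin n)) (L : List (Fin n × Fin n)) :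
    swapProd (L.map (Prod.map τ τ)) = τ * swapProd L * τ⁻¹ := by
  induction L with
  | nil => simp
  | cons t L ih =>
    rw [List.map_cons, swapProd_cons, swapProd_cons, ih]
    simp only [Prod.map_fst, Prod.map_snd, Equiv.swap_apply_apply, mul_assoc, inv_mul_cancel_left]

theorem inc_append {L L' : List (Fin n × Fin n)} :
    Inc u (L ++ L') ↔ Inc u L ∧ Inc (u * swapProd L) L' := by
  induction L generalizing u with
  | nil => simp [Inc]
  | cons t L ih => simp only [List.cons_append, Inc, ih, swapProd_cons, mul_assoc, and_assoc]

theorem inc_map (τ : Equiv.Perm (Fin n)) {L : List (Fin n × Fin n)} :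
    Inc (u * τ⁻¹) (L.map (Prod.map τ τ)) ↔ Inc u L := by
  induction L generalizing u with
  | nil => simp [Inc]
  | cons t L ih =>
    simp only [List.map_cons, Inc, Prod.map_fst, Prod.map_snd, Equiv.swap_apply_apply]
    rw [show u * τ⁻¹ * (τ * Equiv.swap t.1 t.2 * τ⁻¹) = u * Equiv.swap t.1 t.2 * τ⁻¹ by group, ih]
    simp

theorem IsChain.tail {t : Fin n × Fin n} {L : List (Fin n × Fin n)} (h : IsChain m u (t :: L)) :
    IsChain m (u * Equiv.swap t.1 t.2) L :=
  ⟨h.inc.2, fun t' ht' => h.pos t' (List.mem_cons_of_mem _ ht'), (List.nodup_cons.mp h.nodup).2⟩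

theorem len_add_length_le {L : List (Fin n × Fin n)} (hinc : Inc u L)
    (hpos : ∀ t ∈ L, (t.1 : ℕ) < m ∧ m ≤ (t.2 : ℕ)) :
    len u + L.length ≤ len (u * swapProd L) := by
  induction L generalizing u with
  | nil => simp
  | cons t L ih =>
    have h1 := ih hinc.2 fun t' ht' => hpos t' (List.mem_cons_of_mem _ ht')
    have h2 := hpos t List.mem_cons_self
    have h3 := len_lt_len_mul_swap (u := u) (b := t.1) (c := t.2)
      (by simp only [Fin.lt_def]; omega) hinc.1
    rw [swapProd_cons, ← mul_assoc, List.length_cons]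
    omega

/-- A chain is saturated as soon as its total length is right. -/
theorem saturated_iff {L : List (Fin n × Fin n)} (hpos : ∀ t ∈ L, (t.1 : ℕ) < m ∧ m ≤ (t.2 : ℕ)) :
    (∀ i, 1 ≤ i → i ≤ L.length → len (u * swapProd (L.take i)) = len u + i) ↔
      Inc u L ∧ len (u * swapProd L) = len u + L.length := by
  induction L generalizing u with
  | nil =>
    refine ⟨fun _ => ⟨trivial, by simp⟩, fun _ i h1 h2 => ?_⟩
    simp at h2
    omega
  | cons t L ih =>
    have hpos' : ∀ t ∈ L, (t.1 : ℕ) < m ∧ m ≤ (t.2 : ℕ) :=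
      fun t' ht' => hpos t' (List.mem_cons_of_mem _ ht')
    have h2 := hpos t List.mem_cons_self
    have hlt : t.1 < t.2 := by simp only [Fin.lt_def]; omega
    have ih' := ih (u := u * Equiv.swap t.1 t.2) hpos'
    constructor
    · intro h
      have h1 := h 1 le_rfl (by simp)
      simp only [List.take_succ_cons, List.take_zero, swapProd_cons, swapProd_nil, mul_one] at h1
      have hu : u t.1 < u t.2 := by
        by_contra hc
        have := len_mul_swap_lt hlt (lt_of_le_of_ne (not_lt.mp hc)
          fun e => hlt.ne' (u.injective e))
        omega
      have h3 := ih'.mp fun i hi1 hi2 => by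
        have := h (i + 1) (by omega) (by simpa using hi2)
        rw [List.take_succ_cons, swapProd_cons, ← mul_assoc] at this
        rw [this, h1]
        ring
      refine ⟨⟨hu, h3.1⟩, ?_⟩
      rw [swapProd_cons, ← mul_assoc, h3.2, h1, List.length_cons]
      ring
    · rintro ⟨⟨hu, hL⟩, hlen⟩
      rw [swapProd_cons, ← mul_assoc, List.length_cons] at hlen
      have h3 := len_add_length_le hL hpos'
      have h4 := len_lt_len_mul_swap hlt hu
      have h5 := ih'.mpr ⟨hL, by omega⟩
      intro i hi1 hi2
      obtain ⟨i, rfl⟩ := Nat.exists_eq_add_of_le' hi1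
      rw [List.take_succ_cons, swapProd_cons, ← mul_assoc]
      rcases Nat.eq_zero_or_pos i with rfl | hi
      · simp only [List.take_zero, swapProd_nil, mul_one]
        omega
      · rw [h5 i hi (by simpa using hi2)]
        omega

theorem pieriArrow_iff {r : ℕ} {v : Equiv.Perm (Fin n)} :
    PieriArrow r m u v ↔ Up m (m + 1 - r) u v := by
  constructor
  · rintro ⟨L, hl, hpos, hv, hlen, hnd⟩
    obtain ⟨h1, h2⟩ := (saturated_iff hpos).mp hlen
    exact ⟨⟨L, hl, ⟨h1, hpos, hnd⟩, hv⟩, by rw [hv, ← hl]; exact h2⟩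
  · rintro ⟨⟨L, hl, hc, rfl⟩, hlen⟩
    exact ⟨L, hl, hc.pos, rfl, (saturated_iff hc.pos).mpr ⟨hc.inc, by rw [hlen, hl]⟩, hc.nodup⟩

theorem simpleSwap_val_lt_iff {i : ℕ} (hi : i + 1 < n) (him : i + 1 ≠ m) (x : Fin n) :
    (simpleSwap i hi x : ℕ) < m ↔ (x : ℕ) < m := by
  by_cases h1 : (x : ℕ) = i
  · obtain rfl : x = ⟨i, Nat.lt_of_succ_lt hi⟩ := Fin.ext h1
    rw [simpleSwap_left]
    simp only
    omega
  by_cases h2 : (x : ℕ) = i + 1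
  · obtain rfl : x = ⟨i + 1, hi⟩ := Fin.ext h2
    rw [simpleSwap_right]
    simp only
    omega
  · rw [simpleSwap_of_ne hi h1 h2]

theorem IsChain.conj {L : List (Fin n × Fin n)} (h : IsChain m u L) {i : ℕ} (hi : i + 1 < n)
    (him : i + 1 ≠ m) : IsChain m (u * simpleSwap i hi)
      (L.map (Prod.map (simpleSwap i hi) (simpleSwap i hi))) where
  inc := by
    have := (inc_map (simpleSwap i hi)).mpr h.inc
    rwa [show (simpleSwap i hi)⁻¹ = simpleSwap i hi from Equiv.swap_inv _ _] at this
  pos := by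
    intro t ht
    obtain ⟨t', ht', rfl⟩ := List.mem_map.mp ht
    have := h.pos t' ht'
    rw [Prod.map_fst, Prod.map_snd, simpleSwap_val_lt_iff hi him, ← not_lt,
      simpleSwap_val_lt_iff hi him]
    omega
  nodup := by
    have := h.nodup.map (simpleSwap i hi).injective
    rw [List.map_map] at this ⊢
    exact this

theorem mul_swapProd_conj {i : ℕ} (hi : i + 1 < n) (L : List (Fin n × Fin n)) :
    u * simpleSwap i hi * swapProd (L.map (Prod.map (simpleSwap i hi) (simpleSwap i hi))) =
      u * swapProd L * simpleSwap i hi := by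
  rw [swapProd_map, ← mul_assoc, ← mul_assoc, mul_simpleSwap_cancel,
    show (simpleSwap i hi)⁻¹ = simpleSwap i hi from Equiv.swap_inv _ _]

/-- A chain of transpositions across `m` creates no descent at any other place. -/
theorem Up.asc {j : ℕ} {v : Equiv.Perm (Fin n)} (h : Up m j u v) {i : ℕ} {hi : i + 1 < n}
    (him : i + 1 ≠ m) (hu : Asc u i hi) : Asc v i hi := by
  obtain ⟨⟨L, hl, hL, rfl⟩, hlen⟩ := h
  by_contra hv
  -- the conjugated chain would be longer than the difference of the lengths
  have h1 := hL.conj hi him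
  have h2 := len_add_length_le h1.inc h1.pos
  rw [mul_swapProd_conj, List.length_map] at h2
  have h3 := len_mul_simpleSwap hu
  have h4 := len_mul_simpleSwap_of_not_asc hv
  omega

/-- If `v` has a descent at a place other than `m`, conjugation by the simple transposition there
matches the chains from `u` to `v` with those between permutations that have an ascent there. -/
theorem up_conj_iff {j : ℕ} {v : Equiv.Perm (Fin n)} {i : ℕ} {hi : i + 1 < n}
    (him : i + 1 ≠ m) (hv : ¬ Asc v i hi) :
    Up m j (u * simpleSwap i hi) (v * simpleSwap i hi) ∧ Asc (u * simpleSwap i hi) i hi ↔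
      Up m j u v := by
  have h4 := len_mul_simpleSwap_of_not_asc hv
  constructor
  · rintro ⟨⟨⟨L, hl, hL, hLv⟩, hlen⟩, ha⟩
    have h1 := len_mul_simpleSwap ha
    rw [mul_simpleSwap_cancel] at h1
    refine ⟨⟨_, ?_, hL.conj hi him |> (mul_simpleSwap_cancel hi u ▸ ·), ?_⟩, by omega⟩
    · rw [List.length_map, hl]
    · have := mul_swapProd_conj (u := u * simpleSwap i hi) hi L
      rw [mul_simpleSwap_cancel] at this
      rw [this, ← hLv, mul_simpleSwap_cancel]
  · intro h
    have hu : ¬ Asc u i hi := fun hu => hv (h.asc him hu)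
    have h5 := len_mul_simpleSwap_of_not_asc hu
    obtain ⟨⟨L, hl, hL, rfl⟩, hlen⟩ := h
    refine ⟨⟨⟨_, ?_, hL.conj hi him, (mul_swapProd_conj hi L).symm⟩, by omega⟩,
      asc_mul_simpleSwap.mpr hu⟩
    rw [List.length_map, hl]

/-! ### The values along a chain -/

variable {L : List (Fin n × Fin n)}

theorem ne_of_val_lt_le {x y : Fin n} (hx : (x : ℕ) < m)
    (hy : m ≤ (y : ℕ)) : x ≠ y := fun e => by subst e; omega

theorem IsChain.apply_le (h : IsChain m u L) {c : Fin n} (hc : m ≤ (c : ℕ)) :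
    (u * swapProd L) c ≤ u c := by
  induction L generalizing u with
  | nil => simp
  | cons t L ih =>
    have hp := h.pos t List.mem_cons_self
    rw [swapProd_cons, ← mul_assoc]
    refine (ih h.tail).trans ?_
    have h1 : c ≠ t.1 := (ne_of_val_lt_le hp.1 hc).symm
    by_cases h2 : c = t.2
    · subst h2
      simpa using h.inc.1.le
    · simp [Equiv.swap_apply_of_ne_of_ne h1 h2]

theorem IsChain.apply_fst_of_notMem (h : IsChain m u L) {b : Fin n} (hb : (b : ℕ) < m)
    (hbL : b ∉ L.map Prod.fst) : (u * swapProd L) b = u b := by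
  induction L generalizing u with
  | nil => simp
  | cons t L ih =>
    have hp := h.pos t List.mem_cons_self
    rw [List.map_cons, List.mem_cons, not_or] at hbL
    rw [swapProd_cons, ← mul_assoc, ih h.tail hbL.2, Equiv.Perm.mul_apply,
      Equiv.swap_apply_of_ne_of_ne hbL.1 (ne_of_val_lt_le hb hp.2)]

theorem IsChain.apply_snd_of_notMem (h : IsChain m u L) {c : Fin n} (hc : m ≤ (c : ℕ))
    (hcL : c ∉ L.map Prod.snd) : (u * swapProd L) c = u c := by
  induction L generalizing u with
  | nil => simp
  | cons t L ih =>
    have hp := h.pos t List.mem_cons_self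
    rw [List.map_cons, List.mem_cons, not_or] at hcL
    rw [swapProd_cons, ← mul_assoc, ih h.tail hcL.2, Equiv.Perm.mul_apply,
      Equiv.swap_apply_of_ne_of_ne (ne_of_val_lt_le hp.1 hc).symm hcL.1]

theorem IsChain.lt_apply (h : IsChain m u L) {b : Fin n} (hbL : b ∈ L.map Prod.fst) :
    u b < (u * swapProd L) b := by
  induction L generalizing u with
  | nil => simp at hbL
  | cons t L ih =>
    have hp := h.pos t List.mem_cons_self
    have hnd := List.nodup_cons.mp h.nodup
    rw [swapProd_cons, ← mul_assoc]
    rcases List.mem_cons.mp hbL with rfl | hbL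
    · rw [h.tail.apply_fst_of_notMem hp.1 hnd.1]
      simpa using h.inc.1
    · obtain ⟨t', ht', rfl⟩ := List.mem_map.mp hbL
      refine lt_of_eq_of_lt ?_ (ih h.tail hbL)
      rw [Equiv.Perm.mul_apply, Equiv.swap_apply_of_ne_of_ne (fun e => hnd.1 (by rwa [← e]))
        (ne_of_val_lt_le (h.pos t' (List.mem_cons_of_mem _ ht')).1 hp.2)]

/-- The old value at a moved position ends, or is undercut, on the right. -/
theorem IsChain.exists_apply_le (h : IsChain m u L) {b : Fin n} (hbL : b ∈ L.map Prod.fst) :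
    ∃ c : Fin n, m ≤ (c : ℕ) ∧ (u * swapProd L) c ≤ u b := by
  induction L generalizing u with
  | nil => simp at hbL
  | cons t L ih =>
    have hp := h.pos t List.mem_cons_self
    have hnd := List.nodup_cons.mp h.nodup
    rw [swapProd_cons, ← mul_assoc]
    rcases List.mem_cons.mp hbL with rfl | hbL
    · exact ⟨t.2, hp.2, (h.tail.apply_le hp.2).trans (by simp)⟩
    · obtain ⟨t', ht', rfl⟩ := List.mem_map.mp hbL
      obtain ⟨c, hc, hle⟩ := ih h.tail hbL
      refine ⟨c, hc, hle.trans (le_of_eq ?_)⟩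
      rw [Equiv.Perm.mul_apply, Equiv.swap_apply_of_ne_of_ne (fun e => hnd.1 (by rwa [← e]))
        (ne_of_val_lt_le (h.pos t' (List.mem_cons_of_mem _ ht')).1 hp.2)]

theorem IsChain.exists_apply_lt (h : IsChain m u L) {c : Fin n} (hcL : c ∈ L.map Prod.snd) :
    ∃ b : Fin n, (b : ℕ) < m ∧ (u * swapProd L) c < (u * swapProd L) b := by
  induction L generalizing u with
  | nil => simp at hcL
  | cons t L ih =>
    have hp := h.pos t List.mem_cons_self
    have hnd := List.nodup_cons.mp h.nodup
    rw [swapProd_cons, ← mul_assoc]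
    by_cases hc : c ∈ L.map Prod.snd
    · exact ih h.tail hc
    · obtain rfl : c = t.2 := (List.mem_cons.mp hcL).resolve_right hc
      refine ⟨t.1, hp.1, ?_⟩
      rw [h.tail.apply_fst_of_notMem hp.1 hnd.1, h.tail.apply_snd_of_notMem hp.2 hc]
      simpa using h.inc.1

/-- The positions moved by a chain fall into classes, each with a single element `c ≥ m`, which
`u⁻¹ * v` preserves: all the pairs of the chain that involve `b` have the same `c`. -/
theorem IsChain.exists_label (h : IsChain m u L) : ∃ γ : Fin n → Fin n,
    (∀ c : Fin n, m ≤ (c : ℕ) → γ c = c) ∧ ∀ x, γ (u⁻¹ ((u * swapProd L) x)) = γ x := by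
  induction L generalizing u with
  | nil => exact ⟨id, fun _ _ => rfl, fun x => by simp⟩
  | cons t L ih =>
    obtain ⟨γ, h1, h2⟩ := ih h.tail
    obtain ⟨b, c⟩ := t
    have hp := h.pos (b, c) List.mem_cons_self
    have hnd := List.nodup_cons.mp h.nodup
    simp only at hp hnd h2
    rw [swapProd_cons, ← mul_assoc]
    simp only
    set v := u * Equiv.swap b c * swapProd L with hv
    have hbc : b ≠ c := ne_of_val_lt_le hp.1 hp.2
    have hb : v b = u c := by
      rw [hv, h.tail.apply_fst_of_notMem hp.1 hnd.1]
      simp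
    have h2' : ∀ x, γ (Equiv.swap b c (u⁻¹ (v x))) = γ x := fun x => by
      rw [← h2 x, mul_inv_rev, Equiv.swap_inv]; rfl
    refine ⟨Function.update γ b c, fun x hx => ?_, fun x => ?_⟩
    · rw [Function.update_of_ne (ne_of_val_lt_le hp.1 hx).symm, h1 x hx]
    · by_cases hx : x = b
      · subst hx
        rw [hb, show u⁻¹ (u c) = c from u.symm_apply_apply c, Function.update_of_ne hbc.symm,
          Function.update_self, h1 c hp.2]
      rw [Function.update_of_ne hx]
      have hyc : u⁻¹ (v x) ≠ c := by
        intro e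
        rw [Equiv.Perm.inv_eq_iff_eq, ← hb] at e
        exact hx (v.injective e)
      by_cases hy : u⁻¹ (v x) = b
      · have := h2' x
        rw [hy, Equiv.swap_apply_left, h1 c hp.2] at this
        rw [hy, Function.update_self, this]
      · rw [Function.update_of_ne hy, ← h2' x, Equiv.swap_apply_of_ne_of_ne hy hyc]

/-! ### Reordering a chain -/

/-- A transposition that is disjoint from all those of `A` can be moved past them. -/
theorem inc_append_cons {t : Fin n × Fin n} {A B : List (Fin n × Fin n)} (h : Inc u (t :: (A ++ B)))
    (hA : ∀ a ∈ A, a.1 ≠ t.1 ∧ a.1 ≠ t.2 ∧ a.2 ≠ t.1 ∧ a.2 ≠ t.2) :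
    Inc u (A ++ t :: B) ∧ swapProd (A ++ t :: B) = swapProd (t :: (A ++ B)) := by
  induction A generalizing u with
  | nil => exact ⟨h, rfl⟩
  | cons a A ih =>
    obtain ⟨h1, h2, h3⟩ := h
    obtain ⟨n1, n2, n3, n4⟩ := hA a List.mem_cons_self
    have hcomm : Equiv.swap t.1 t.2 * Equiv.swap a.1 a.2 =
        Equiv.swap a.1 a.2 * Equiv.swap t.1 t.2 := by
      by_cases ht : t.1 = t.2
      · rw [ht, Equiv.swap_self]; rfl
      by_cases ha : a.1 = a.2
      · rw [ha, Equiv.swap_self]; rfl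
      refine (Equiv.Perm.disjoint_swap_swap ?_).commute
      simp [ht, ha, n1.symm, n2.symm, n3.symm, n4.symm]
    have := ih (u := u * Equiv.swap a.1 a.2) ⟨?_, ?_⟩
      fun a' ha' => hA a' (List.mem_cons_of_mem _ ha')
    · refine ⟨⟨?_, this.1⟩, ?_⟩
      · simpa [Equiv.swap_apply_of_ne_of_ne n1 n2, Equiv.swap_apply_of_ne_of_ne n3 n4] using h2
      · rw [List.cons_append, swapProd_cons, this.2, swapProd_cons, swapProd_cons, List.cons_append,
          swapProd_cons, ← mul_assoc, ← mul_assoc, hcomm]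
    · simpa [Equiv.swap_apply_of_ne_of_ne n1.symm n3.symm,
        Equiv.swap_apply_of_ne_of_ne n2.symm n4.symm] using h1
    · rwa [mul_assoc, ← hcomm, ← mul_assoc]

/-- The pairs whose second component satisfies `p` can be moved to the front of a chain. -/
theorem IsChain.partition (h : IsChain m u L) (p : Fin n → Bool) :
    IsChain m u (L.filter (fun t => p t.2) ++ L.filter (fun t => !p t.2)) ∧
      swapProd (L.filter (fun t => p t.2) ++ L.filter (fun t => !p t.2)) = swapProd L := by
  have hperm := List.filter_append_perm (fun t : Fin n × Fin n => p t.2) L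
  suffices hs : Inc u (L.filter (fun t => p t.2) ++ L.filter (fun t => !p t.2)) ∧
      swapProd (L.filter (fun t => p t.2) ++ L.filter (fun t => !p t.2)) = swapProd L from
    ⟨⟨hs.1, fun t ht => h.pos t (hperm.mem_iff.mp ht), ((hperm.map _).nodup_iff).mpr h.nodup⟩, hs.2⟩
  clear hperm
  induction L generalizing u with
  | nil => exact ⟨trivial, rfl⟩
  | cons t L ih =>
    have hp := h.pos t List.mem_cons_self
    have hnd := List.nodup_cons.mp h.nodup
    obtain ⟨h1, h2⟩ := ih h.tail
    by_cases hpt : p t.2 = true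
    · rw [List.filter_cons_of_pos (by simpa using hpt),
        List.filter_cons_of_neg (by simpa using hpt),
        List.cons_append, swapProd_cons, h2, swapProd_cons]
      exact ⟨⟨h.inc.1, h1⟩, rfl⟩
    · rw [List.filter_cons_of_neg (by simpa using hpt),
        List.filter_cons_of_pos (by simpa using hpt)]
      have := inc_append_cons (u := u) (t := t) ⟨h.inc.1, h1⟩ ?_
      · exact ⟨this.1, by rw [this.2, swapProd_cons, h2, swapProd_cons]⟩
      · intro a ha
        rw [List.mem_filter] at ha
        have hpa := h.pos a (List.mem_cons_of_mem _ ha.1)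
        refine ⟨fun e => hnd.1 (e ▸ List.mem_map_of_mem ha.1), ne_of_val_lt_le hpa.1 hp.2,
          (ne_of_val_lt_le hp.1 hpa.2).symm, fun e => hpt (e ▸ ha.2)⟩

end

/-! ### The recursion for chains when the end point is increasing -/

section
variable {n : ℕ} {u w : Equiv.Perm (Fin n)} {m : Fin n} {j : ℕ}

theorem IsChain.center_notMem {L : List (Fin n × Fin n)} (hL : IsChain m u L)
    (hw : ∀ b < m, (u * swapProd L) b < (u * swapProd L) m) : m ∉ L.map Prod.snd := by
  intro h
  obtain ⟨b, hb, hlt⟩ := hL.exists_apply_lt h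
  exact lt_asymm hlt (hw b hb)

theorem Up.succ_left (h : Up (m : ℕ) j u w) (hw : ∀ b < m, w b < w m) :
    Up ((m : ℕ) + 1) j u w := by
  obtain ⟨⟨L, hl, hL, rfl⟩, hlen⟩ := h
  have hm := hL.center_notMem hw
  refine ⟨⟨L, hl, ⟨hL.inc, fun t ht => ?_, hL.nodup⟩, rfl⟩, hlen⟩
  have := hL.pos t ht
  have h2 : (t.2 : ℕ) ≠ m := fun e => hm (by
    rw [← Fin.ext e]
    exact List.mem_map_of_mem ht)
  omega

/-- A chain `L₁, (m, c), L₂` across `m + 1` that moves the value at `m` becomes a chain across `m`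
that ends at `w * (m c)`, when `(m, c)` is left out and `c` is replaced by `m` in `L₂`. -/
theorem Up.of_succ (h : Up ((m : ℕ) + 1) (j + 1) u w) : Up (m : ℕ) (j + 1) u w ∨
    ∃ c, m < c ∧ len (w * Equiv.swap m c) + 1 = len w ∧ Up (m : ℕ) j u (w * Equiv.swap m c) := by
  obtain ⟨⟨L, hl, hL, rfl⟩, hlen⟩ := h
  by_cases hm : m ∈ L.map Prod.fst
  · right
    obtain ⟨⟨m', c⟩, hmc, hm'⟩ := List.mem_map.mp hm
    obtain rfl : m = m' := hm'.symm
    obtain ⟨L₁, L₂, rfl⟩ := List.append_of_mem hmc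
    have hpm := hL.pos (m, c) hmc
    simp only at hpm
    have hmltc : m < c := by simp only [Fin.lt_def]; omega
    obtain ⟨hi1, hi2, hi3⟩ := inc_append.mp hL.inc
    simp only at hi2 hi3
    have hnd := hL.nodup
    rw [List.map_append, List.map_cons, List.nodup_append] at hnd
    obtain ⟨hnd1, hnd2, hnd3⟩ := hnd
    rw [List.nodup_cons] at hnd2
    have hm1 : m ∉ L₁.map Prod.fst := fun h => hnd3 m h m List.mem_cons_self rfl
    have hm2 : m ∉ L₂.map Prod.fst := hnd2.1
    have hpos1 : ∀ t ∈ L₁, (t.1 : ℕ) < m ∧ (m : ℕ) + 1 ≤ t.2 := by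
      intro t ht
      have h1 := hL.pos t (List.mem_append_left _ ht)
      have h2 : (t.1 : ℕ) ≠ m := fun e => hm1 (Fin.ext e ▸ List.mem_map_of_mem ht)
      omega
    have hpos2 : ∀ t ∈ L₂, (t.1 : ℕ) < m ∧ (m : ℕ) + 1 ≤ t.2 := by
      intro t ht
      have h1 := hL.pos t (List.mem_append_right _ (List.mem_cons_of_mem _ ht))
      have h2 : (t.1 : ℕ) ≠ m := fun e => hm2 (Fin.ext e ▸ List.mem_map_of_mem ht)
      omega
    set τ := Equiv.swap m c with hτ
    have hττ : τ⁻¹ = τ := Equiv.swap_inv _ _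
    have hmul : τ * τ = 1 := Equiv.swap_mul_self _ _
    have hτ1 : ∀ t ∈ L₂, τ t.1 = t.1 := fun t ht => by
      have := hpos2 t ht
      exact Equiv.swap_apply_of_ne_of_ne (fun e => by rw [e] at this; omega)
        (ne_of_val_lt_le this.1 (by simp only [Fin.lt_def] at hmltc; omega))
    have hfst : (L₂.map (Prod.map τ τ)).map Prod.fst = L₂.map Prod.fst := by
      rw [List.map_map]
      exact List.map_congr_left fun t ht => hτ1 t ht
    have hprod : u * swapProd (L₁ ++ L₂.map (Prod.map τ τ)) =
        u * swapProd (L₁ ++ (m, c) :: L₂) * τ := by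
      rw [swapProd_append, swapProd_append, swapProd_map, swapProd_cons, hττ]
      simp only [← hτ, mul_assoc]
    have hchain : IsChain (m : ℕ) u (L₁ ++ L₂.map (Prod.map τ τ)) := by
      refine ⟨inc_append.mpr ⟨hi1, ?_⟩, fun t ht => ?_, ?_⟩
      · have := (inc_map τ).mpr hi3
        rwa [mul_assoc, hττ, hmul, mul_one] at this
      · rcases List.mem_append.mp ht with ht | ht
        · have := hpos1 t ht
          omega
        · obtain ⟨t', ht', rfl⟩ := List.mem_map.mp ht
          have h1 := hpos2 t' ht'
          rw [Prod.map_fst, Prod.map_snd, hτ1 t' ht']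
          refine ⟨h1.1, ?_⟩
          rcases eq_or_ne t'.2 c with e | e
          · rw [e, hτ, Equiv.swap_apply_right]
          · rw [hτ, Equiv.swap_apply_of_ne_of_ne (fun e' => by rw [e'] at h1; omega) e]
            omega
      · rw [List.map_append, hfst]
        exact List.nodup_append.mpr ⟨hnd1, hnd2.2, fun a ha b hb =>
          hnd3 a ha b (List.mem_cons_of_mem _ hb)⟩
    have hlen1 := len_add_length_le hchain.inc hchain.pos
    rw [hprod, List.length_append, List.length_map] at hlen1
    rw [List.length_append, List.length_cons] at hl
    have hlen2 : len (u * swapProd (L₁ ++ (m, c) :: L₂) * τ) <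
        len (u * swapProd (L₁ ++ (m, c) :: L₂)) := by
      refine len_mul_swap_lt hmltc ?_
      have htail : IsChain ((m : ℕ) + 1) (u * swapProd L₁ * τ) L₂ :=
        ⟨hi3, fun t ht => hL.pos t (List.mem_append_right _ (List.mem_cons_of_mem _ ht)), hnd2.2⟩
      rw [swapProd_append, swapProd_cons, ← mul_assoc, ← mul_assoc]
      change (u * swapProd L₁ * τ * swapProd L₂) c < (u * swapProd L₁ * τ * swapProd L₂) m
      rw [htail.apply_fst_of_notMem hpm.1 hm2]
      refine (htail.apply_le hpm.2).trans_lt ?_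
      have e1 : (u * swapProd L₁ * τ) c = (u * swapProd L₁) m := by simp [hτ]
      have e2 : (u * swapProd L₁ * τ) m = (u * swapProd L₁) c := by simp [hτ]
      rw [e1, e2]
      exact hi2
    refine ⟨c, hmltc, ?_, ⟨_, ?_, hchain, hprod.symm⟩, ?_⟩
    · change len (u * swapProd (L₁ ++ (m, c) :: L₂) * τ) + 1 = _
      omega
    · rw [List.length_append, List.length_map]
      omega
    · change len (u * swapProd (L₁ ++ (m, c) :: L₂) * τ) = _
      omega
  · left
    refine ⟨⟨L, hl, ⟨hL.inc, fun t ht => ?_, hL.nodup⟩, rfl⟩, hlen⟩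
    have h1 := hL.pos t ht
    have h2 : (t.1 : ℕ) ≠ m := fun e => hm (Fin.ext e ▸ List.mem_map_of_mem ht)
    omega

/-- The converse of the second case of `Up.of_succ`. -/
theorem Up.succ_of_swap {c : Fin n} (hmc : m < c) (hlen : len (w * Equiv.swap m c) + 1 = len w)
    (hup : Up (m : ℕ) j u (w * Equiv.swap m c)) (hw : ∀ b < m, w b < w m) :
    Up ((m : ℕ) + 1) (j + 1) u w := by
  obtain ⟨⟨L, hl, hL, hLw⟩, hlen'⟩ := hup
  -- the pairs with second component `m` come last, so that `(m, c)` can be put before them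
  obtain ⟨hc, hprod⟩ := hL.partition (fun x => decide (x ≠ m))
  set L₁ := L.filter (fun t => decide (t.2 ≠ m)) with hL₁
  set L₂ := L.filter (fun t => !decide (t.2 ≠ m)) with hL₂
  have hlen12 : L₁.length + L₂.length = j := by
    rw [← hl, ← List.length_append]
    exact (List.filter_append_perm (fun t : Fin n × Fin n => decide (t.2 ≠ m)) L).length_eq
  have h2m : ∀ t ∈ L₂, t.2 = m := fun t ht => by simpa using (List.mem_filter.mp ht).2
  have h1m : ∀ t ∈ L₁, t.2 ≠ m := fun t ht => by simpa using (List.mem_filter.mp ht).2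
  obtain ⟨hi1, hi2⟩ := inc_append.mp hc.inc
  have hnd := hc.nodup
  rw [List.map_append, List.nodup_append] at hnd
  set τ := Equiv.swap m c with hτ
  have hττ : τ⁻¹ = τ := Equiv.swap_inv _ _
  have hmul : τ * τ = 1 := Equiv.swap_mul_self _ _
  have hpos2 : ∀ t ∈ L₂, (t.1 : ℕ) < m := fun t ht => (hc.pos t (List.mem_append_right _ ht)).1
  have hτ1 : ∀ t ∈ L₂, τ t.1 = t.1 := fun t ht => by
    have := hpos2 t ht
    exact Equiv.swap_apply_of_ne_of_ne (fun e => by rw [e] at this; omega)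
      (ne_of_val_lt_le this (by simp only [Fin.lt_def] at hmc; omega))
  have hfst : (L₂.map (Prod.map τ τ)).map Prod.fst = L₂.map Prod.fst := by
    rw [List.map_map]
    exact List.map_congr_left fun t ht => hτ1 t ht
  have hwτ : w * τ = u * swapProd L₁ * swapProd L₂ := by
    rw [hLw, ← hprod, swapProd_append, mul_assoc]
  have htail : IsChain (m : ℕ) (u * swapProd L₁) L₂ :=
    ⟨hi2, fun t ht => hc.pos t (List.mem_append_right _ ht), hnd.2.1⟩
  have hvc : (u * swapProd L₁) c = w m := by
    rw [← htail.apply_snd_of_notMem (c := c) (by simp only [Fin.lt_def] at hmc; omega), ← hwτ, hτ]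
    · simp
    · intro h
      obtain ⟨t, ht, e⟩ := List.mem_map.mp h
      rw [h2m t ht] at e
      exact hmc.ne e
  have hvm : (u * swapProd L₁) m < (u * swapProd L₁) c := by
    rw [hvc]
    rcases hcase : L₂ with _ | ⟨t, L₃⟩
    · have h1 : (u * swapProd L₁) m = w c := by
        have := congrArg (fun σ => σ m) hwτ
        simp only [hcase, swapProd_nil, mul_one] at this
        rw [← this, hτ]
        simp
      rw [h1]
      have := (len_mul_swap_lt_iff hmc.ne).mp (show len (w * τ) < len w by omega)
      exact this.mp hmc
    · have ht : t ∈ L₂ := by rw [hcase]; exact List.mem_cons_self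
      rw [hcase] at htail
      have h1 : (u * swapProd L₁) m = w t.1 := by
        have h2 : (u * swapProd L₁ * Equiv.swap t.1 m * swapProd L₃) t.1 = (u * swapProd L₁) m := by
          have := htail.tail.apply_fst_of_notMem (hpos2 t ht) (List.nodup_cons.mp htail.nodup).1
          rw [h2m t ht] at this
          rw [this]
          simp
        rw [← h2]
        have h3 := congrArg (fun σ => σ t.1) hwτ
        rw [hcase, swapProd_cons, ← mul_assoc, h2m t ht] at h3
        rw [← h3, Equiv.Perm.mul_apply, hτ1 t ht]
      rw [h1]
      exact hw _ (hpos2 t ht)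
  refine ⟨⟨L₁ ++ (m, c) :: L₂.map (Prod.map τ τ), ?_, ⟨?_, ?_, ?_⟩, ?_⟩, by omega⟩
  · rw [List.length_append, List.length_cons, List.length_map]
    omega
  · refine inc_append.mpr ⟨hi1, hvm, ?_⟩
    have := (inc_map τ).mpr hi2
    rwa [hττ] at this
  · intro t ht
    rcases List.mem_append.mp ht with ht | ht
    · have h1 := hc.pos t (List.mem_append_left _ ht)
      have h2 : (t.2 : ℕ) ≠ m := fun e => h1m t ht (Fin.ext e)
      omega
    rcases List.mem_cons.mp ht with rfl | ht
    · exact ⟨Nat.lt_succ_self _, hmc⟩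
    · obtain ⟨t', ht', rfl⟩ := List.mem_map.mp ht
      have h1 := hpos2 t' ht'
      rw [Prod.map_fst, Prod.map_snd, hτ1 t' ht', h2m t' ht', hτ, Equiv.swap_apply_left]
      simp only [Fin.lt_def] at hmc
      omega
  · rw [List.map_append, List.map_cons, hfst, List.nodup_append, List.nodup_cons]
    refine ⟨hnd.1, ⟨fun h => ?_, hnd.2.1⟩, fun a ha b hb => ?_⟩
    · obtain ⟨t, ht, e⟩ := List.mem_map.mp h
      have := hpos2 t ht
      rw [e] at this
      exact lt_irrefl _ this
    · rcases List.mem_cons.mp hb with rfl | hb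
      · rintro rfl
        obtain ⟨t, ht, e⟩ := List.mem_map.mp ha
        have := (hc.pos t (List.mem_append_left _ ht)).1
        rw [e] at this
        exact lt_irrefl _ this
      · exact hnd.2.2 a ha b hb
  · rw [swapProd_append, swapProd_cons, swapProd_map, hττ]
    simp only [← hτ]
    rw [show u * (swapProd L₁ * (τ * (τ * swapProd L₂ * τ))) =
      u * swapProd L₁ * (τ * τ) * swapProd L₂ * τ by group, hmul, mul_one, ← hwτ, mul_assoc, hmul,
      mul_one]

/-- The two cases of `Up.of_succ` exclude each other: in the first, `u⁻¹ * w` fixes `m`, in the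
second, it does not. -/
theorem not_up_of_up_swap {j' : ℕ} {c : Fin n} (hmc : m < c)
    (hup : Up (m : ℕ) j u (w * Equiv.swap m c)) (hw : ∀ b < m, w b < w m) :
    ¬ Up (m : ℕ) j' u w := by
  rintro ⟨⟨L, hl, hL, rfl⟩, hlen⟩
  have h1 := hL.apply_snd_of_notMem le_rfl (hL.center_notMem hw)
  obtain ⟨⟨L', hl', hL', hLw⟩, hlen'⟩ := hup
  obtain ⟨γ, hγ1, hγ2⟩ := hL'.exists_label
  have h2 := hγ2 c
  rw [← hLw, Equiv.Perm.mul_apply, Equiv.swap_apply_right, h1,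
    show u⁻¹ (u m) = m from u.symm_apply_apply m, hγ1 m le_rfl,
    hγ1 c (by simp only [Fin.lt_def] at hmc; omega)] at h2
  exact hmc.ne h2

/-- The position `c` in the recursion is the first element `≥ m` met on the cycle of `u⁻¹ * w`
through `m`, hence unique. -/
theorem up_swap_unique {c₁ c₂ : Fin n} (h₁ : m < c₁) (h₂ : m < c₂)
    (hup₁ : Up (m : ℕ) j u (w * Equiv.swap m c₁)) (hup₂ : Up (m : ℕ) j u (w * Equiv.swap m c₂)) :
    c₁ = c₂ := by
  set σ := u⁻¹ * w with hσ
  have aux : ∀ c, m < c → Up (m : ℕ) j u (w * Equiv.swap m c) → ∃ γ : Fin n → Fin n,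
      (∀ x : Fin n, (m : ℕ) ≤ x → γ x = x) ∧ γ (σ m) = c ∧ ∀ x < m, γ (σ x) = γ x := by
    rintro c hmc ⟨⟨L, -, hL, hLw⟩, -⟩
    obtain ⟨γ, hγ1, hγ2⟩ := hL.exists_label
    refine ⟨γ, hγ1, ?_, fun x hx => ?_⟩
    · have := hγ2 c
      rwa [← hLw, Equiv.Perm.mul_apply, Equiv.swap_apply_right,
        hγ1 c (by simp only [Fin.lt_def] at hmc; omega)] at this
    · have := hγ2 x
      rwa [← hLw, Equiv.Perm.mul_apply, Equiv.swap_apply_of_ne_of_ne hx.ne (hx.trans hmc).ne]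
        at this
  obtain ⟨γ₁, a1, a2, a3⟩ := aux c₁ h₁ hup₁
  obtain ⟨γ₂, b1, b2, b3⟩ := aux c₂ h₂ hup₂
  by_contra hne
  have key : ∀ k : ℕ, γ₁ ((σ ^ k) (σ m)) = c₁ ∧ γ₂ ((σ ^ k) (σ m)) = c₂ ∧ (σ ^ k) (σ m) < m := by
    intro k
    have hlt : ∀ y, γ₁ y = c₁ → γ₂ y = c₂ → y < m := by
      intro y h1 h2
      by_contra hy
      rw [a1 y (by simpa using hy)] at h1
      rw [b1 y (by simpa using hy)] at h2
      exact hne (h1.symm.trans h2)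
    induction k with
    | zero => exact ⟨a2, b2, hlt _ a2 b2⟩
    | succ k ih =>
      rw [pow_succ', Equiv.Perm.mul_apply]
      have e1 := (a3 _ ih.2.2).trans ih.1
      have e2 := (b3 _ ih.2.2).trans ih.2.1
      exact ⟨e1, e2, hlt _ e1 e2⟩
  have hpos : 0 < orderOf σ := orderOf_pos σ
  have h := (key (orderOf σ - 1)).2.2
  rw [← Equiv.Perm.mul_apply, ← pow_succ, Nat.sub_add_cancel hpos, pow_orderOf_eq_one] at h
  exact lt_irrefl m h

end

/-! ### The dual of Pieri's rule -/

/-- The elementary symmetric polynomial `e_j` in the first `m` variables, for any `m`. -/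
noncomputable def elemFirst (n m j : ℕ) : MvPolynomial (Fin n) ℤ :=
  ∑ t ∈ powersetCard j ({i : Fin n | (i : ℕ) < m} : Finset (Fin n)), ∏ i ∈ t, X i

theorem elemFirst_zero_right (n m : ℕ) : elemFirst n m 0 = 1 := by simp [elemFirst]

theorem elemFirst_zero_left (n j : ℕ) : elemFirst n 0 (j + 1) = 0 := by
  rw [elemFirst, powersetCard_eq_empty.mpr (by simp), sum_empty]

theorem elemFirst_succ {n : ℕ} (m : Fin n) (j : ℕ) :
    elemFirst n ((m : ℕ) + 1) (j + 1) = elemFirst n m (j + 1) + X m * elemFirst n m j := by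
  have hins : ({i : Fin n | (i : ℕ) < m + 1} : Finset (Fin n)) =
      insert m ({i : Fin n | (i : ℕ) < m} : Finset (Fin n)) := by
    ext i
    simp only [mem_filter_univ, mem_insert, Fin.ext_iff]
    omega
  have hm : m ∉ ({i : Fin n | (i : ℕ) < m} : Finset (Fin n)) := by simp
  rw [elemFirst, hins, powersetCard_succ_insert hm, sum_union, sum_image, elemFirst, elemFirst,
    mul_sum]
  · congr 1
    refine sum_congr rfl fun t ht => prod_insert fun h => hm ((mem_powersetCard.mp ht).1 h)
  · intro s hs t ht hst
    have hs' : m ∉ s := fun h => hm ((mem_powersetCard.mp hs).1 h)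
    have ht' : m ∉ t := fun h => hm ((mem_powersetCard.mp ht).1 h)
    replace hst : insert m s = insert m t := hst
    rw [← erase_insert hs', hst, erase_insert ht']
  · rw [disjoint_left]
    intro t ht ht'
    obtain ⟨s, -, rfl⟩ := mem_image.mp ht'
    exact hm ((mem_powersetCard.mp ht).1 (mem_insert_self m s))

theorem rename_elemFirst {n m j i : ℕ} (hi : i + 1 < n) (him : i + 1 ≠ m) :
    rename (simpleSwap i hi) (elemFirst n m j) = elemFirst n m j := by
  have hmap : ({i : Fin n | (i : ℕ) < m} : Finset (Fin n)).map (simpleSwap i hi).toEmbedding =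
      ({i : Fin n | (i : ℕ) < m} : Finset (Fin n)) := by
    ext x
    rw [mem_map_equiv, mem_filter_univ, mem_filter_univ,
      show (simpleSwap i hi).symm = simpleSwap i hi from Equiv.symm_swap _ _,
      simpleSwap_val_lt_iff hi him]
  rw [elemFirst]
  conv_rhs => rw [← hmap, powersetCard_map, sum_map]
  rw [map_sum]
  refine sum_congr rfl fun t _ => ?_
  simp [map_prod]

theorem elemSym_eq {n : ℕ} (m : Fin n) (j : ℕ) : elemSym m j = elemFirst n m j := by
  have hmap : ({i : Fin n | (i : ℕ) < m} : Finset (Fin n)) =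
      univ.map (Fin.castLEEmb m.isLt.le) := by
    ext x
    simp only [mem_filter_univ, mem_map, mem_univ, true_and, Fin.castLEEmb_apply]
    exact ⟨fun h => ⟨⟨x, h⟩, rfl⟩, fun ⟨y, hy⟩ => hy ▸ y.isLt⟩
  rw [elemSym, esymm, elemFirst, hmap, powersetCard_map, sum_map, map_sum]
  refine sum_congr rfl fun t _ => ?_
  simp [map_prod]

/-- The dual of Pieri's rule. For `m + 1` in place of `m`: if `w` has a descent before the
position `m + 1`, both sides are moved along the divided difference there, under which `e_j` is
symmetric. Otherwise `w` increases on its first `m + 1` positions, and the recursion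
`e_j(x_1, …, x_{m+1}) = e_j(x_1, …, x_m) + x_{m+1} e_{j-1}(x_1, …, x_m)`
matches the recursion for chains, the negative terms of the dual Monk rule being absent. -/
theorem phi_elemFirst_mul {n m : ℕ} (hm : m ≤ n) (j : ℕ) (w : Equiv.Perm (Fin n))
    (f : MvPolynomial (Fin n) ℤ) [DecidablePred fun u => Up m j u w] :
    phi w (elemFirst n m j * f) = ∑ u with Up m j u w, phi u f := by
  classical
  have hzero : ∀ (m : ℕ) (w : Equiv.Perm (Fin n)) (f : MvPolynomial (Fin n) ℤ),
      phi w (elemFirst n m 0 * f) = ∑ u with Up m 0 u w, phi u f := by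
    intro m w f
    rw [elemFirst_zero_right, one_mul]
    have : ∀ u, Up m 0 u w ↔ u = w := by
      intro u
      constructor
      · rintro ⟨⟨L, hl, -, rfl⟩, -⟩
        rw [List.length_eq_zero_iff.mp hl]
        simp
      · rintro rfl
        exact ⟨⟨[], rfl, ⟨trivial, by simp, by simp⟩, by simp⟩, rfl⟩
    rw [sum_filter, sum_eq_single w]
    · simp [this]
    · intro u _ hu
      rw [if_neg (mt (this u).mp hu)]
    · simp
  induction m generalizing j w f with
  | zero =>
    obtain _ | j := j
    · convert hzero 0 w f
    · rw [elemFirst_zero_left, zero_mul, map_zero, sum_eq_zero]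
      intro u hu
      obtain ⟨⟨L, hl, hL, -⟩, -⟩ := (mem_filter_univ _).mp hu
      obtain _ | ⟨t, L⟩ := L
      · simp at hl
      · exact absurd (hL.pos t List.mem_cons_self).1 (Nat.not_lt_zero _)
  | succ m ihm =>
    induction hN : len w using Nat.strong_induction_on generalizing j w f with
    | _ N ih =>
      by_cases hd : ∃ i, ∃ hi : i + 1 < n, i + 1 ≠ m + 1 ∧ i + 1 ≤ m ∧ ¬ Asc w i hi
      · obtain ⟨i, hi, him, -, hda⟩ := hd
        have hlen := len_mul_simpleSwap_of_not_asc hda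
        rw [phi_of_not_asc hda, ddiff_mul_of_symm hi (rename_elemFirst hi him),
          ih _ (by omega) j (w * simpleSwap i hi) _ rfl]
        simp only [phi_ddiff]
        rw [← sum_filter, filter_filter]
        refine sum_bij' (fun u _ => u * simpleSwap i hi) (fun u _ => u * simpleSwap i hi)
          ?_ ?_ ?_ ?_ ?_
        · intro u hu
          rw [mem_filter_univ] at hu ⊢
          rw [← up_conj_iff him hda, mul_simpleSwap_cancel]
          exact hu
        · intro u hu
          rw [mem_filter_univ] at hu ⊢
          exact (up_conj_iff him hda).mpr hu
        · exact fun u _ => mul_simpleSwap_cancel hi u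
        · exact fun u _ => mul_simpleSwap_cancel hi u
        · exact fun u _ => rfl
      · push Not at hd
        obtain _ | j := j
        · convert hzero (m + 1) w f
        set p : Fin n := ⟨m, hm⟩ with hp
        have hw : ∀ b < p, w b < w p := fun b hb =>
          lt_of_asc (lo := 0) (up := m) (fun i hi _ h => hd i hi (by omega) h) (Nat.zero_le _) hb
            le_rfl
        have hE := elemFirst_succ p j
        rw [show ((p : Fin n) : ℕ) = m from rfl] at hE
        rw [hE, add_mul, map_add, mul_assoc, phi_X_mul, ihm (Nat.le_of_succ_le hm)]
        have hmonk : ∀ x, (if len (w * Equiv.swap p x) + 1 = len w then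
            monkSign p x * phi (w * Equiv.swap p x) (elemFirst n m j * f) else 0) =
            ∑ u, if p < x ∧ len (w * Equiv.swap p x) + 1 = len w ∧
              Up m j u (w * Equiv.swap p x) then phi u f else 0 := by
          intro x
          rw [ihm (Nat.le_of_succ_le hm), sum_filter]
          rcases lt_trichotomy p x with hx | rfl | hx
          · simp only [monkSign, hx, if_true, one_mul, true_and, ite_and]
            split_ifs <;> simp
          · simp [monkSign]
          · have := len_lt_len_mul_swap hx (hw x hx)
            rw [Equiv.swap_comm] at this
            rw [if_neg (by omega)]
            simp [hx.not_gt]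
        simp only [hmonk]
        rw [sum_comm, sum_filter, sum_filter, ← sum_add_distrib]
        refine sum_congr rfl fun u _ => ?_
        by_cases h1 : Up m (j + 1) u w
        · rw [if_pos h1, if_pos (h1.succ_left (m := p) hw), sum_eq_zero, add_zero]
          intro x _
          rw [if_neg]
          rintro ⟨hx, -, hup⟩
          exact not_up_of_up_swap (m := p) hx hup hw h1
        · rw [if_neg h1, zero_add]
          by_cases h2 : Up (m + 1) (j + 1) u w
          · obtain ⟨c, hc1, hc2, hc3⟩ := (h2.of_succ (m := p)).resolve_left h1
            rw [if_pos h2, sum_eq_single c, if_pos ⟨hc1, hc2, hc3⟩]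
            · intro x _ hxc
              rw [if_neg]
              rintro ⟨hx, -, hup⟩
              exact hxc (up_swap_unique (m := p) hx hc1 hup hc3)
            · simp
          · rw [if_neg h2, sum_eq_zero]
            intro x _
            rw [if_neg]
            rintro ⟨hx, hlen, hup⟩
            exact h2 (hup.succ_of_swap (m := p) hx hlen hw)

/-! ### Degrees of Schubert polynomials -/

/-- The code of a permutation: the number of smaller values to the right of a position. -/
def code {n : ℕ} (w : Equiv.Perm (Fin n)) (k : Fin n) : ℕ := #{j : Fin n | k < j ∧ w j < w k}

theorem len_eq_sum_code {n : ℕ} (w : Equiv.Perm (Fin n)) : len w = ∑ k, code w k := by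
  rw [len, Finset.card_eq_sum_card_fiberwise (f := Prod.fst) (t := univ) (by simp)]
  refine sum_congr rfl fun k _ => ?_
  rw [code, filter_filter]
  refine card_bij' (fun x _ => x.2) (fun j _ => (k, j)) ?_ ?_ ?_ ?_
  · rintro ⟨x, y⟩ h
    rw [mem_filter_univ] at h
    obtain ⟨⟨h1, h2⟩, rfl⟩ := h
    rw [mem_filter_univ]
    exact ⟨h1, h2⟩
  · intro j h
    rw [mem_filter_univ] at h ⊢
    exact ⟨h, rfl⟩
  · rintro ⟨x, y⟩ h
    rw [mem_filter_univ] at h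
    obtain ⟨-, rfl⟩ := h
    rfl
  · intro j h
    rfl

section
variable {n : ℕ} {w : Equiv.Perm (Fin n)} {i : ℕ} {hi : i + 1 < n}

theorem code_mul_simpleSwap_left (h : Asc w i hi) :
    code (w * simpleSwap i hi) ⟨i, Nat.lt_of_succ_lt hi⟩ = code w ⟨i + 1, hi⟩ + 1 := by
  have : ({j : Fin n | ⟨i, Nat.lt_of_succ_lt hi⟩ < j ∧ (w * simpleSwap i hi) j <
      (w * simpleSwap i hi) ⟨i, Nat.lt_of_succ_lt hi⟩} : Finset (Fin n)) =
      insert ⟨i + 1, hi⟩ ({j : Fin n | ⟨i + 1, hi⟩ < j ∧ w j < w ⟨i + 1, hi⟩} :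
        Finset (Fin n)) := by
    ext j
    rw [mem_filter_univ, mem_insert, mem_filter_univ, Equiv.Perm.mul_apply, Equiv.Perm.mul_apply,
      simpleSwap_left]
    by_cases hj : j = ⟨i + 1, hi⟩
    · subst hj
      rw [simpleSwap_right]
      exact ⟨fun _ => Or.inl rfl, fun _ => ⟨Nat.lt_succ_self i, h⟩⟩
    · rw [or_iff_right hj]
      by_cases hj' : (j : ℕ) = i
      · simp only [Fin.lt_def, hj']
        omega
      · have hj2 : (j : ℕ) ≠ i + 1 := fun e => hj (Fin.ext e)
        rw [simpleSwap_of_ne hi hj' hj2]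
        simp only [Fin.lt_def]
        omega
  rw [code, this, card_insert_of_notMem (by simp), code]

theorem code_mul_simpleSwap_right (h : Asc w i hi) :
    code (w * simpleSwap i hi) ⟨i + 1, hi⟩ = code w ⟨i, Nat.lt_of_succ_lt hi⟩ := by
  rw [code, code]
  congr 1
  ext j
  rw [mem_filter_univ, mem_filter_univ, Equiv.Perm.mul_apply, Equiv.Perm.mul_apply,
    simpleSwap_right]
  by_cases hj' : (j : ℕ) = i
  · simp only [Fin.lt_def, hj']
    omega
  by_cases hj : (j : ℕ) = i + 1
  · obtain rfl : j = ⟨i + 1, hi⟩ := Fin.ext hj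
    have := not_lt_of_gt h
    simp only [lt_irrefl, false_and, this, and_false]
  · rw [simpleSwap_of_ne hi hj' hj]
    simp only [Fin.lt_def]
    omega

theorem code_mul_simpleSwap_of_ne {k : Fin n} (h1 : (k : ℕ) ≠ i) (h2 : (k : ℕ) ≠ i + 1) :
    code (w * simpleSwap i hi) k = code w k := by
  have hk := simpleSwap_of_ne hi h1 h2
  rw [code, code]
  refine card_equiv (simpleSwap i hi) fun j => ?_
  rw [mem_filter_univ, mem_filter_univ, Equiv.Perm.mul_apply, Equiv.Perm.mul_apply, hk]
  by_cases hj : j = k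
  · subst hj
    rw [hk]
  · have := simpleSwap_lt_iff hi (x := k) (y := j) (by rwa [hk])
    rw [hk] at this
    rw [this]

theorem code_le_of_asc (h : Asc w i hi) :
    code w ⟨i, Nat.lt_of_succ_lt hi⟩ ≤ code w ⟨i + 1, hi⟩ := by
  refine card_le_card fun j hj => ?_
  rw [mem_filter_univ] at hj ⊢
  refine ⟨lt_of_le_of_ne (Fin.le_def.mpr (Fin.lt_def.mp hj.1)) ?_, hj.2.trans h⟩
  rintro rfl
  exact lt_asymm h hj.2

theorem code_lt_of_not_asc (h : ¬ Asc w i hi) :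
    code w ⟨i + 1, hi⟩ < code w ⟨i, Nat.lt_of_succ_lt hi⟩ := by
  have h' := asc_mul_simpleSwap.mpr h
  have h1 := code_mul_simpleSwap_left h'
  have h2 := code_mul_simpleSwap_right h'
  have h3 := code_le_of_asc h'
  rw [mul_simpleSwap_cancel] at h1 h2
  omega

/-- The code of the permutation that reverses the first `N` positions. -/
theorem code_of_not_asc {N : ℕ} (hN : N ≤ n) (hfix : ∀ x : Fin n, N ≤ (x : ℕ) → w x = x)
    (h : ∀ i hi, i + 1 < N → ¬ Asc w i hi) (k : Fin n) : code w k = N - 1 - (k : ℕ) := by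
  have hdesc : ∀ (d : ℕ) (x y : Fin n), (y : ℕ) = x + d + 1 → (y : ℕ) < N → w y < w x := by
    intro d
    induction d with
    | zero =>
      intro x y hxy hy
      have hi : (x : ℕ) + 1 < n := by have := y.isLt; omega
      obtain rfl : y = ⟨x + 1, hi⟩ := Fin.ext hxy
      exact not_asc.mp (h x hi hy)
    | succ d ih =>
      intro x y hxy hy
      have hi : (x + d + 1 : ℕ) + 1 < n := by have := y.isLt; omega
      obtain rfl : y = ⟨x + d + 1 + 1, hi⟩ := Fin.ext hxy
      simp only at hy
      exact (not_asc.mp (h (x + d + 1) hi hy)).trans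
        (ih x ⟨x + d + 1, Nat.lt_of_succ_lt hi⟩ rfl (by simp only; omega))
  have : ({j : Fin n | k < j ∧ w j < w k} : Finset (Fin n)) =
      ({j : Fin n | (k : ℕ) < j ∧ (j : ℕ) < N} : Finset (Fin n)) := by
    ext j
    rw [mem_filter_univ, mem_filter_univ, Fin.lt_def]
    refine and_congr_right fun hkj => ⟨fun hj => ?_, fun hj => ?_⟩
    · by_contra hjN
      rw [hfix j (by omega)] at hj
      have hwk : N ≤ (w k : ℕ) := by simp only [Fin.lt_def] at hj; omega
      have := w.injective (hfix _ hwk)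
      rw [this] at hj
      simp only [Fin.lt_def] at hj
      omega
    · exact hdesc (j - k - 1) k j (by omega) hj
  rw [code, this]
  have hmap : ({j : Fin n | (k : ℕ) < j ∧ (j : ℕ) < N} : Finset (Fin n)).map Fin.valEmbedding =
      Ioo (k : ℕ) N := by
    ext x
    simp only [mem_map, mem_filter_univ, Fin.valEmbedding_apply, mem_Ioo]
    exact ⟨fun ⟨y, hy, e⟩ => e ▸ hy, fun hx => ⟨⟨x, by omega⟩, hx, rfl⟩⟩
  rw [← card_map, hmap, Nat.card_Ioo]
  omega

end

theorem rename_prod_X_pow {n i : ℕ} (hi : i + 1 < n) {e : Fin n → ℕ}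
    (he : e ⟨i, Nat.lt_of_succ_lt hi⟩ = e ⟨i + 1, hi⟩) :
    rename (simpleSwap i hi) (∏ k, X k ^ e k : MvPolynomial (Fin n) ℤ) = ∏ k, X k ^ e k := by
  rw [map_prod, ← Equiv.prod_comp (simpleSwap i hi)]
  conv_rhs => rw [← Equiv.prod_comp (simpleSwap i hi)]
  rw [← Equiv.prod_comp (simpleSwap i hi)]
  refine prod_congr rfl fun k _ => ?_
  rw [map_pow, rename_X]
  have hss : simpleSwap i hi (simpleSwap i hi k) = k := by
    rw [← Equiv.Perm.mul_apply, simpleSwap_mul_self]; rfl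
  rw [hss]
  congr 1
  by_cases h1 : (k : ℕ) = i
  · obtain rfl : k = ⟨i, Nat.lt_of_succ_lt hi⟩ := Fin.ext h1
    rw [simpleSwap_left, he]
  by_cases h2 : (k : ℕ) = i + 1
  · obtain rfl : k = ⟨i + 1, hi⟩ := Fin.ext h2
    rw [simpleSwap_right, he]
  · rw [simpleSwap_of_ne hi h1 h2]

/-- The Schubert polynomial of a permutation with weakly decreasing code is a monomial. -/
theorem schubert_of_code {n : ℕ} (w : Equiv.Perm (Fin n))
    (h : ∀ i (hi : i + 1 < n), code w ⟨i + 1, hi⟩ ≤ code w ⟨i, Nat.lt_of_succ_lt hi⟩) :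
    schubert w = ∏ k, X k ^ code w k := by
  induction hN : n * n - len w using Nat.strong_induction_on generalizing w with
  | _ N ih =>
    by_cases hex : ∃ i, ∃ hi : i + 1 < n, Asc w i hi
    swap
    · push Not at hex
      rw [schubert_of_forall_not_asc hex]
      refine prod_congr rfl fun k _ => ?_
      rw [code_of_not_asc le_rfl (fun x hx => absurd x.isLt (by omega)) fun i hi _ => hex i hi]
    -- at the first ascent the code stays weakly decreasing after the exchange
    classical
    obtain ⟨i, hi, ha, hmin⟩ : ∃ i, ∃ hi : i + 1 < n, Asc w i hi ∧ ∀ l hl, l < i → ¬ Asc w l hl :=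
      ⟨Nat.find hex, (Nat.find_spec hex).1, (Nat.find_spec hex).2,
        fun l hl hlt ha => Nat.find_min hex hlt ⟨hl, ha⟩⟩
    have heq := le_antisymm (code_le_of_asc ha) (h i hi)
    have e1 := code_mul_simpleSwap_left ha
    have e2 := code_mul_simpleSwap_right ha
    have hlen := len_mul_simpleSwap ha
    have hle := len_le (w * simpleSwap i hi)
    have hother : ∀ k : Fin n, (k : ℕ) ≠ i → (k : ℕ) ≠ i + 1 →
        code (w * simpleSwap i hi) k = code w k := fun k h1 h2 => code_mul_simpleSwap_of_ne h1 h2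
    have hw' : schubert (w * simpleSwap i hi) =
        (∏ k, X k ^ code w k) * X ⟨i, Nat.lt_of_succ_lt hi⟩ := by
      rw [ih _ (by omega) (w * simpleSwap i hi) ?_ rfl]
      · rw [← Finset.prod_erase_mul _ _ (mem_univ (⟨i, Nat.lt_of_succ_lt hi⟩ : Fin n)),
          ← Finset.prod_erase_mul univ (fun k => X k ^ code w k)
            (mem_univ (⟨i, Nat.lt_of_succ_lt hi⟩ : Fin n)), e1, ← heq, pow_succ, ← mul_assoc]
        congr 2
        refine prod_congr rfl fun k hk => ?_
        have hk1 : (k : ℕ) ≠ i := fun e => (mem_erase.mp hk).1 (Fin.ext e)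
        by_cases hk2 : (k : ℕ) = i + 1
        · obtain rfl : k = ⟨i + 1, hi⟩ := Fin.ext hk2
          rw [e2, heq]
        · rw [hother k hk1 hk2]
      · intro l hl
        by_cases h1 : l = i
        · subst h1
          rw [e1, e2]
          omega
        by_cases h2 : l = i + 1
        · subst h2
          rw [e2, hother _ (by simp only; omega) (by simp only; omega), heq]
          exact h _ _
        by_cases h3 : l + 1 = i
        · have h4 := code_lt_of_not_asc (hmin l hl (by omega))
          have h5 : code (w * simpleSwap i hi) ⟨l + 1, hl⟩ = code w ⟨l + 1, hl⟩ + 1 := by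
            have h6 : (⟨l + 1, hl⟩ : Fin n) = ⟨i, Nat.lt_of_succ_lt hi⟩ := Fin.ext h3
            rw [h6, e1, heq]
          rw [h5, hother ⟨l, Nat.lt_of_succ_lt hl⟩ (by simp only; omega) (by simp only; omega)]
          exact h4
        · rw [hother _ (by simp only; omega) (by simp only; omega),
            hother _ (by simp only; omega) (by simp only; omega)]
          exact h l hl
    rw [schubert_eq_ddiff ha, hw', ddiff_mul_of_symm hi (rename_prod_X_pow hi heq), ddiff_X,
      simpleSwap_left]
    simp [monkSign, Fin.lt_def]

theorem code_one {n : ℕ} (k : Fin n) : code (1 : Equiv.Perm (Fin n)) k = 0 := by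
  rw [code, card_eq_zero, filter_eq_empty_iff]
  rintro j - ⟨h1, h2⟩
  exact lt_asymm h1 h2

theorem schubert_one {n : ℕ} : schubert (1 : Equiv.Perm (Fin n)) = 1 := by
  rw [schubert_of_code 1 (fun i hi => by rw [code_one, code_one])]
  simp [code_one]

theorem isHomogeneous_ddiff {n i d : ℕ} (hi : i + 1 < n) {f : MvPolynomial (Fin n) ℤ}
    (hf : f.IsHomogeneous (d + 1)) : (ddiff i hi f).IsHomogeneous d := by
  let _ : GradedAlgebra (homogeneousSubmodule (Fin n) ℤ) := gradedAlgebra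
  have h1 : (X ⟨i, Nat.lt_of_succ_lt hi⟩ - X ⟨i + 1, hi⟩ : MvPolynomial (Fin n) ℤ) ∈
      homogeneousSubmodule (Fin n) ℤ 1 := (isHomogeneous_X _ _).sub (isHomogeneous_X _ _)
  have h2 : (f - rename (simpleSwap i hi) f) ∈ homogeneousSubmodule (Fin n) ℤ (d + 1) :=
    hf.sub hf.rename_isHomogeneous
  rw [ddiff_spec hi] at h2
  -- the component of degree `e` of the quotient, times `x_i - x_{i+1}`, is one of degree `e + 1`
  have h3 : ∀ e, e ≠ d → homogeneousComponent e (ddiff i hi f) = 0 := by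
    intro e he
    have h4 := DirectSum.coe_decompose_mul_add_of_left_mem (homogeneousSubmodule (Fin n) ℤ)
      (i := 1) (j := e) (b := ddiff i hi f) h1
    have h5 := DirectSum.decompose_of_mem_ne (homogeneousSubmodule (Fin n) ℤ) h2
      (show d + 1 ≠ 1 + e by omega)
    rw [h5] at h4
    have h6 := (mul_eq_zero.mp h4.symm).resolve_left (X_sub_X_ne_zero (by simp))
    exact (decomposition.decompose'_apply _ e).symm.trans h6
  rw [← sum_homogeneousComponent (ddiff i hi f)]
  refine IsHomogeneous.sum _ _ _ fun e _ => ?_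
  by_cases he : e = d
  · rw [he]
    exact homogeneousComponent_isHomogeneous _ _
  · rw [h3 e he]
    exact isHomogeneous_zero _ _ _

/-- Homogeneity enters only through the constant coefficient of `schubert u`, which vanishes unless
`u = 1`. -/
theorem isHomogeneous_schubert {n : ℕ} (w : Equiv.Perm (Fin n)) :
    (schubert w).IsHomogeneous (len w) := by
  induction hN : n * n - len w using Nat.strong_induction_on generalizing w with
  | _ N ih =>
    by_cases hex : ∃ i, ∃ hi : i + 1 < n, Asc w i hi
    · obtain ⟨i, hi, ha⟩ := hex
      have hlen := len_mul_simpleSwap ha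
      have hle := len_le (w * simpleSwap i hi)
      rw [schubert_eq_ddiff ha]
      refine isHomogeneous_ddiff hi ?_
      rw [← hlen]
      exact ih _ (by omega) _ rfl
    · push Not at hex
      rw [schubert_of_forall_not_asc hex, len_eq_sum_code]
      refine IsHomogeneous.prod _ _ _ fun k _ => ?_
      rw [code_of_not_asc le_rfl (fun x hx => absurd x.isLt (by omega)) fun i hi _ => hex i hi]
      exact isHomogeneous_X_pow _ _

/-- The functionals `phi` are dual to the Schubert polynomials. -/
theorem phi_schubert {n : ℕ} (w u : Equiv.Perm (Fin n)) :
    phi w (schubert u) = if u = w then 1 else 0 := by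
  classical
  induction hN : len w using Nat.strong_induction_on generalizing w u with
  | _ N ih =>
    by_cases hex : ∃ i, ∃ hi : i + 1 < n, ¬ Asc w i hi
    · obtain ⟨i, hi, ha⟩ := hex
      have hlen := len_mul_simpleSwap_of_not_asc ha
      rw [phi_of_not_asc ha, ddiff_schubert]
      split_ifs with h1 h2 h2
      · exact absurd (h2 ▸ h1) ha
      · simp
      · rw [ih _ (by omega) _ _ rfl, h2, if_pos rfl]
      · rw [ih _ (by omega) _ _ rfl, if_neg fun e => h2 (mul_right_cancel e)]
    · push Not at hex
      obtain rfl := eq_one_of_asc hex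
      rw [phi_one]
      split_ifs with h
      · rw [h, schubert_one, map_one]
      · refine (isHomogeneous_schubert u).coeff_eq_zero ?_
        intro h0
        have h0 : len u = 0 := by simpa using h0.symm
        refine h (eq_one_of_asc fun i hi => ?_)
        by_contra ha
        have := len_mul_simpleSwap_of_not_asc ha
        omega

/-! ### Polynomials below the staircase -/

/-- The exponent of the variable at the zero-based position `k` is at most `N - 1 - k`. -/
def BelowStaircase {n : ℕ} (N : ℕ) (f : MvPolynomial (Fin n) ℤ) : Prop :=
  ∀ k : Fin n, degreeOf k f ≤ N - 1 - (k : ℕ)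

section
variable {n : ℕ}

theorem degreeOf_X_sub_X {i j k : Fin n} (hij : i ≠ j) (hk : k = i ∨ k = j) :
    1 ≤ degreeOf k (X i - X j : MvPolynomial (Fin n) ℤ) := by
  have : Finsupp.single k 1 ∈ (X i - X j : MvPolynomial (Fin n) ℤ).support := by
    rw [mem_support_iff, coeff_sub, coeff_X, coeff_X]
    rcases hk with rfl | rfl
    · simp [Finsupp.single_left_inj, hij.symm]
    · simp [Finsupp.single_left_inj, hij]
  simpa using monomial_le_degreeOf k this

theorem degreeOf_rename_simpleSwap {i : ℕ} (hi : i + 1 < n) (f : MvPolynomial (Fin n) ℤ)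
    (k : Fin n) :
    degreeOf k (rename (simpleSwap i hi) f) = degreeOf (simpleSwap i hi k) f := by
  have := degreeOf_rename_of_injective (p := f) (simpleSwap i hi).injective (simpleSwap i hi k)
  rwa [show simpleSwap i hi (simpleSwap i hi k) = k by
    rw [← Equiv.Perm.mul_apply, simpleSwap_mul_self]; rfl] at this

theorem degreeOf_ddiff_le {i : ℕ} (hi : i + 1 < n) {f : MvPolynomial (Fin n) ℤ}
    (h : ddiff i hi f ≠ 0) (k : Fin n) :
    degreeOf k (X ⟨i, Nat.lt_of_succ_lt hi⟩ - X ⟨i + 1, hi⟩ : MvPolynomial (Fin n) ℤ) +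
      degreeOf k (ddiff i hi f) ≤ max (degreeOf k f) (degreeOf (simpleSwap i hi k) f) := by
  rw [← degreeOf_mul_eq (X_sub_X_ne_zero (by simp)) h, ← ddiff_spec,
    ← degreeOf_rename_simpleSwap hi f k]
  exact degreeOf_sub_le _ _ _

theorem BelowStaircase.ddiff {N i : ℕ} (hi : i + 1 < n) (hN : i + 1 < N)
    {f : MvPolynomial (Fin n) ℤ} (hf : BelowStaircase N f) : BelowStaircase N (ddiff i hi f) := by
  intro k
  by_cases h : Schub.ddiff i hi f = 0
  · rw [h]
    simp
  have h1 := degreeOf_ddiff_le hi h k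
  have h2 := hf ⟨i, Nat.lt_of_succ_lt hi⟩
  have h3 := hf ⟨i + 1, hi⟩
  simp only at h2 h3
  by_cases hk1 : (k : ℕ) = i
  · obtain rfl : k = ⟨i, Nat.lt_of_succ_lt hi⟩ := Fin.ext hk1
    rw [simpleSwap_left] at h1
    have h4 := degreeOf_X_sub_X (i := ⟨i, Nat.lt_of_succ_lt hi⟩) (j := ⟨i + 1, hi⟩) (by simp)
      (Or.inl rfl)
    simp only
    omega
  by_cases hk2 : (k : ℕ) = i + 1
  · obtain rfl : k = ⟨i + 1, hi⟩ := Fin.ext hk2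
    rw [simpleSwap_right] at h1
    have h4 := degreeOf_X_sub_X (i := ⟨i, Nat.lt_of_succ_lt hi⟩) (j := ⟨i + 1, hi⟩) (by simp)
      (Or.inr rfl)
    simp only
    omega
  · rw [simpleSwap_of_ne hi hk1 hk2] at h1
    have := hf k
    omega

theorem belowStaircase_schubert {N : ℕ} (hN : N ≤ n) (w : Equiv.Perm (Fin n))
    (hfix : ∀ x : Fin n, N ≤ (x : ℕ) → w x = x) : BelowStaircase N (schubert w) := by
  induction hl : n * n - len w using Nat.strong_induction_on generalizing w with
  | _ l ih =>
    by_cases hex : ∃ i, ∃ hi : i + 1 < n, i + 1 < N ∧ Asc w i hi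
    · obtain ⟨i, hi, hiN, ha⟩ := hex
      have hlen := len_mul_simpleSwap ha
      have hle := len_le (w * simpleSwap i hi)
      rw [schubert_eq_ddiff ha]
      refine (ih _ (by omega) (w * simpleSwap i hi) (fun x hx => ?_) rfl).ddiff hi hiN
      rw [Equiv.Perm.mul_apply, simpleSwap_of_ne hi (by omega) (by omega), hfix x hx]
    · push Not at hex
      have hcode := code_of_not_asc hN hfix hex
      rw [schubert_of_code w fun i hi => by rw [hcode, hcode]; simp only; omega]
      intro k
      refine (degreeOf_prod_le _ _ _).trans ?_
      rw [sum_eq_single k]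
      · refine (degreeOf_pow_le _ _ _).trans ?_
        rw [degreeOf_X, if_pos rfl, mul_one, hcode]
      · intro j _ hj
        refine Nat.le_zero.mp ((degreeOf_pow_le _ _ _).trans ?_)
        rw [degreeOf_X, if_neg hj.symm, mul_zero]
      · simp

theorem totalDegree_ddiff_lt {i : ℕ} (hi : i + 1 < n) {f : MvPolynomial (Fin n) ℤ}
    (h : ddiff i hi f ≠ 0) : (ddiff i hi f).totalDegree < f.totalDegree := by
  have hX : (X ⟨i, Nat.lt_of_succ_lt hi⟩ - X ⟨i + 1, hi⟩ : MvPolynomial (Fin n) ℤ) ≠ 0 :=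
    X_sub_X_ne_zero (by simp)
  have h1 := totalDegree_mul_of_isDomain hX h
  rw [((isHomogeneous_X _ _).sub (isHomogeneous_X _ _)).totalDegree hX, ← ddiff_spec] at h1
  have h2 := totalDegree_sub f (rename (simpleSwap i hi) f)
  have h3 := totalDegree_rename_le (simpleSwap i hi) f
  omega

/-- The functionals `phi` separate the polynomials below the staircase: if all divided differences
vanish, the polynomial is symmetric, and it does not contain the last variable. -/
theorem BelowStaircase.eq_zero {g : MvPolynomial (Fin n) ℤ} (hg : BelowStaircase n g)
    (h : ∀ w, phi w g = 0) : g = 0 := by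
  classical
  induction hd : g.totalDegree using Nat.strong_induction_on generalizing g with
  | _ d ih =>
    have hdd : ∀ i hi, Schub.ddiff i hi g = 0 := by
      intro i hi
      by_contra hne
      refine hne (ih _ (hd ▸ totalDegree_ddiff_lt hi hne) (hg.ddiff hi hi) (fun w => ?_) rfl)
      rw [phi_ddiff]
      split_ifs
      · exact h _
      · rfl
    have hsymm : ∀ i hi, rename (simpleSwap i hi) g = g := by
      intro i hi
      have := ddiff_spec hi g
      rw [hdd i hi, mul_zero] at this
      exact (sub_eq_zero.mp this).symm
    have hdeg : ∀ (e : ℕ) (k : Fin n), (k : ℕ) + e + 1 = n → degreeOf k g = 0 := by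
      intro e
      induction e with
      | zero =>
        intro k hk
        have := hg k
        omega
      | succ e ihe =>
        intro k hk
        have hk' : (k : ℕ) + 1 < n := by omega
        have h1 := degreeOf_rename_simpleSwap hk' g k
        rw [hsymm, simpleSwap_left hk', ihe ⟨k + 1, hk'⟩ (by simp only; omega)] at h1
        exact h1
    have htot : g.totalDegree = 0 := by
      rw [totalDegree_eq_zero_iff]
      intro m hm k
      have := monomial_le_degreeOf k hm
      rw [hdeg (n - 1 - k) k (by omega)] at this
      exact Nat.le_zero.mp this
    rw [totalDegree_eq_zero_iff_eq_C.mp htot]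
    have h1 := h 1
    rw [phi_one] at h1
    rw [show coeff 0 g = 0 from h1, map_zero]

theorem degreeOf_elemFirst_le (m j : ℕ) (k : Fin n) :
    degreeOf k (elemFirst n m j) ≤ if (k : ℕ) < m then 1 else 0 := by
  refine (degreeOf_sum_le _ _ _).trans (Finset.sup_le fun t ht => ?_)
  refine (degreeOf_prod_le _ _ _).trans ?_
  simp only [degreeOf_X]
  rw [sum_ite_eq]
  split_ifs with h1 h2 h2
  · exact le_rfl
  · exact absurd ((mem_filter_univ _).mp ((mem_powersetCard.mp ht).1 h1)) h2
  · exact Nat.zero_le _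
  · exact le_rfl

/-- Pieri's rule inside `S_n`: as `u` fixes the last position, the product does not leave `S_n`. -/
theorem schubert_mul_elemSym {u : Equiv.Perm (Fin n)} (hu : ∀ x : Fin n, (x : ℕ) + 1 = n → u x = x)
    (m : Fin n) (j : ℕ) [DecidablePred fun v => Up (m : ℕ) j u v] :
    schubert u * elemSym m j = ∑ v with Up (m : ℕ) j u v, schubert v := by
  classical
  rw [← sub_eq_zero]
  refine BelowStaircase.eq_zero (fun k => ?_) fun w => ?_
  · refine (degreeOf_sub_le _ _ _).trans (max_le ?_ ?_)
    · refine (degreeOf_mul_le _ _ _).trans ?_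
      have h1 := belowStaircase_schubert (N := n - 1) (Nat.sub_le _ _) u
        (fun x hx => hu x (by have := x.isLt; omega)) k
      have h2 := degreeOf_elemFirst_le (n := n) m j k
      rw [elemSym_eq]
      have := m.isLt
      split_ifs at h2 <;> omega
    · refine (degreeOf_sum_le _ _ _).trans (Finset.sup_le fun v _ => ?_)
      exact belowStaircase_schubert le_rfl v (fun x hx => absurd x.isLt (by omega)) k
  · rw [map_sub, mul_comm, elemSym_eq, phi_elemFirst_mul m.isLt.le, map_sum]
    simp only [phi_schubert]
    rw [sum_ite_eq, sum_ite_eq']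
    simp

end

/-! ### The reduction of a permutation -/

/-- The relation `IsReduction` for an arbitrary position `c` in place of `a p`. -/
def IsRed {n : ℕ} (w : Equiv.Perm (Fin n)) (c : Fin n) (u : Equiv.Perm (Fin n)) : Prop :=
  (∀ i, i < c → w i < w c → u i = w i) ∧
  (∀ i, i < c → w c < w i → (u i : ℕ) = (w i : ℕ) - 1) ∧
  (∀ (i : ℕ) (hi : i + 1 < n), (c : ℕ) ≤ i →
    (u ⟨i, Nat.lt_of_succ_lt hi⟩ : ℕ) = (w ⟨i + 1, hi⟩ : ℕ) - 1) ∧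
  (∀ i : Fin n, (i : ℕ) + 1 = n → u i = i)

/-- The cycle that moves `q` to the last place and lowers everything above `q` by one. -/
noncomputable def moveToLast {n : ℕ} (q : Fin n) : Equiv.Perm (Fin n) :=
  Equiv.ofBijective
    (fun v => if v < q then v else if v = q then ⟨n - 1, by have := q.isLt; omega⟩
      else ⟨v - 1, by have := v.isLt; omega⟩)
    (Finite.injective_iff_bijective.mp (by
      intro x y h
      have hx := x.isLt
      have hy := y.isLt
      simp only [Fin.lt_def, Fin.ext_iff] at h ⊢
      split_ifs at h <;> (try simp only at h) <;> omega))

section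
variable {n : ℕ} {w u : Equiv.Perm (Fin n)} {c : Fin n}

theorem moveToLast_of_lt {q v : Fin n} (h : v < q) : moveToLast q v = v := if_pos h

theorem moveToLast_self (q : Fin n) : (moveToLast q q : ℕ) = n - 1 := by
  simp [moveToLast]

theorem moveToLast_of_gt {q v : Fin n} (h : q < v) : (moveToLast q v : ℕ) = v - 1 := by
  simp [moveToLast, h.not_gt, h.ne']

theorem exists_isRed (hw : ∀ x y : Fin n, c ≤ x → x < y → w x < w y) : ∃ u, IsRed w c u := by
  refine ⟨moveToLast (w c) * w * (moveToLast c)⁻¹, ?_, ?_, ?_, ?_⟩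
  · intro i hi h
    have : (moveToLast c)⁻¹ i = i := by rw [Equiv.Perm.inv_eq_iff_eq, moveToLast_of_lt hi]
    rw [Equiv.Perm.mul_apply, Equiv.Perm.mul_apply, this, moveToLast_of_lt h]
  · intro i hi h
    have : (moveToLast c)⁻¹ i = i := by rw [Equiv.Perm.inv_eq_iff_eq, moveToLast_of_lt hi]
    rw [Equiv.Perm.mul_apply, Equiv.Perm.mul_apply, this, moveToLast_of_gt h]
  · intro i hi hci
    have hlt : c < ⟨i + 1, hi⟩ := by simp only [Fin.lt_def]; omega
    have : (moveToLast c)⁻¹ ⟨i, Nat.lt_of_succ_lt hi⟩ = ⟨i + 1, hi⟩ := by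
      rw [Equiv.Perm.inv_eq_iff_eq]
      exact Fin.ext (moveToLast_of_gt hlt).symm
    rw [Equiv.Perm.mul_apply, Equiv.Perm.mul_apply, this,
      moveToLast_of_gt (hw c _ le_rfl hlt)]
  · intro i hi
    have : (moveToLast c)⁻¹ i = c := by
      rw [Equiv.Perm.inv_eq_iff_eq]
      exact Fin.ext (by rw [moveToLast_self]; omega)
    rw [Equiv.Perm.mul_apply, Equiv.Perm.mul_apply, this]
    exact Fin.ext (by rw [moveToLast_self]; omega)

theorem IsRed.unique {u' : Equiv.Perm (Fin n)} (h : IsRed w c u) (h' : IsRed w c u') : u = u' := by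
  refine Equiv.ext fun i => ?_
  rcases Nat.lt_or_ge i c with hi | hi
  · rcases lt_trichotomy (w i) (w c) with hlt | heq | hgt
    · rw [h.1 i hi hlt, h'.1 i hi hlt]
    · exact absurd (congrArg Fin.val (w.injective heq)) hi.ne
    · exact Fin.ext ((h.2.1 i hi hgt).trans (h'.2.1 i hi hgt).symm)
  · by_cases hn : (i : ℕ) + 1 < n
    · exact Fin.ext ((h.2.2.1 i hn hi).trans (h'.2.2.1 i hn hi).symm)
    · have hn' : (i : ℕ) + 1 = n := by have := i.isLt; omega
      rw [h.2.2.2 i hn', h'.2.2.2 i hn']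

/-- The reduction is undone by a saturated chain, which raises by one, in increasing order, the
values that the reduction has lowered on the left. The positions from `m` to `c` hold values below
`w c`; this generality lets the induction on the value at `c` move `c` to the right. -/
theorem IsRed.exists_chain {m : ℕ} (hred : IsRed w c u) (hmc : m ≤ (c : ℕ))
    (hw : ∀ x y : Fin n, c ≤ x → x < y → w x < w y)
    (hw' : ∀ x : Fin n, m ≤ (x : ℕ) → x < c → w x < w c) :
    ∃ L, IsChain m u L ∧ w = u * swapProd L ∧ len w = len u + L.length ∧
      L.length = #{b : Fin n | (b : ℕ) < m ∧ w c < w b} ∧ ∀ t ∈ L, w c < w t.1 := by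
  induction hN : n - (w c : ℕ) using Nat.strong_induction_on generalizing w c with
  | _ N ih =>
    obtain ⟨r1, r2, r3, r4⟩ := id hred
    have hc := c.isLt
    have hwc := (w c).isLt
    by_cases htop : (w c : ℕ) + 1 = n
    · have hlast : (c : ℕ) + 1 = n := by
        by_contra hne
        have h1 := hw c ⟨c + 1, by omega⟩ le_rfl (by simp [Fin.lt_def])
        have h2 := (w ⟨c + 1, by omega⟩).isLt
        simp only [Fin.lt_def] at h1
        omega
      have huw : w = u := by
        refine Equiv.ext fun i => ?_
        rcases lt_or_ge i c with hi | hi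
        · refine (r1 i hi ?_).symm
          have h1 := (w i).isLt
          have h2 : w i ≠ w c := fun e => hi.ne (w.injective e)
          simp only [Fin.lt_def, Fin.ext_iff, ne_eq] at h2 ⊢
          omega
        · have hi' : i = c := by
            have h1 := i.isLt
            simp only [Fin.le_def, Fin.ext_iff] at hi ⊢
            omega
          subst hi'
          rw [r4 i hlast]
          exact Fin.ext (by omega)
      refine ⟨[], ⟨trivial, by simp, by simp⟩, by simp [huw], by simp [huw], ?_, by simp⟩
      symm
      rw [List.length_nil, card_eq_zero, filter_eq_empty_iff]
      rintro b - ⟨-, h⟩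
      have := (w b).isLt
      simp only [Fin.lt_def] at h
      omega
    obtain ⟨x, hx⟩ := w.surjective ⟨w c + 1, by omega⟩
    have hx' : (w x : ℕ) = w c + 1 := by rw [hx]
    have hne : ∀ y, y ≠ x → (w y : ℕ) ≠ w c + 1 := fun y hy e =>
      hy (w.injective (Fin.ext (e.trans hx'.symm)))
    have hne' : ∀ y, y ≠ c → (w y : ℕ) ≠ w c := fun y hy e => hy (w.injective (Fin.ext e))
    rcases lt_trichotomy x c with hxc | rfl | hxc
    · -- the value `w c + 1` is on the left: exchange it with the value at `c`
      have hxm : (x : ℕ) < m := by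
        by_contra h
        have := hw' x (not_lt.mp h) hxc
        simp only [Fin.lt_def] at this
        omega
      set w₁ := w * Equiv.swap x c with hw₁
      have e1 : w₁ x = w c := by simp [hw₁]
      have e2 : w₁ c = w x := by simp [hw₁]
      have e3 : ∀ y, y ≠ x → y ≠ c → w₁ y = w y := fun y h1 h2 => by
        rw [hw₁, Equiv.Perm.mul_apply, Equiv.swap_apply_of_ne_of_ne h1 h2]
      have hmul : w₁ * Equiv.swap x c = w := by rw [hw₁, mul_assoc, Equiv.swap_mul_self, mul_one]
      have hlen : len w = len w₁ + 1 := by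
        have h1 := len_mul_swap (c - x) w₁ x c (by simp only [Fin.lt_def] at hxc; omega)
          (by rw [e1, e2]; simp only [Fin.lt_def]; omega)
        rw [hmul, card_eq_zero.mpr] at h1
        · simpa using h1
        · rw [filter_eq_empty_iff]
          rintro y - ⟨-, -, h2, h3⟩
          rw [e1] at h2
          rw [e2] at h3
          simp only [Fin.lt_def] at h2 h3
          omega
      have key := ih (n - (w₁ c : ℕ)) (by rw [e2]; omega) (w := w₁) (c := c)
        ⟨?_, ?_, ?_, r4⟩ hmc ?_ ?_ rfl
      · obtain ⟨L, h1, h2, h3, h4, h5⟩ := key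
        have hxL : x ∉ L.map Prod.fst := by
          intro h
          obtain ⟨t, ht, e⟩ := List.mem_map.mp h
          have := h5 t ht
          rw [e, e1, e2] at this
          simp only [Fin.lt_def] at this
          omega
        have hLx : ∀ t ∈ L, w₁ t.1 = w t.1 := fun t ht =>
          e3 _ (fun e => hxL (e ▸ List.mem_map_of_mem ht)) (ne_of_val_lt_le (h1.pos t ht).1 hmc)
        refine ⟨L ++ [(x, c)], ⟨?_, ?_, ?_⟩, ?_, ?_, ?_, ?_⟩
        · refine inc_append.mpr ⟨h1.inc, ?_, trivial⟩
          rw [← h2, e1, e2]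
          simp only [Fin.lt_def]
          omega
        · intro t ht
          rcases List.mem_append.mp ht with ht | ht
          · exact h1.pos t ht
          · rw [List.mem_singleton.mp ht]
            exact ⟨hxm, hmc⟩
        · rw [List.map_append, List.map_cons, List.map_nil, List.nodup_append]
          refine ⟨h1.nodup, List.nodup_singleton _, fun y hy z hz => ?_⟩
          rw [List.mem_singleton.mp hz]
          rintro rfl
          exact hxL hy
        · rw [swapProd_append, swapProd_cons, swapProd_nil, mul_one, ← mul_assoc, ← h2, hmul]
        · rw [List.length_append, List.length_singleton]
          omega
        · have hins : ({b : Fin n | (b : ℕ) < m ∧ w c < w b} : Finset (Fin n)) =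
              insert x ({b : Fin n | (b : ℕ) < m ∧ w₁ c < w₁ b} : Finset (Fin n)) := by
            ext b
            rw [mem_filter_univ, mem_insert, mem_filter_univ]
            by_cases hbx : b = x
            · subst hbx
              exact ⟨fun _ => Or.inl rfl, fun _ => ⟨hxm, by simp only [Fin.lt_def]; omega⟩⟩
            · rw [or_iff_right hbx]
              refine and_congr_right fun hb => ?_
              rw [e2, e3 b hbx (ne_of_val_lt_le hb hmc)]
              have := hne b hbx
              simp only [Fin.lt_def]
              omega
          rw [hins, card_insert_of_notMem, ← h4, List.length_append, List.length_singleton]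
          rw [mem_filter_univ, e1, e2]
          simp only [Fin.lt_def]
          omega
        · intro t ht
          rcases List.mem_append.mp ht with ht | ht
          · have := h5 t ht
            rw [e2, hLx t ht] at this
            simp only [Fin.lt_def] at this ⊢
            omega
          · rw [List.mem_singleton.mp ht]
            simp only [Fin.lt_def]
            omega
      · intro i hi h
        by_cases hix : i = x
        · subst hix
          have := r2 i hi (by simp only [Fin.lt_def]; omega)
          rw [e1]
          exact Fin.ext (by omega)
        · rw [e3 i hix hi.ne] at h ⊢
          refine r1 i hi ?_
          rw [e2] at h
          have := hne' i hi.ne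
          simp only [Fin.lt_def] at h ⊢
          omega
      · intro i hi h
        have hix : i ≠ x := by
          rintro rfl
          rw [e1, e2] at h
          simp only [Fin.lt_def] at h
          omega
        rw [e3 i hix hi.ne] at h ⊢
        refine r2 i hi ?_
        rw [e2] at h
        simp only [Fin.lt_def] at h ⊢
        omega
      · intro i hi hci
        rw [e3]
        · exact r3 i hi hci
        · intro e
          simp only [Fin.lt_def, ← e] at hxc
          omega
        · intro e
          have := congrArg Fin.val e
          simp only at this
          omega
      · intro y z hy hyz
        have hzc : c < z := hy.trans_lt hyz
        rw [e3 z (hxc.trans hzc).ne' hzc.ne']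
        rcases eq_or_lt_of_le hy with rfl | hy
        · rw [e2]
          have h1 := hw c z le_rfl hyz
          have h2 := hne z (hxc.trans hzc).ne'
          simp only [Fin.lt_def] at h1 ⊢
          omega
        · rw [e3 y (hxc.trans hy).ne' hy.ne']
          exact hw y z hy.le hyz
      · intro y hy hyc
        rw [e3 y (ne_of_val_lt_le hxm hy).symm hyc.ne, e2]
        have := hw' y hy hyc
        simp only [Fin.lt_def] at this ⊢
        omega
    · omega
    · -- the value `w c + 1` is at `c + 1`: continue there
      have hcn : (c : ℕ) + 1 < n := by
        have := x.isLt
        simp only [Fin.lt_def] at hxc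
        omega
      have hxc1 : x = ⟨c + 1, hcn⟩ := by
        by_contra hne1
        have h1 : (⟨c + 1, hcn⟩ : Fin n) < x := by
          simp only [Fin.lt_def, Fin.ext_iff] at hxc hne1 ⊢
          omega
        have h2 := hw _ _ (by simp [Fin.le_def]) h1
        have h3 := hw c ⟨c + 1, hcn⟩ le_rfl (by simp [Fin.lt_def])
        simp only [Fin.lt_def] at h2 h3
        omega
      have hlt : ∀ i, i < x → i ≠ c → i < c := by
        intro i hi hic
        rw [hxc1] at hi
        simp only [Fin.lt_def, ne_eq, Fin.ext_iff] at hi hic ⊢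
        omega
      have key := ih (n - (w x : ℕ)) (by omega) (w := w) (c := x)
        ⟨?_, ?_, ?_, r4⟩ (by simp only [Fin.lt_def] at hxc; omega)
        (fun y z hy hyz => hw y z (hxc.le.trans hy) hyz) ?_ rfl
      · obtain ⟨L, h1, h2, h3, h4, h5⟩ := key
        refine ⟨L, h1, h2, h3, ?_, fun t ht => ?_⟩
        · rw [h4]
          congr 1
          ext b
          rw [mem_filter_univ, mem_filter_univ]
          refine and_congr_right fun hb => ?_
          have := hne b (ne_of_val_lt_le hb (by simp only [Fin.lt_def] at hxc; omega))
          simp only [Fin.lt_def]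
          omega
        · have := h5 t ht
          simp only [Fin.lt_def] at this ⊢
          omega
      · intro i hi h
        by_cases hic : i = c
        · subst hic
          have := r3 i hcn le_rfl
          rw [← hxc1] at this
          exact Fin.ext (by simp only [Fin.eta] at this; omega)
        · refine r1 i (hlt i hi hic) ?_
          have := hne' i hic
          simp only [Fin.lt_def] at h ⊢
          omega
      · intro i hi h
        have hic : i ≠ c := by
          rintro rfl
          simp only [Fin.lt_def] at h
          omega
        refine r2 i (hlt i hi hic) ?_
        simp only [Fin.lt_def] at h ⊢
        omega
      · intro i hi hxi
        exact r3 i hi (by simp only [Fin.lt_def] at hxc; omega)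
      · intro y hy hyx
        by_cases hyc : y = c
        · subst hyc
          simp only [Fin.lt_def]
          omega
        · have := hw' y hy (hlt y hyx hyc)
          simp only [Fin.lt_def] at this ⊢
          omega

theorem card_val_lt (m : ℕ) (hm : m ≤ n) : #{b : Fin n | (b : ℕ) < m} = m := by
  have hmap : ({j : Fin n | (j : ℕ) < m} : Finset (Fin n)).map Fin.valEmbedding = range m := by
    ext x
    simp only [mem_map, mem_filter_univ, Fin.valEmbedding_apply, mem_range]
    exact ⟨fun ⟨y, hy, e⟩ => e ▸ hy, fun hx => ⟨⟨x, by omega⟩, hx, rfl⟩⟩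
  rw [← card_map, hmap, card_range]

theorem card_lt_apply (hw : ∀ x y : Fin n, c ≤ x → x < y → w x < w y) :
    #{b : Fin n | (b : ℕ) < c ∧ w c < w b} = (c : ℕ) - (w c : ℕ) := by
  have h1 : #{b : Fin n | (b : ℕ) < c ∧ w b < w c} = (w c : ℕ) := by
    rw [← card_val_lt (n := n) (w c) (w c).isLt.le]
    refine card_equiv w fun b => ?_
    rw [mem_filter_univ, mem_filter_univ]
    refine ⟨fun h => h.2, fun h => ⟨?_, h⟩⟩
    by_contra hbc
    rcases eq_or_lt_of_le (Fin.le_def.mpr (not_lt.mp hbc)) with rfl | hlt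
    · exact lt_irrefl _ h
    · exact lt_asymm h (hw c b le_rfl hlt)
  have h2 := card_val_lt (n := n) c c.isLt.le
  rw [← card_filter_add_card_filter_not (p := fun b => w b < w c), filter_filter,
    filter_filter, h1] at h2
  rw [show ({b : Fin n | (b : ℕ) < c ∧ w c < w b} : Finset (Fin n)) =
    ({b : Fin n | (b : ℕ) < c ∧ ¬ w b < w c} : Finset (Fin n)) from ?_]
  · omega
  · ext b
    rw [mem_filter_univ, mem_filter_univ]
    refine and_congr_right fun hb => ?_
    have : w b ≠ w c := fun e => ne_of_val_lt_le hb le_rfl (w.injective e)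
    rw [not_lt, le_iff_lt_or_eq, or_iff_left this.symm]

/-- A saturated chain moves at most the first of the fixed positions on the right. -/
theorem Up.apply_eq {m j N : ℕ} {v : Equiv.Perm (Fin n)} (h : Up m j u v) (hmN : m ≤ N)
    (hu : ∀ x : Fin n, N ≤ (x : ℕ) → u x = x) (x : Fin n) (hx : N + 1 ≤ (x : ℕ)) : v x = x := by
  obtain ⟨⟨L, hl, hL, rfl⟩, hlen⟩ := h
  rw [hL.apply_snd_of_notMem (by omega), hu x (by omega)]
  intro hxL
  obtain ⟨t, ht, rfl⟩ := List.mem_map.mp hxL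
  -- the first pair with this second component may be applied to `u`, but that is no cover
  obtain ⟨hc, hprod⟩ := hL.partition (fun y => decide (y = t.2))
  set L₁ := L.filter (fun s => decide (s.2 = t.2)) with hL₁
  set L₂ := L.filter (fun s => !decide (s.2 = t.2))
  have htL : t ∈ L₁ := List.mem_filter.mpr ⟨ht, by simp⟩
  rcases hcase : L₁ with _ | ⟨s, L₃⟩
  · rw [hcase] at htL
    simp at htL
  have hs : s.2 = t.2 := by
    have : s ∈ L₁ := by rw [hcase]; exact List.mem_cons_self
    simpa using (List.mem_filter.mp this).2
  have hlen12 : (L₁ ++ L₂).length = j := by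
    rw [← hl]
    exact (List.filter_append_perm (fun s : Fin n × Fin n => decide (s.2 = t.2)) L).length_eq
  have hsat := (saturated_iff hc.pos).mpr ⟨hc.inc, by rw [hprod, hlen, hlen12]⟩ 1 le_rfl
    (by rw [hcase]; simp)
  have hpos := hc.pos s (by rw [hcase]; simp)
  have hinc : u s.1 < u s.2 := by
    have := hc.inc
    rw [hcase] at this
    exact this.1
  rw [hcase, List.cons_append, List.take_succ_cons, List.take_zero, swapProd_cons, swapProd_nil,
    mul_one, len_mul_swap (s.2 - s.1) u s.1 s.2 (by omega) hinc] at hsat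
  have hcard : #{x : Fin n | s.1 < x ∧ x < s.2 ∧ u s.1 < u x ∧ u x < u s.2} = 0 := by omega
  rw [card_eq_zero, filter_eq_empty_iff] at hcard
  rw [← hs] at hx
  have hN : N < n := by have := s.2.isLt; omega
  refine hcard (mem_univ (⟨N, hN⟩ : Fin n)) ⟨?_, ?_, ?_, ?_⟩
  · simp only [Fin.lt_def]; omega
  · simp only [Fin.lt_def]; omega
  · rw [hu ⟨N, hN⟩ le_rfl]
    by_contra hge
    have h1 : N ≤ (u s.1 : ℕ) := by simpa [Fin.lt_def] using hge
    have h2 := u.injective (hu _ h1)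
    rw [h2] at h1
    omega
  · rw [hu ⟨N, hN⟩ le_rfl, hu s.2 (by omega)]
    simp only [Fin.lt_def]; omega

end

/-! ### Permutations with prescribed descents and their pivots -/

section
variable {n k : ℕ} {a : Fin k → Fin n} {w u v : Equiv.Perm (Fin n)} {p : Fin k}

theorem IsIn.asc (hw : IsIn a w) {i : ℕ} (hi : i + 1 < n) (h : ∀ p, (a p : ℕ) ≠ i + 1) :
    Asc w i hi := by
  by_contra hd
  obtain ⟨p, hp⟩ := hw i hi (not_asc.mp hd)
  exact h p hp

theorem isIn_of_asc (h : ∀ i (hi : i + 1 < n), (∀ p, (a p : ℕ) ≠ i + 1) → Asc w i hi) :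
    IsIn a w := by
  intro i hi hd
  by_contra hne
  push Not at hne
  exact lt_asymm hd (h i hi hne)

theorem IsIn.le_apply (hw : IsIn a w) {M : ℕ} (hM : ∀ x : Fin n, (x : ℕ) = M → x ≤ w x)
    (hq : ∀ q, M < (a q : ℕ) → w (a q) = a q) (x : Fin n) (hx : M ≤ (x : ℕ)) : x ≤ w x := by
  obtain ⟨d, hd⟩ := Nat.exists_eq_add_of_le hx
  induction d generalizing x with
  | zero => exact hM x hd
  | succ d ih =>
    have hi : M + d + 1 < n := by have := x.isLt; omega
    obtain rfl : x = ⟨M + d + 1, hi⟩ := Fin.ext hd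
    by_cases hp : ∃ q, (a q : ℕ) = M + d + 1
    · obtain ⟨q, hq'⟩ := hp
      obtain heq : a q = ⟨M + d + 1, hi⟩ := Fin.ext hq'
      rw [← heq, hq q (by omega)]
    · push Not at hp
      have h1 := ih ⟨M + d, Nat.lt_of_succ_lt hi⟩ (by simp) rfl
      have h2 : _ < _ := hw.asc hi hp
      simp only [Fin.le_def, Fin.lt_def] at h1 h2 ⊢
      omega

theorem IsIn.exists_pivot (hw : IsIn a w) (h1 : w ≠ 1) : ∃ p, IsPivot a w p := by
  have hne : ({q : Fin k | w (a q) ≠ a q} : Finset (Fin k)).Nonempty := by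
    by_contra hemp
    rw [not_nonempty_iff_eq_empty, filter_eq_empty_iff] at hemp
    push Not at hemp
    refine h1 (Equiv.ext fun x => ?_)
    exact apply_eq_of_le (M := 0) (hw.le_apply (fun x hx => by
      simp only [Fin.le_def]
      omega) fun q _ => hemp (mem_univ q)) x (Nat.zero_le _)
  obtain ⟨p, hp, hmax⟩ := exists_max_image _ id hne
  refine ⟨p, (mem_filter.mp hp).2, fun q hq => ?_⟩
  by_contra hq'
  exact absurd (hmax q (mem_filter.mpr ⟨mem_univ q, hq'⟩)) (not_le_of_gt hq)

theorem IsPivot.unique {p' : Fin k} (h : IsPivot a w p) (h' : IsPivot a w p') : p = p' := by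
  rcases lt_trichotomy p p' with hlt | heq | hlt
  · exact absurd (h.2 p' hlt) h'.1
  · exact heq
  · exact absurd (h'.2 p hlt) h.1

theorem not_isPivot_one : ¬ IsPivot a 1 p := fun h => h.1 rfl

theorem next_le_of_lt (ha : StrictMono a) {q : Fin k} (h : p < q) : next a p ≤ a q := by
  have hp : (p : ℕ) + 1 < k := lt_of_le_of_lt h q.isLt
  rw [next, dif_pos hp]
  exact ha.monotone (Fin.le_def.mpr h)

theorem lt_next (ha : StrictMono a) (p : Fin k) : (a p : ℕ) < next a p := by
  rw [next]
  split_ifs with h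
  · exact ha (Fin.lt_def.mpr (Nat.lt_succ_self _))
  · exact (a p).isLt

theorem IsIn.apply_eq_of_next_le (ha : StrictMono a) (hw : IsIn a w)
    (hp : ∀ q, p < q → w (a q) = a q) (x : Fin n) (hx : next a p ≤ (x : ℕ)) : w x = x := by
  refine apply_eq_of_le (hw.le_apply (M := next a p) (fun x hx => ?_) fun q hq => ?_) x hx
  · rw [next] at hx
    split_ifs at hx with h
    · obtain rfl : x = a ⟨p + 1, h⟩ := Fin.ext hx
      rw [hp _ (Fin.lt_def.mpr (Nat.lt_succ_self _))]
    · exact absurd x.isLt (by omega)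
  · exact hp q (ha.lt_iff_lt.mp (Fin.lt_def.mpr ((lt_next ha p).trans hq)))

/-- The part of `w` from the pivot on is increasing. -/
theorem IsIn.apply_lt_apply (ha : StrictMono a) (hw : IsIn a w)
    (hp : ∀ q, p < q → w (a q) = a q) (x y : Fin n) (hx : a p ≤ x) (hxy : x < y) : w x < w y := by
  refine lt_of_asc (lo := a p) (up := n) (fun i hi hpi _ => ?_) hx hxy y.isLt.le
  by_cases h : ∃ q, (a q : ℕ) = i + 1
  · -- a later position of the sequence: everything from there on is fixed
    obtain ⟨q, hq⟩ := h
    have hpq : p < q := ha.lt_iff_lt.mp (Fin.lt_def.mpr (by omega))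
    have hfix : ∀ x : Fin n, i + 1 ≤ (x : ℕ) → w x = x := fun x hx =>
      hw.apply_eq_of_next_le ha hp x ((next_le_of_lt ha hpq).trans (hq ▸ hx))
    change w _ < w _
    rw [hfix ⟨i + 1, hi⟩ le_rfl]
    by_contra hge
    have h1 : i + 1 ≤ (w ⟨i, Nat.lt_of_succ_lt hi⟩ : ℕ) := by simpa [Fin.lt_def] using hge
    have h2 := congrArg Fin.val (w.injective (hfix _ h1))
    simp only at h2
    omega
  · push Not at h
    exact hw.asc hi h

theorem IsPivot.apply_lt (ha : StrictMono a) (hw : IsIn a w) (hp : IsPivot a w p) :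
    w (a p) < a p := by
  by_contra hge
  refine hp.1 (apply_eq_of_le
    (hw.le_apply (M := (a p : ℕ)) (fun x hx => ?_) fun q hq => ?_) _ le_rfl)
  · obtain rfl : x = a p := Fin.ext hx
    exact not_lt.mp hge
  · exact hp.2 q (ha.lt_iff_lt.mp hq)

/-! ### One step of the recursion -/

theorem mem_others : v ∈ others a w p u ↔ Up (a p : ℕ) (stepDegree a w p) u v ∧ v ≠ w := by
  have h : v ∈ others a w p u ↔ StepArrow a w p u v ∧ v ≠ w := by
    classical
    exact mem_filter.trans (and_iff_right (mem_univ v))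
  rw [h, StepArrow, pieriArrow_iff, Nat.add_sub_add_right]
  rfl

theorem up_of_isReduction (ha : StrictMono a) (hw : IsIn a w) (hp : IsPivot a w p)
    (hu : IsReduction a w p u) : Up (a p : ℕ) (stepDegree a w p) u w := by
  have hinc := hw.apply_lt_apply ha hp.2
  obtain ⟨L, h1, h2, h3, h4, -⟩ := IsRed.exists_chain (c := a p) hu le_rfl hinc
    fun x hx hx' => absurd hx (not_le_of_gt hx')
  have h5 : L.length = stepDegree a w p := h4.trans (card_lt_apply hinc)
  exact ⟨⟨L, h5, h1, h2⟩, h5 ▸ h3⟩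

theorem isIn_of_isReduction (ha : StrictMono a) (hw : IsIn a w) (hp : IsPivot a w p)
    (hu : IsReduction a w p u) : IsIn a u := by
  have hinc := hw.apply_lt_apply ha hp.2
  obtain ⟨r1, r2, r3, r4⟩ := hu
  refine isIn_of_asc fun i hi hne => ?_
  have hpne := hne p
  rcases Nat.lt_or_ge (i + 1) (a p) with h | h
  · have hasc : w _ < w _ := hw.asc hi hne
    have hval : ∀ x : Fin n, x < a p → ((w x < w (a p) ∧ (u x : ℕ) = w x) ∨
        (w (a p) < w x ∧ (u x : ℕ) = w x - 1)) := by
      intro x hx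
      rcases lt_trichotomy (w x) (w (a p)) with h1 | h1 | h1
      · exact Or.inl ⟨h1, congrArg Fin.val (r1 x hx h1)⟩
      · exact absurd (w.injective h1) hx.ne
      · exact Or.inr ⟨h1, r2 x hx h1⟩
    have v1 := hval ⟨i, Nat.lt_of_succ_lt hi⟩ (by simp only [Fin.lt_def]; omega)
    have v2 := hval ⟨i + 1, hi⟩ (by simp only [Fin.lt_def]; omega)
    change u _ < u _
    simp only [Fin.lt_def] at v1 v2 hasc ⊢
    omega
  · have hle : (a p : ℕ) ≤ i := by omega
    have e1 := r3 i hi hle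
    change u _ < u _
    by_cases hi2 : i + 1 + 1 < n
    · have e2 := r3 (i + 1) hi2 (by omega)
      have h1 := hinc ⟨i + 1, hi⟩ ⟨i + 1 + 1, hi2⟩ h (by simp [Fin.lt_def])
      have h2 := hinc (a p) ⟨i + 1, hi⟩ le_rfl (by simp only [Fin.lt_def]; omega)
      simp only [Fin.lt_def] at h1 h2 ⊢
      omega
    · have e2 := r4 ⟨i + 1, hi⟩ (by simp only; omega)
      rw [e2]
      have h1 : u ⟨i, Nat.lt_of_succ_lt hi⟩ ≠ ⟨i + 1, hi⟩ := by
        intro e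
        have := congrArg Fin.val (u.injective (e.trans e2.symm))
        simp at this
      have h2 := (u ⟨i, Nat.lt_of_succ_lt hi⟩).isLt
      simp only [Fin.lt_def, ne_eq, Fin.ext_iff] at h1 ⊢
      omega

/-- A chain across `a p` does not lead out of the permutations with the prescribed descents. -/
theorem Up.isIn {j : ℕ} (h : Up (a p : ℕ) j u v) (hu : IsIn a u) : IsIn a v :=
  isIn_of_asc fun _ hi hne => h.asc (hne p).symm (hu.asc hi hne)

theorem IsReduction.apply_eq (hu : IsReduction a w p u) {M : ℕ} (hM : (a p : ℕ) < M)
    (hw : ∀ x : Fin n, M ≤ (x : ℕ) → w x = x) (x : Fin n) (hx : M - 1 ≤ (x : ℕ)) : u x = x := by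
  by_cases hn : (x : ℕ) + 1 < n
  · have := hu.2.2.1 x hn (by omega)
    rw [hw _ (by simp only; omega)] at this
    exact Fin.ext this
  · exact hu.2.2.2 x (by have := x.isLt; omega)

theorem schubert_recursion (ha : StrictMono a) (hw : IsIn a w) (hp : IsPivot a w p)
    (hu : IsReduction a w p u) :
    schubert w = schubert u * elemSym (a p) (stepDegree a w p) -
      ∑ v ∈ others a w p u, schubert v := by
  classical
  rw [schubert_mul_elemSym hu.2.2.2]
  have : (univ.filter fun v => Up (a p : ℕ) (stepDegree a w p) u v) =
      insert w (others a w p u) := by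
    ext v
    rw [mem_filter_univ, mem_insert, mem_others]
    by_cases hvw : v = w
    · subst hvw
      exact ⟨fun _ => Or.inl rfl, fun _ => up_of_isReduction ha hw hp hu⟩
    · simp [hvw]
  rw [this, sum_insert fun h => (mem_others.mp h).2 rfl, add_sub_cancel_right]

/-! ### Termination -/

/-- Among permutations of the same length and with the same pivot `p`, the recursive calls lower the
value at `a p`, or keep it and raise the sum of the values to the left of `a p`. The two quantities
are combined lexicographically, the sum being at most `n * n`. -/
def callMeasure {n k : ℕ} (a : Fin k → Fin n) (p : Fin k) (w : Equiv.Perm (Fin n)) : ℕ :=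
  (w (a p) : ℕ) * (n * n + 1) + (n * n - ∑ b with b < a p, (w b : ℕ))

theorem sum_apply_le (s : Finset (Fin n)) (w : Equiv.Perm (Fin n)) :
    ∑ b ∈ s, (w b : ℕ) ≤ n * n := by
  refine (sum_le_card_nsmul s _ n fun b _ => (w b).isLt.le).trans ?_
  exact Nat.mul_le_mul_right n ((card_le_univ s).trans (by simp))

theorem eq_of_eq_of_lt {m : Fin n} (h : ∀ x < m, v x = w x)
    (hv : ∀ x y, m ≤ x → x < y → v x < v y) (hw : ∀ x y, m ≤ x → x < y → w x < w y) : v = w := by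
  have h1 : ∀ x < m, (v⁻¹ * w) x = x := fun x hx => by
    rw [Equiv.Perm.mul_apply, Equiv.Perm.inv_eq_iff_eq, h x hx]
  have h2 : ∀ x, m ≤ x → m ≤ (v⁻¹ * w) x := fun x hx => by
    by_contra hlt
    exact hlt (((v⁻¹ * w).injective (h1 _ (not_le.mp hlt))).symm ▸ hx)
  have h3 : v⁻¹ * w = 1 := by
    refine eq_one_of_asc fun i hi => ?_
    change (v⁻¹ * w) _ < (v⁻¹ * w) _
    have hii : (⟨i, Nat.lt_of_succ_lt hi⟩ : Fin n) < ⟨i + 1, hi⟩ := Nat.lt_succ_self i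
    rcases lt_or_ge (⟨i + 1, hi⟩ : Fin n) m with hlt | hge
    · rw [h1 _ hlt, h1 _ (hii.trans hlt)]
      exact hii
    rcases lt_or_ge (⟨i, Nat.lt_of_succ_lt hi⟩ : Fin n) m with hlt | hge'
    · rw [h1 _ hlt]
      exact hlt.trans_le (h2 _ hge)
    · by_contra hle
      have hvw : ∀ x, v ((v⁻¹ * w) x) = w x := fun x => v.apply_symm_apply (w x)
      have h4 := hw _ _ hge' hii
      rcases eq_or_lt_of_le (not_lt.mp hle) with he | hlt
      · exact hii.ne ((v⁻¹ * w).injective he).symm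
      · have := hv _ _ (h2 _ hge) hlt
        rw [hvw, hvw] at this
        exact lt_asymm this h4
  rw [inv_mul_eq_one] at h3
  exact h3

/-- A call from `w` to a permutation of the same length keeps the pivot and lowers the measure. If
the chain from `u` to `v` moves a position at which `u` has a value below `w (a p)`, then `v` has
at `a p` a value below `w (a p)`. Otherwise it moves the same positions as the chain from `u` to
`w`, and as that chain raises each of their values by one only, `v` is nowhere below `w`
on the left. -/
theorem callMeasure_lt (ha : StrictMono a) (hw : IsIn a w) (hp : IsPivot a w p)
    (hu : IsReduction a w p u) (hv : v ∈ others a w p u) :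
    IsPivot a v p ∧ callMeasure a p v < callMeasure a p w := by
  obtain ⟨hup, hne⟩ := mem_others.mp hv
  have hvin := hup.isIn (isIn_of_isReduction ha hw hp hu)
  have hnext := lt_next ha p
  have hufix := hu.apply_eq hnext (hw.apply_eq_of_next_le ha hp.2)
  have hvfix : ∀ q, p < q → v (a q) = a q := fun q hq =>
    hup.apply_eq (N := next a p - 1) (by omega) hufix _ (by have := next_le_of_lt ha hq; omega)
  have hwinc := hw.apply_lt_apply ha hp.2
  have hvinc := hvin.apply_lt_apply ha hvfix
  have hvle : ∀ c : Fin n, (a p : ℕ) ≤ c → v (a p) ≤ v c := fun c hc => by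
    rcases eq_or_lt_of_le (Fin.le_def.mpr hc) with rfl | h
    · exact le_rfl
    · exact (hvinc _ _ le_rfl h).le
  have hwlt := hp.apply_lt ha hw
  obtain ⟨⟨L, hl, hL, rfl⟩, -⟩ := hup
  set v := u * swapProd L with hvdef
  have hsumv := sum_apply_le ({b : Fin n | b < a p} : Finset (Fin n)) v
  by_cases hcase : ∃ b ∈ L.map Prod.fst, u b < w (a p)
  · -- a value below `w (a p)` is moved to the right
    obtain ⟨b, hb, hlt⟩ := hcase
    obtain ⟨c, hc, hle⟩ := hL.exists_apply_le hb
    have h1 : v (a p) < w (a p) := (hvle c hc).trans_lt (hle.trans_lt hlt)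
    refine ⟨⟨(h1.trans hwlt).ne, hvfix⟩, ?_⟩
    have h2 : ((v (a p) : ℕ) + 1) * (n * n + 1) ≤ (w (a p) : ℕ) * (n * n + 1) :=
      Nat.mul_le_mul_right _ h1
    rw [callMeasure, callMeasure]
    rw [add_mul, one_mul] at h2
    omega
  · -- the same positions are moved as on the way to `w`
    push Not at hcase
    have hsub : (L.map Prod.fst).toFinset ⊆
        ({b : Fin n | (b : ℕ) < a p ∧ w (a p) < w b} : Finset (Fin n)) := by
      intro b hb
      rw [List.mem_toFinset] at hb
      have hge := hcase b hb
      obtain ⟨t, ht, rfl⟩ := List.mem_map.mp hb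
      have hlt := (hL.pos t ht).1
      rw [mem_filter_univ]
      refine ⟨hlt, ?_⟩
      rcases lt_trichotomy (w t.1) (w (a p)) with h1 | h1 | h1
      · rw [hu.1 _ hlt h1] at hge
        exact absurd h1 (not_lt.mpr hge)
      · exact absurd (w.injective h1) (ne_of_val_lt_le hlt le_rfl)
      · exact h1
    have hcard : (L.map Prod.fst).toFinset =
        ({b : Fin n | (b : ℕ) < a p ∧ w (a p) < w b} : Finset (Fin n)) := by
      refine eq_of_subset_of_card_le hsub ?_
      rw [card_lt_apply hwinc, List.toFinset_card_of_nodup hL.nodup, List.length_map, hl]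
      rfl
    have hmem : ∀ b : Fin n, b < a p → (b ∈ L.map Prod.fst ↔ w (a p) < w b) := by
      intro b hb
      rw [← List.mem_toFinset, hcard, mem_filter_univ]
      exact and_iff_right hb
    have hlow : ∀ b : Fin n, b < a p → w b < w (a p) → v b = w b := by
      intro b hb h1
      rw [hvdef, hL.apply_fst_of_notMem hb fun h => lt_asymm h1 ((hmem b hb).mp h), hu.1 b hb h1]
    have hge : ∀ b : Fin n, b < a p → w b ≤ v b := by
      intro b hb
      rcases lt_trichotomy (w b) (w (a p)) with h1 | h1 | h1
      · rw [hlow b hb h1]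
      · exact absurd (w.injective h1) hb.ne
      · have h2 := hL.lt_apply ((hmem b hb).mpr h1)
        have h3 := hu.2.1 b hb h1
        rw [← hvdef] at h2
        simp only [Fin.lt_def, Fin.le_def] at h2 ⊢
        omega
    have hq : v (a p) ≤ w (a p) := by
      obtain ⟨x, hx⟩ := v.surjective (w (a p))
      rcases lt_or_ge x (a p) with h | h
      · exfalso
        have h1 := hge x h
        rw [hx] at h1
        have h2 := lt_of_le_of_ne h1 fun e => h.ne (w.injective e)
        rw [hlow x h h2] at hx
        exact h2.ne hx
      · rw [← hx]
        exact hvle x h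
    refine ⟨⟨(hq.trans_lt hwlt).ne, hvfix⟩, ?_⟩
    have hsum : ∑ b with b < a p, (w b : ℕ) < ∑ b with b < a p, (v b : ℕ) := by
      refine sum_lt_sum (fun b hb => hge b (mem_filter.mp hb).2) ?_
      by_contra hall
      push Not at hall
      refine hne (eq_of_eq_of_lt (m := a p) (fun x hx => ?_) hvinc hwinc)
      exact le_antisymm (hall x ((mem_filter_univ _).mpr hx)) (hge x hx)
    have h2 : (v (a p) : ℕ) * (n * n + 1) ≤ (w (a p) : ℕ) * (n * n + 1) :=
      Nat.mul_le_mul_right _ hq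
    rw [callMeasure, callMeasure]
    omega

/-- The call to the reduction `u` lowers the length; the others keep it and lower `callMeasure`. -/
theorem acc_calls (ha : StrictMono a) (w : Equiv.Perm (Fin n)) (hw : IsIn a w) :
    Acc (Calls a) w := by
  induction hl : len w using Nat.strong_induction_on generalizing w with
  | _ l ih =>
    have inner : ∀ (N : ℕ) (p : Fin k) (w : Equiv.Perm (Fin n)), IsIn a w → len w = l →
        IsPivot a w p → callMeasure a p w = N → Acc (Calls a) w := by
      intro N p
      induction N using Nat.strong_induction_on with
      | _ N ihN =>
        intro w hw hlw hp hN
        refine Acc.intro w ?_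
        rintro v ⟨p', u, hp', hu, hv⟩
        obtain rfl := hp.unique hp'
        have hlt := hp.apply_lt ha hw
        have hlen := (up_of_isReduction ha hw hp hu).2
        rw [stepDegree] at hlen
        simp only [Fin.lt_def] at hlt
        have huin := isIn_of_isReduction ha hw hp hu
        rcases hv with rfl | hv
        · exact ih _ (by omega) _ huin rfl
        · obtain ⟨h1, h2⟩ := callMeasure_lt ha hw hp hu hv
          have hup := (mem_others.mp hv).1
          have hlen' := hup.2
          rw [stepDegree] at hlen'
          exact ihN _ (hN ▸ h2) v (hup.isIn huin) (by omega) h1 rfl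
    refine Acc.intro w ?_
    rintro v ⟨p, u, hp, hu, hv⟩
    exact (inner _ p w hw hl hp rfl).inv ⟨p, u, hp, hu, hv⟩

/-! ### The result of the recursion -/

theorem IsIn.exists_isReduction (ha : StrictMono a) (hw : IsIn a w) (hp : IsPivot a w p) :
    ∃ u, IsReduction a w p u :=
  exists_isRed (hw.apply_lt_apply ha hp.2)

theorem IsReduction.unique {u' : Equiv.Perm (Fin n)} (h : IsReduction a w p u)
    (h' : IsReduction a w p u') : u = u' :=
  IsRed.unique (c := a p) h h'

theorem existsUnique_expands (ha : StrictMono a) (w : Equiv.Perm (Fin n)) (hw : IsIn a w) :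
    ∃! F, Expands a w F := by
  induction acc_calls ha w hw with
  | intro w _ ih =>
    by_cases h1 : w = 1
    · subst h1
      refine ⟨1, .one, fun F hF => ?_⟩
      cases hF with
      | one => rfl
      | step w p u F G hp => exact absurd hp not_isPivot_one
    · obtain ⟨p, hp⟩ := hw.exists_pivot h1
      obtain ⟨u, hu⟩ := hw.exists_isReduction ha hp
      have huin := isIn_of_isReduction ha hw hp hu
      obtain ⟨F, hF, hFu⟩ := ih u ⟨p, u, hp, hu, Or.inl rfl⟩ huin
      have hother : ∀ v ∈ others a w p u, ∃! G, Expands a v G := fun v hv =>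
        ih v ⟨p, u, hp, hu, Or.inr hv⟩ ((mem_others.mp hv).1.isIn huin)
      choose! G hG hGu using hother
      refine ⟨_, .step w p u F G hp hu hF hG, fun F' hF' => ?_⟩
      cases hF' with
      | one => exact absurd rfl h1
      | step _ p' u' F' G' hp' hu' hF' hG' =>
        obtain rfl := hp.unique hp'
        obtain rfl := IsReduction.unique hu hu'
        rw [hFu F' hF', sum_congr rfl fun v hv => hGu v hv (G' v) (hG' v hv)]

/-- Evaluation of the formal symbols. -/
noncomputable def evalSymbol {n k : ℕ} (a : Fin k → Fin n) :
    MvPolynomial (Fin k × ℕ) ℤ →ₐ[ℤ] MvPolynomial (Fin n) ℤ :=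
  aeval fun x => elemSym (a x.1) x.2

theorem evalSymbol_eSymbol (p : Fin k) (j : ℕ) : evalSymbol a (eSymbol p j) = elemSym (a p) j := by
  rw [eSymbol]
  split_ifs with h
  · rw [h, elemSym_eq, elemFirst_zero_right, map_one]
  · exact aeval_X _ _

theorem evalSymbol_eProdSymbol (i : Fin n → ℕ) : evalSymbol a (eProdSymbol a i) = eProd a i := by
  simp only [eProdSymbol, eProd, map_prod, evalSymbol_eSymbol]

theorem Expands.evalSymbol_eq (ha : StrictMono a) {F : MvPolynomial (Fin k × ℕ) ℤ}
    (h : Expands a w F) (hw : IsIn a w) : evalSymbol a F = schubert w := by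
  induction h with
  | one => rw [map_one, schubert_one]
  | step w p u F G hp hu hF hG ihF ihG =>
    have huin := isIn_of_isReduction ha hw hp hu
    rw [schubert_recursion ha hw hp hu, map_sub, map_mul, evalSymbol_eSymbol, ihF huin, map_sum]
    congr 1
    exact sum_congr rfl fun v hv => ihG v hv ((mem_others.mp hv).1.isIn huin)

/-- The admissible sequences whose entries vanish from the index `M` on. -/
def admissibleBelow {n k : ℕ} (a : Fin k → Fin n) (M : ℕ) : Set (Fin n → ℕ) :=
  {i | Admissible a i ∧ ∀ r : Fin n, M ≤ (r : ℕ) → i r = 0}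

theorem block_unique (ha : StrictMono a) {q : Fin k} {r : Fin n} (hp : r ∈ block a p)
    (hq : r ∈ block a q) : p = q := by
  rw [block, mem_filter_univ] at hp hq
  have h1 := Fin.le_def.mp hp.1
  have h2 := Fin.le_def.mp hq.1
  rcases lt_trichotomy p q with h | h | h
  · have := next_le_of_lt ha h
    omega
  · exact h
  · have := next_le_of_lt ha h
    omega

/-- An unused index in the block of `p` takes up one more factor. -/
theorem eProdSymbol_update (ha : StrictMono a) {i : Fin n → ℕ} {r : Fin n} (hr : r ∈ block a p)
    (hi : i r = 0) (j : ℕ) :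
    eProdSymbol a (Function.update i r j) = eProdSymbol a i * eSymbol p j := by
  have h1 : ∀ q, ∀ s ∈ block a q, eSymbol q (Function.update i r j s) =
      eSymbol q (i s) * if s = r then eSymbol p j else 1 := by
    intro q s hs
    by_cases hsr : s = r
    · subst hsr
      obtain rfl := block_unique ha hr hs
      rw [Function.update_self, if_pos rfl, hi, eSymbol, eSymbol, if_pos rfl, one_mul]
    · rw [Function.update_of_ne hsr, if_neg hsr, mul_one]
  have h2 : ∀ q, (∏ s ∈ block a q, if s = r then eSymbol p j else 1) =
      if q = p then eSymbol p j else 1 := by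
    intro q
    rw [prod_ite_eq']
    refine if_congr ⟨fun h => block_unique ha h hr, ?_⟩ rfl rfl
    rintro rfl
    exact hr
  simp only [eProdSymbol]
  rw [prod_congr rfl fun q _ => prod_congr rfl (h1 q)]
  simp only [prod_mul_distrib, h2]
  rw [prod_ite_eq' univ p, if_pos (mem_univ p)]

/-- If `w` fixes everything from `M` on, the symbols with index at least `M` are not used: `u` fixes
everything from `M - 1` on, so that the index `M - 1`, taken in the block of the pivot, is free for
the factor of this step, and the other `v` fix everything from `M` on. -/
theorem Expands.mem_span (ha : StrictMono a) {F : MvPolynomial (Fin k × ℕ) ℤ}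
    (h : Expands a w F) (hw : IsIn a w) {M : ℕ} (hM : ∀ x : Fin n, M ≤ (x : ℕ) → w x = x) :
    F ∈ Submodule.span ℤ (eProdSymbol a '' admissibleBelow a M) := by
  induction h generalizing M with
  | one =>
    refine Submodule.subset_span
      ⟨0, ⟨⟨fun _ _ _ => Nat.zero_le _, fun _ _ => rfl⟩, fun _ _ => rfl⟩, ?_⟩
    simp [eProdSymbol, eSymbol]
  | step w p u F G hp hu hF hG ihF ihG =>
    have huin := isIn_of_isReduction ha hw hp hu
    have hpM : (a p : ℕ) < M := by
      by_contra hge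
      exact hp.1 (hM _ (not_lt.mp hge))
    have hnext := lt_next ha p
    -- the index `M' - 1` lies in the block of `p`
    obtain ⟨M', hM', hpM', hMM', hMn⟩ : ∃ M', (∀ x : Fin n, M' ≤ (x : ℕ) → w x = x) ∧
        (a p : ℕ) < M' ∧ M' ≤ M ∧ M' ≤ next a p := by
      refine ⟨min M (next a p), fun x hx => ?_, lt_min hpM hnext, min_le_left _ _, min_le_right _ _⟩
      rcases min_le_iff.mp hx with h | h
      · exact hM x h
      · exact hw.apply_eq_of_next_le ha hp.2 x h
    have hufix := hu.apply_eq hpM' hM'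
    have hnn : next a p ≤ n := by
      rw [next]
      split_ifs
      · exact (a _).isLt.le
      · exact le_rfl
    refine Submodule.sub_mem _ ?_ (Submodule.sum_mem _ fun v hv => ?_)
    · have hFmem := ihF huin hufix
      clear ihF hF
      induction hFmem using Submodule.span_induction with
      | mem x hx =>
        obtain ⟨i, ⟨⟨hi1, hi2⟩, hi3⟩, rfl⟩ := hx
        set r : Fin n := ⟨M' - 1, by omega⟩ with hr
        have hrb : r ∈ block a p := by
          rw [block, mem_filter_univ, Fin.le_def]
          simp only [hr]
          omega
        rw [← eProdSymbol_update ha hrb (hi3 r le_rfl)]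
        refine Submodule.subset_span ⟨_, ⟨⟨fun q s hs => ?_, fun s hs => ?_⟩, fun s hs => ?_⟩, rfl⟩
        · by_cases hsr : s = r
          · subst hsr
            obtain rfl := block_unique ha hrb hs
            rw [Function.update_self]
            exact Nat.sub_le _ _
          · rw [Function.update_of_ne hsr]
            exact hi1 q s hs
        · rw [Function.update_of_ne, hi2 s hs]
          rintro rfl
          have := hs p
          simp only [Fin.lt_def, hr] at this
          omega
        · rw [Function.update_of_ne, hi3 s (by omega)]
          rintro rfl
          simp only [hr] at hs
          omega
      | zero =>
        rw [zero_mul]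
        exact Submodule.zero_mem _
      | add x y _ _ hx hy =>
        rw [add_mul]
        exact Submodule.add_mem _ hx hy
      | smul z x _ hx =>
        rw [smul_mul_assoc]
        exact Submodule.smul_mem _ z hx
    · have hup := (mem_others.mp hv).1
      exact ihG v hv (hup.isIn huin) fun x hx =>
        hup.apply_eq (N := M' - 1) (by omega) hufix x (by omega)

end

end Schub

theorem mainTheorem3 {n k : ℕ} (a : Fin k → Fin n) (ha : StrictMono a)
    (ha0 : ∀ p, 0 < (a p : ℕ)) (w : Equiv.Perm (Fin n)) (hw : Schub.IsIn a w) :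
    -- the recursive identity holds at every `w ≠ 1`, and leads to permutations in `S_n(a)` only
    (w ≠ 1 → ∃ (p : Fin k) (u : Equiv.Perm (Fin n)),
      Schub.IsPivot a w p ∧ Schub.IsReduction a w p u ∧ Schub.IsIn a u ∧
      w (a p) < a p ∧ Schub.StepArrow a w p u w ∧
      (∀ v ∈ Schub.others a w p u, Schub.IsIn a v) ∧
      Schub.schubert w =
        Schub.schubert u * Schub.elemSym (a p) (Schub.stepDegree a w p)
          - ∑ v ∈ Schub.others a w p u, Schub.schubert v) ∧
    -- the recursion terminates: no infinite chain of calls, and exactly one result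
    Acc (Schub.Calls a) w ∧
    (∃! F : MvPolynomial (Fin k × ℕ) ℤ, Schub.Expands a w F) ∧
    -- the result has the required form, and represents the Schubert polynomial
    (∀ F : MvPolynomial (Fin k × ℕ) ℤ, Schub.Expands a w F →
      ∃ c : (Fin n → ℕ) →₀ ℤ, (∀ i ∈ c.support, Schub.Admissible a i) ∧
        F = c.sum (fun i z => z • Schub.eProdSymbol a i) ∧
        Schub.schubert w = c.sum (fun i z => z • Schub.eProd a i)) := by
  refine ⟨fun h1 => ?_, Schub.acc_calls ha w hw, Schub.existsUnique_expands ha w hw, fun F hF => ?_⟩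
  · obtain ⟨p, hp⟩ := hw.exists_pivot h1
    obtain ⟨u, hu⟩ := hw.exists_isReduction ha hp
    have huin := Schub.isIn_of_isReduction ha hw hp hu
    refine ⟨p, u, hp, hu, huin, hp.apply_lt ha hw, ?_,
      fun v hv => (Schub.mem_others.mp hv).1.isIn huin, Schub.schubert_recursion ha hw hp hu⟩
    rw [Schub.StepArrow, Schub.pieriArrow_iff, Nat.add_sub_add_right]
    exact Schub.up_of_isReduction ha hw hp hu
  · have hmem := hF.mem_span ha hw (M := n) fun x hx => absurd x.isLt (not_lt.mpr hx)
    rw [Finsupp.mem_span_image_iff_linearCombination] at hmem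
    obtain ⟨c, hc, rfl⟩ := hmem
    refine ⟨c, fun i hi => (hc hi).1, Finsupp.linearCombination_apply _ _, ?_⟩
    rw [← hF.evalSymbol_eq ha hw, Finsupp.linearCombination_apply, Finsupp.sum, Finsupp.sum,
      map_sum]
    exact Finset.sum_congr rfl fun i _ => by rw [map_smul, Schub.evalSymbol_eProdSymbol]
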